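/- Let $K$ be any field. Let $X=(x_{ij})$ and $Y=(y_{ij})$ be generic matrices of sizes $2\times 4$ and $4\times 8$, let $J\subset K[x_{ij},y_{ij}]$ be the ideal generated by the entries of $XY$ and all $3\times 3$ minors of $Y$, and let $R_2=K[x_{ij},y_{ij}]/J$ (Bruns's ring $K((2,4,8),(2,2))$). Let $f$ be the $2\times 2$ minor of $X$ on columns $3,4$; for each pair $\sigma$ of columns let $g_\sigma$ be the $2\times 2$ minor of $Y$ on rows $1,2$ and columns $\sigma$; and let $R=R_2[\{g_\sigma/f\}_\sigma]$, the $R_2$-subalgebra of $R_2[1/f]$ generated by the elements $g_\sigma/f$. Let $P$ be the ideal of $R$ generated by all $x_{ij}$, $y_{ij}$ and $g_\sigma/f$. Let $S=K[s,t]/(s^2,st,t^2)$, $N=S^2/((t,0),(0,s),(s,t))S$, and $$\overline X=\begin{pmatrix} sI_2 & tI_2\end{pmatrix},\qquad \overline Y=\begin{pmatrix} sI_4 & tI_4\end{pmatrix},$$ matrices of sizes $2\times 4$ and $4\times 8$ over $S$. Then $R$ is a finitely generated $K$-algebra, $P$ is a maximal ideal with $R/P=K$, and the entries of $X$ and $Y$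 lie in $P$ and are $K$-linearly independent modulo $P^2$. Moreover, let $A$ be any one of the rings $R$, the localization $R_P$, and the completion $\widehat{R_P}$ of $R_P$ at its maximal ideal, and let $M=A^8/(A^4)Y$ (row vectors, with $X$ and $Y$ regarded as matrices over $A$). Then: 1. $A$ is Noetherian, and $0\to A^2\xrightarrow{X}A^4\xrightarrow{Y}A^8$ is exact; 2. $M$ has projective dimension exactly $2$ over $A$; 3. there is a $K$-algebra homomorphism $\varphi:A\to S$ that takes $X$ to $\overline X$ and $Y$ to $\overline Y$; and for every such $\varphi$, the module $N$, regarded as an $A$-module through $\varphi$, has length $3$, and $\operatorname{Tor}_1^A(M,N)=0$ but $\operatorname{Tor}_2^A(M,N)\neq 0$; 4. $M$ is not rigid: it is not true that, for every finitely generated $A$-module $N'$ and every $i$, $\operatorname{Tor}_i^A(M,N')=0$ implies $\operatorname{Tor}_j^A(M,N')=0$ for all $j\ge i$. The ring $\widehat{R_P}$ is local. Consequently the Peskine–Szpiro rigidity conjecture (every finitely generated module of finite projective dimension over a Noetherian ring is rigid) is false. -/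

import Mathlib

universe u

open CategoryTheory CategoryTheory.Limits

noncomputable section

/-! ### Tor, rigidity, and the rigidity conjecture -/

/-- `Tor_i^R(M, N)`, computed by a projective resolution of `M`. -/
abbrev torModule {R : Type u} [CommRing R] (i : ℕ) (M N : ModuleCat.{u} R) : ModuleCat.{u} R :=
  ((Tor' (ModuleCat.{u} R) i).obj M).obj N

/-- `M` is rigid if for every `R`-module `N` of finite type, `Tor_i^R(M, N) = 0` implies
`Tor_j^R(M, N) = 0` for all `j ≥ i`. -/
def IsRigidModule {R : Type u} [CommRing R] (M : ModuleCat.{u} R) : Prop :=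
  ∀ N : ModuleCat.{u} R, Module.Finite R N →
    ∀ i : ℕ, IsZero (torModule i M N) → ∀ j : ℕ, i ≤ j → IsZero (torModule j M N)

/-- The Peskine-Szpiro rigidity conjecture: every module of finite type and finite projective
dimension over a Noetherian ring is rigid. -/
def RigidityConjecture : Prop :=
  ∀ (R : Type u) [CommRing R] [IsNoetherianRing R] (M : ModuleCat.{u} R),
    Module.Finite R M → projectiveDimension M ≠ ⊤ → IsRigidModule M

/-- The cokernel `R^n / (R^m)Y` of a matrix acting on row vectors from the right. -/
abbrev rowCokernel {R : Type u} [CommRing R] {m n : ℕ} (Y : Matrix (Fin m) (Fin n) R) :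
    ModuleCat.{u} R :=
  ModuleCat.of R ((Fin n → R) ⧸ LinearMap.range Y.vecMulLinear)

namespace RigidityCounterexample

variable (K : Type u) [Field K]

/-! ### Bruns's ring `K((2,4,8),(2,2))` -/

/-- Indices of the entries of a `2 × 4` and of a `4 × 8` matrix. -/
abbrev EntryIndex : Type := (Fin 2 × Fin 4) ⊕ (Fin 4 × Fin 8)

/-- The polynomial ring `K[x_ij, y_ij]`. -/
abbrev PolyRing : Type u := MvPolynomial EntryIndex K

/-- The generic `2 × 4` matrix. -/
def polyX : Matrix (Fin 2) (Fin 4) (PolyRing K) :=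
  Matrix.of fun i j => MvPolynomial.X (Sum.inl (i, j))

/-- The generic `4 × 8` matrix. -/
def polyY : Matrix (Fin 4) (Fin 8) (PolyRing K) :=
  Matrix.of fun i j => MvPolynomial.X (Sum.inr (i, j))

/-- The ideal generated by the entries of `XY` and the `3 × 3` minors of `Y`.  (Index functions
that are not strictly increasing only contribute `0` or a minor up to sign.) -/
def brunsIdeal : Ideal (PolyRing K) :=
  Ideal.span
    ({p | ∃ i j, p = (polyX K * polyY K) i j} ∪
      {p | ∃ (a : Fin 3 → Fin 4) (b : Fin 3 → Fin 8), p = ((polyY K).submatrix a b).det})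

/-- Bruns's ring `K((2,4,8),(2,2))`. -/
abbrev BrunsRing : Type u := PolyRing K ⧸ brunsIdeal K

def brunsX : Matrix (Fin 2) (Fin 4) (BrunsRing K) :=
  (polyX K).map (Ideal.Quotient.mk (brunsIdeal K))

def brunsY : Matrix (Fin 4) (Fin 8) (BrunsRing K) :=
  (polyY K).map (Ideal.Quotient.mk (brunsIdeal K))

/-! ### Adjoining the `u`-elements -/

/-- `f`, the `2 × 2` minor of `X` on columns 3 and 4. -/
def minorF : BrunsRing K := ((brunsX K).submatrix ![0, 1] ![2, 3]).det

/-- `g_σ`, the `2 × 2` minor of `Y` on rows 1 and 2 and the columns `σ`. -/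
def minorG (σ : Fin 8 × Fin 8) : BrunsRing K :=
  ((brunsY K).submatrix ![0, 1] ![σ.1, σ.2]).det

/-- The `u`-element `g_σ / f`, as an element of the localization of Bruns's ring at `f`. -/
def uElement (σ : Fin 8 × Fin 8) : Localization.Away (minorF K) :=
  Localization.mk (minorG K σ) ⟨minorF K, Submonoid.mem_powers _⟩

/-- The ring `R`: Bruns's ring with all `g_σ / f` adjoined, inside the localization of Bruns's
ring at `f`.  (Pairs `σ` that are not strictly increasing only contribute `0` or `-g_τ / f`.) -/
def HRing : Type u := ↥(Algebra.adjoin (BrunsRing K) (Set.range (uElement K)))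

instance : CommRing (HRing K) :=
  inferInstanceAs (CommRing ↥(Algebra.adjoin (BrunsRing K) (Set.range (uElement K))))

instance : Algebra (BrunsRing K) (HRing K) :=
  inferInstanceAs
    (Algebra (BrunsRing K) ↥(Algebra.adjoin (BrunsRing K) (Set.range (uElement K))))

instance : Algebra K (HRing K) :=
  inferInstanceAs (Algebra K ↥(Algebra.adjoin (BrunsRing K) (Set.range (uElement K))))

instance : IsScalarTower K (BrunsRing K) (HRing K) :=
  inferInstanceAs
    (IsScalarTower K (BrunsRing K) ↥(Algebra.adjoin (BrunsRing K) (Set.range (uElement K))))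

/-- The matrix `X` over `R`. -/
def matX : Matrix (Fin 2) (Fin 4) (HRing K) :=
  (brunsX K).map (algebraMap (BrunsRing K) (HRing K))

/-- The matrix `Y` over `R`. -/
def matY : Matrix (Fin 4) (Fin 8) (HRing K) :=
  (brunsY K).map (algebraMap (BrunsRing K) (HRing K))

/-- The family of all entries of `X` and `Y` in `R`. -/
def entry : EntryIndex → HRing K :=
  Sum.elim (fun p => matX K p.1 p.2) (fun p => matY K p.1 p.2)

/-- `g_σ / f` as an element of `R`. -/
def uGen (σ : Fin 8 × Fin 8) : HRing K :=
  ⟨uElement K σ, Algebra.subset_adjoin ⟨σ, rfl⟩⟩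

/-- The ideal `P` of `R` generated by the entries of `X` and `Y` and the `u`-elements; all of
these have positive degree and they generate the graded `K`-algebra `R`, so `P` is the ideal of
elements of positive degree. -/
def idealP : Ideal (HRing K) :=
  Ideal.span (Set.range (entry K) ∪ Set.range (uGen K))

/-! ### The ring `S`, the module `N` and the matrices over `S` -/

/-- `S = K[s,t] / (s², st, t²)`. -/
abbrev SRing : Type u :=
  MvPolynomial (Fin 2) K ⧸
    (Ideal.span {MvPolynomial.X 0 ^ 2, MvPolynomial.X 0 * MvPolynomial.X 1,
      MvPolynomial.X 1 ^ 2} : Ideal (MvPolynomial (Fin 2) K))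

def sElt : SRing K := Ideal.Quotient.mk _ (MvPolynomial.X 0)

def tElt : SRing K := Ideal.Quotient.mk _ (MvPolynomial.X 1)

/-- `N = S² / ((t,0), (0,s), (s,t))S`. -/
def moduleN : ModuleCat.{u} (SRing K) :=
  ModuleCat.of (SRing K) ((Fin 2 → SRing K) ⧸
    (Submodule.span (SRing K) {![tElt K, 0], ![0, sElt K], ![sElt K, tElt K]} :
      Submodule (SRing K) (Fin 2 → SRing K)))

def barX : Matrix (Fin 2) (Fin 4) (SRing K) :=
  !![sElt K, 0, tElt K, 0;
     0, sElt K, 0, tElt K]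

def barY : Matrix (Fin 4) (Fin 8) (SRing K) :=
  !![sElt K, 0, 0, 0, tElt K, 0, 0, 0;
     0, sElt K, 0, 0, 0, tElt K, 0, 0;
     0, 0, sElt K, 0, 0, 0, tElt K, 0;
     0, 0, 0, sElt K, 0, 0, 0, tElt K]

variable {K}

/-- `N` as a module over a `K`-algebra `A` through a homomorphism `A → S`. -/
abbrev moduleNVia {A : Type u} [CommRing A] [Algebra K A] (φ : A →ₐ[K] SRing K) :
    ModuleCat.{u} A :=
  (ModuleCat.restrictScalars (φ : A →+* SRing K)).obj (moduleN K)

/-- The homomorphism `φ : A → S` takes `X` to `X̄` and `Y` to `Ȳ`. -/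
def IsSpecialization {A : Type u} [CommRing A] [Algebra K A] (X : Matrix (Fin 2) (Fin 4) A)
    (Y : Matrix (Fin 4) (Fin 8) A) (φ : A →ₐ[K] SRing K) : Prop :=
  X.map φ = barX K ∧ Y.map φ = barY K

/-- The asserted properties of the Noetherian `K`-algebra `A`, the matrices `X`, `Y` over `A`,
the module `M = A^8/(A^4)Y` and the `A`-module `N`. -/
structure IsCounterexample {A : Type u} [CommRing A] [Algebra K A]
    (X : Matrix (Fin 2) (Fin 4) A) (Y : Matrix (Fin 4) (Fin 8) A) : Prop where
  /-- `A` is Noetherian. -/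
  noetherian : IsNoetherianRing A
  /-- `0 → A² → A⁴ → A⁸` is exact at `A²`. -/
  injective : Function.Injective X.vecMulLinear
  /-- `0 → A² → A⁴ → A⁸` is exact at `A⁴`. -/
  exact : Function.Exact X.vecMulLinear Y.vecMulLinear
  /-- `M` has projective dimension exactly 2. -/
  projectiveDimension_eq : projectiveDimension (rowCokernel Y) = 2
  /-- There is a homomorphism `A → S` that takes `X` to `X̄` and `Y` to `Ȳ`. -/
  exists_specialization : ∃ φ : A →ₐ[K] SRing K, IsSpecialization X Y φ
  /-- Through every such homomorphism, `N` is a module of length 3 with `Tor_1(M, N) = 0` and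
  `Tor_2(M, N) ≠ 0`. -/
  tor : ∀ φ : A →ₐ[K] SRing K, IsSpecialization X Y φ →
    Module.length A (moduleNVia φ) = 3 ∧
    IsZero (torModule 1 (rowCokernel Y) (moduleNVia φ)) ∧
    ¬ IsZero (torModule 2 (rowCokernel Y) (moduleNVia φ))
  /-- `M` is not rigid. -/
  not_rigid : ¬ IsRigidModule (rowCokernel Y)

/-- The completion of a local ring at its maximal ideal. -/
abbrev LocalCompletion (A : Type u) [CommRing A] [IsLocalRing A] : Type u :=
  AdicCompletion (IsLocalRing.maximalIdeal A) A

end RigidityCounterexample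

end

/-! Once `0 → A² → A⁴ → A⁸` is exact it is a free resolution of `M`, so `Tor_1(M,N)` and
`Tor_2(M,N)` are the homology of `N² → N⁴ → N⁸` at `N⁴` and at `N²`, and only the matrices over `S`
matter. The module `N` has the `K`-basis `e₁, e₂, se₁`, with `te₁ = se₂ = 0` and `te₂ = -se₁`. A row
killed by `barY` has its entries in the socle `K·se₁`, and `n ↦ (sn, tn)` maps `N` onto the square
of the socle; hence `barX` fills the kernel of `barY` (`exact_barX_barY`). But `barX` kills the
socle (`not_injective_barX`). A specialization also prevents `X` from having a right inverse, which
excludes projective dimension below 2.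

Specializations exist because `S` is a square-zero extension of `K`: a homomorphism `R → S` may be
prescribed at will on elements of `P` that are independent modulo `P²`
(`exists_algHom_apply_eq_linComb`). The entries are independent for degree reasons: with degrees 2
for `X` and 3 for `Y`, the elements `g_σ/f` have degree 2, and `P²` begins in degree 4
(`linearIndependent_entry`).

The main work is exactness over `R`. Solving `XY = 0` for the last two rows of `Y` identifies `R`
with a subring `ring K 8` of the polynomial ring `Amb` in the first two rows over `Frac K[X]`. There
`vY = 0` gives `v = wX` with `w` over `Amb`, and every 2-minor of `X` carries `w` into `R`. So it
suffices that an element carried into `R` by powers of each of two minors lies in `R`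
(`mem_ring_of_locallyMem`).

This is proved for any number of columns of `Y`, by induction. With one column the ring is
`K[x,y]/(Xy)`, where the two minors form a regular sequence. For the step, the last two columns are
merged. The merged element lies in the smaller ring by induction and lifts back with any prescribed
bidegree; the difference is killed by merging, hence is a multiple of the `u`-element of these two
columns, and the quotient is again locally in the ring and of smaller bidegree. This is where the
adjoined elements `g_σ/f` are needed.

Localization and completion are flat, and the specialization extends to them because it inverts the
complement of `P` and kills `P²`. -/

noncomputable section

/-! ### Nonzerodivisors modulo an ideal -/

/-- `x` is a nonzerodivisor modulo `I`. -/
def NonZeroDivisorMod {A : Type*} [CommRing A] (I : Ideal A) (x : A) : Prop :=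
  ∀ v, x * v ∈ I → v ∈ I

namespace NonZeroDivisorMod

variable {A : Type*} [CommRing A] {I : Ideal A} {x z : A}

lemma mem_sup_span_singleton {v : A} :
    v ∈ I ⊔ Ideal.span {x} ↔ ∃ r, v - x * r ∈ I := by
  rw [Submodule.mem_sup]
  constructor
  · rintro ⟨i, hi, y, hy, rfl⟩
    obtain ⟨r, rfl⟩ := Ideal.mem_span_singleton'.1 hy
    exact ⟨r, by convert hi using 1; ring⟩
  · rintro ⟨r, hr⟩
    exact ⟨_, hr, x * r, Ideal.mul_mem_right _ _ (Ideal.mem_span_singleton_self x), by ring⟩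

/-- One half of permuting a regular sequence, valid without any local hypothesis: from `xv ≡ zn` it
follows that `n ≡ xm`, and `x` cancels. -/
lemma swap (hx : NonZeroDivisorMod I x) (hz : NonZeroDivisorMod (I ⊔ Ideal.span {x}) z) :
    NonZeroDivisorMod (I ⊔ Ideal.span {z}) x := by
  intro v hv
  obtain ⟨n, hn⟩ := mem_sup_span_singleton.1 hv
  obtain ⟨m, hm⟩ := mem_sup_span_singleton.1 (hz n (mem_sup_span_singleton.2
    ⟨v, by convert I.neg_mem hn using 1; ring⟩))
  refine mem_sup_span_singleton.2 ⟨m, hx _ ?_⟩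
  convert I.add_mem hn (I.mul_mem_left z hm) using 1
  ring

lemma pow (hx : NonZeroDivisorMod I x) (n : ℕ) : NonZeroDivisorMod I (x ^ n) := by
  induction n with
  | zero => intro v hv; simpa using hv
  | succ n ih =>
    intro v hv
    exact hx _ (ih _ (by convert hv using 1; ring))

/-- If `zv ≡ x^(n+1) r`, then `v ≡ xw` because `z` is regular modulo `x`; cancelling `x` gives `zw ≡
x^n r`, to which induction applies. -/
lemma sup_span_pow (hx : NonZeroDivisorMod I x) (hz : NonZeroDivisorMod (I ⊔ Ideal.span {x}) z)
    (n : ℕ) : NonZeroDivisorMod (I ⊔ Ideal.span {x ^ n}) z := by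
  induction n with
  | zero =>
    intro v _
    exact mem_sup_span_singleton.2 ⟨v, by simp⟩
  | succ n ih =>
    intro v hv
    obtain ⟨r, hr⟩ := mem_sup_span_singleton.1 hv
    obtain ⟨w, hw⟩ := mem_sup_span_singleton.1 (hz v (mem_sup_span_singleton.2
      ⟨x ^ n * r, by convert hr using 1; ring⟩))
    have h1 : x * (z * w - x ^ n * r) ∈ I := by
      convert I.sub_mem hr (I.mul_mem_left z hw) using 1
      ring
    obtain ⟨s, hs⟩ := mem_sup_span_singleton.1 (ih w (mem_sup_span_singleton.2 ⟨r, hx _ h1⟩))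
    refine mem_sup_span_singleton.2 ⟨s, ?_⟩
    convert I.add_mem hw (I.mul_mem_left x hs) using 1
    ring

variable {J : Ideal A} {θ : A →+* A}

/-- The hypotheses on `θ` identify `A/J` with the image of `θ`, a subring of a domain. -/
lemma of_retraction [IsDomain A] (hθ : ∀ v, v - θ v ∈ J) (hJ : ∀ v ∈ J, θ v = 0)
    (hz : θ z ≠ 0) : NonZeroDivisorMod J z := by
  intro v hv
  have h := hJ _ hv
  rw [map_mul] at h
  have h0 : θ v = 0 := (mul_eq_zero.1 h).resolve_left hz
  simpa [h0] using hθ v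

/-- Primality of `θ l` is used in `A` itself, so that the divisibility it yields can be lifted back
modulo `J`. -/
lemma of_retraction_of_prime {l : A} (hθ : ∀ v, v - θ v ∈ J) (hJ : ∀ v ∈ J, θ v = 0)
    (hl : Prime (θ l)) (hz : ¬ θ l ∣ θ z) : NonZeroDivisorMod (J ⊔ Ideal.span {l}) z := by
  intro v hv
  obtain ⟨r, hr⟩ := mem_sup_span_singleton.1 hv
  have h := hJ _ hr
  rw [map_sub, map_mul, map_mul, sub_eq_zero] at h
  obtain ⟨s, hs⟩ := (hl.dvd_or_dvd ⟨_, h⟩).resolve_left hz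
  refine mem_sup_span_singleton.2 ⟨s, ?_⟩
  have h1 : v - l * s = (v - θ v) - (l - θ l) * s := by rw [hs]; ring
  rw [h1]
  exact J.sub_mem (hθ v) (J.mul_mem_right _ (hθ l))

end NonZeroDivisorMod

/-- The elements which a power of `d` carries into `W + I` form a subalgebra. -/
def powMulMemSubalgebra {R A : Type*} [CommRing R] [CommRing A] [Algebra R A]
    (W : Subalgebra R A) (I : Ideal A) (d : A) (hd : d ∈ W) : Subalgebra R A where
  carrier := {v | ∃ N : ℕ, ∃ w ∈ W, d ^ N * v - w ∈ I}
  mul_mem' := by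
    rintro a b ⟨N, w, hw, h⟩ ⟨M, w', hw', h'⟩
    refine ⟨N + M, w * w', W.mul_mem hw hw', ?_⟩
    convert I.add_mem (I.mul_mem_right (d ^ M * b) h) (I.mul_mem_left w h') using 1
    ring
  add_mem' := by
    rintro a b ⟨N, w, hw, h⟩ ⟨M, w', hw', h'⟩
    refine ⟨N + M, d ^ M * w + d ^ N * w', W.add_mem (W.mul_mem (W.pow_mem hd _) hw)
      (W.mul_mem (W.pow_mem hd _) hw'), ?_⟩
    convert I.add_mem (I.mul_mem_left (d ^ M) h) (I.mul_mem_left (d ^ N) h') using 1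
    ring
  algebraMap_mem' r := ⟨0, algebraMap R A r, W.algebraMap_mem r, by simp⟩

/-- If the variables are carried into `W + I` by `d`, then so is every polynomial by a power
of `d`. -/
lemma MvPolynomial.exists_pow_mul_sub_mem {R σ : Type*} [CommRing R]
    {W : Subalgebra R (MvPolynomial σ R)} {I : Ideal (MvPolynomial σ R)} {d : MvPolynomial σ R}
    (hd : d ∈ W) (h : ∀ s, X s ∈ W ∨ ∃ w ∈ W, d * X s - w ∈ I) (v : MvPolynomial σ R) :
    ∃ N : ℕ, ∃ w ∈ W, d ^ N * v - w ∈ I := by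
  have hv : v ∈ Algebra.adjoin R (Set.range (X : σ → MvPolynomial σ R)) := by
    rw [adjoin_range_X]; trivial
  suffices Algebra.adjoin R (Set.range (X : σ → MvPolynomial σ R)) ≤
    powMulMemSubalgebra W I d hd from this hv
  rw [Algebra.adjoin_le_iff]
  rintro _ ⟨s, rfl⟩
  rcases h s with h | ⟨w, hw, h⟩
  · exact ⟨0, X s, h, by simp⟩
  · exact ⟨1, w, hw, by simpa using h⟩

/-- The device for computing kernels of generic solutions: up to powers of the regular element `d`,
everything is congruent to an element of `W`, where `E` is injective. -/
lemma mem_of_map_eq_zero {A B : Type*} [CommRing A] [CommRing B] {I : Ideal A} {d : A}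
    {W : Set A} (hd : NonZeroDivisorMod I d) (E : A →+* B) (hE : ∀ v ∈ I, E v = 0)
    (hW : ∀ w ∈ W, E w = 0 → w = 0) {v : A} (h : ∃ N : ℕ, ∃ w ∈ W, d ^ N * v - w ∈ I)
    (hv : E v = 0) : v ∈ I := by
  obtain ⟨N, w, hw, h⟩ := h
  have h0 := hE _ h
  rw [map_sub, map_mul, hv, mul_zero, zero_sub, neg_eq_zero] at h0
  rw [hW w hw h0, sub_zero] at h
  exact hd.pow N _ h

/-! ### The column algebra `K[x_ij, y_j] / (Xy)` -/

namespace ColumnAlgebra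

open MvPolynomial

variable (K : Type*) [Field K]

/-- The polynomial ring in the entries of a `2 × 4` matrix and of a column of length 4. -/
abbrev Poly : Type _ := MvPolynomial ((Fin 2 × Fin 4) ⊕ Fin 4) K

def x (i : Fin 2) (a : Fin 4) : Poly K := X (Sum.inl (i, a))

def y (a : Fin 4) : Poly K := X (Sum.inr a)

/-- The entries of the product of the matrix and the column. -/
def form (i : Fin 2) : Poly K := x K i 0 * y K 0 + x K i 1 * y K 1 + x K i 2 * y K 2 + x K i 3 * y K 3

def minor (a b : Fin 4) : Poly K := x K 0 a * x K 1 b - x K 1 a * x K 0 b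

lemma sub_aeval_mem {σ : Type*} {J : Ideal (MvPolynomial σ K)} (g : σ → MvPolynomial σ K)
    (hg : ∀ s, X s - g s ∈ J) (v : MvPolynomial σ K) : v - aeval g v ∈ J := by
  have h : (Ideal.Quotient.mkₐ K J).comp (aeval g) = Ideal.Quotient.mkₐ K J := by
    ext s
    simp only [AlgHom.comp_apply, aeval_X, Ideal.Quotient.mkₐ_eq_mk]
    exact (Ideal.Quotient.eq.2 (hg s)).symm
  rw [← Ideal.Quotient.eq]
  exact (DFunLike.congr_fun h v).symm

/-- The endomorphism that sets the entries of the column with index in `s` to zero. -/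
def kill (s : Finset (Fin 4)) : Poly K →ₐ[K] Poly K :=
  aeval (Sum.elim (fun p => x K p.1 p.2) (fun a => if a ∈ s then 0 else y K a))

@[simp] lemma kill_x (s : Finset (Fin 4)) (i : Fin 2) (a : Fin 4) :
    kill K s (x K i a) = x K i a := by
  simp [kill, x]

@[simp] lemma kill_y (s : Finset (Fin 4)) (a : Fin 4) :
    kill K s (y K a) = if a ∈ s then 0 else y K a := by
  simp [kill, y]

lemma kill_sub_mem (s : Finset (Fin 4)) {J : Ideal (Poly K)} (hJ : ∀ a ∈ s, y K a ∈ J)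
    (v : Poly K) : v - (kill K s : Poly K →+* Poly K) v ∈ J := by
  refine sub_aeval_mem K _ ?_ v
  rintro (⟨i, a⟩ | a)
  · simp [x]
  · by_cases h : a ∈ s
    · have h' := hJ a h
      simp only [y] at h'
      simpa [h] using h'
    · simp [h, y]

lemma y_ne_zero (a : Fin 4) : y K a ≠ 0 := X_ne_zero _

/-- Evaluation of all variables at points of `K`. -/
def point (p : Fin 2 → Fin 4 → K) (q : Fin 4 → K) : Poly K →ₐ[K] K :=
  aeval (Sum.elim (fun r => p r.1 r.2) q)

@[simp] lemma point_x (p : Fin 2 → Fin 4 → K) (q : Fin 4 → K) (i : Fin 2) (a : Fin 4) :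
    point K p q (x K i a) = p i a := by
  simp [point, x]

@[simp] lemma point_y (p : Fin 2 → Fin 4 → K) (q : Fin 4 → K) (a : Fin 4) :
    point K p q (y K a) = q a := by
  simp [point, y]

lemma ne_zero_of_point {v : Poly K} (p : Fin 2 → Fin 4 → K) (q : Fin 4 → K)
    (h : point K p q v ≠ 0) : v ≠ 0 := by
  rintro rfl; simp at h

lemma not_dvd_of_point {v w : Poly K} (p : Fin 2 → Fin 4 → K) (q : Fin 4 → K)
    (h : point K p q v = 0) (h' : point K p q w ≠ 0) : ¬ v ∣ w := by
  rintro ⟨r, rfl⟩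
  simp [h] at h'

/-- The polynomial is linear in `X t` with coprime coefficients `X s` and `g`, hence irreducible,
and the polynomial ring is factorial. -/
lemma prime_of_linear {σ : Type*} {R : Type*} [CommRing R] [IsDomain R]
    [UniqueFactorizationMonoid R] {s t : σ} (hst : s ≠ t) (g : MvPolynomial σ R)
    (hg : t ∉ g.vars) (h : ¬ (X s : MvPolynomial σ R) ∣ g) :
    Prime (X s * X t + g) := by
  refine Irreducible.prime (irreducible_mul_X_add _ _ _ (X_ne_zero s) ?_ hg ?_)
  · simpa [vars_X] using Ne.symm hst
  · exact (irreducible_iff_prime.2 (MvPolynomial.X_prime)).isRelPrime_iff_not_dvd.2 h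

lemma not_mem_vars_mul {σ : Type*} {R : Type*} [CommRing R] {p q : MvPolynomial σ R} {t : σ}
    (hp : t ∉ p.vars) (hq : t ∉ q.vars) : t ∉ (p * q).vars := by
  classical
  intro h
  rcases Finset.mem_union.1 (vars_mul p q h) with h | h
  exacts [hp h, hq h]

lemma not_mem_vars_add {σ : Type*} {R : Type*} [CommRing R] {p q : MvPolynomial σ R} {t : σ}
    (hp : t ∉ p.vars) (hq : t ∉ q.vars) : t ∉ (p + q).vars := by
  classical
  intro h
  rcases Finset.mem_union.1 (vars_add_subset p q h) with h | h
  exacts [hp h, hq h]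

lemma prime_kill_kill_form : Prime (x K 0 2 * y K 2 + x K 0 3 * y K 3) := by
  refine prime_of_linear (by simp) _ (not_mem_vars_mul ?_ ?_)
    (not_dvd_of_point K ![![0, 0, 0, 1], 0] ![0, 0, 0, 1] ?_ ?_)
  · simp [x, vars_X]
  · simp [y, vars_X]
  · change point K _ _ (x K 0 2) = 0
    simp
  · simp

lemma prime_kill_form : Prime (x K 0 1 * y K 1 + (x K 0 2 * y K 2 + x K 0 3 * y K 3)) := by
  refine prime_of_linear (by simp) _ (not_mem_vars_add (not_mem_vars_mul ?_ ?_)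
    (not_mem_vars_mul ?_ ?_)) (not_dvd_of_point K ![![0, 0, 0, 1], 0] ![0, 0, 0, 1] ?_ ?_)
  · simp [x, vars_X]
  · simp [y, vars_X]
  · simp [x, vars_X]
  · simp [y, vars_X]
  · change point K _ _ (x K 0 1) = 0
    simp
  · simp

lemma prime_minor : Prime (minor K 2 3) := by
  have h : minor K 2 3 = x K 0 2 * x K 1 3 + (-1) * (x K 1 2 * x K 0 3) := by
    rw [minor]; ring
  rw [h]
  refine prime_of_linear (by simp) _ (not_mem_vars_mul ?_ (not_mem_vars_mul ?_ ?_))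
    (not_dvd_of_point K ![![0, 0, 0, 1], ![0, 0, 1, 0]] 0 ?_ ?_)
  · rw [← C_1, ← C_neg, vars_C]; simp
  · simp [x, vars_X]
  · simp [x, vars_X]
  · change point K _ _ (x K 0 2) = 0
    simp
  · simp

/-- The ideal generated by the entries of the product. -/
def ideal : Ideal (Poly K) := Ideal.span {form K 0} ⊔ Ideal.span {form K 1}

/-- The ideal of the columns whose first entry vanishes. -/
def ideal₀ : Ideal (Poly K) :=
  Ideal.span {y K 0} ⊔ Ideal.span {form K 0} ⊔ Ideal.span {form K 1}

lemma map_eq_zero_of_mem_span {A B : Type*} [CommRing A] [CommRing B] (E : A →+* B) {s : Set A}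
    (h : ∀ a ∈ s, E a = 0) {v : A} (hv : v ∈ Ideal.span s) : E v = 0 :=
  (Ideal.span_le (I := RingHom.ker E)).2 (fun a ha => h a ha) hv

lemma map_eq_zero_of_mem_ideal {B : Type*} [CommRing B] (E : Poly K →+* B)
    (h0 : E (form K 0) = 0) (h1 : E (form K 1) = 0) {v : Poly K} (hv : v ∈ ideal K) : E v = 0 := by
  refine (sup_le ?_ ?_ : ideal K ≤ RingHom.ker E) hv <;>
    rw [Ideal.span_singleton_le_iff_mem] <;> assumption

lemma nonZeroDivisorMod_span_y (z : Poly K) (hz : kill K {0} z ≠ 0) :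
    NonZeroDivisorMod (Ideal.span {y K 0}) z := by
  refine NonZeroDivisorMod.of_retraction (θ := (kill K {0} : Poly K →+* Poly K))
    (kill_sub_mem K _ ?_) (fun v hv => map_eq_zero_of_mem_span _ ?_ hv) hz
  · simp
  · simp

lemma mem_span_y01 : ∀ a ∈ ({0, 1} : Finset (Fin 4)),
    y K a ∈ Ideal.span {y K 0} ⊔ Ideal.span {y K 1} := by
  intro a ha
  rcases Finset.mem_insert.1 ha with rfl | h
  · exact Ideal.mem_sup_left (Ideal.mem_span_singleton_self _)
  · rw [Finset.mem_singleton.1 h]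
    exact Ideal.mem_sup_right (Ideal.mem_span_singleton_self _)

lemma kill_eq_zero_of_mem {v : Poly K} (hv : v ∈ Ideal.span {y K 0} ⊔ Ideal.span {y K 1}) :
    (kill K {0, 1} : Poly K →+* Poly K) v = 0 := by
  refine (sup_le ?_ ?_ : _ ≤ RingHom.ker (kill K {0, 1} : Poly K →+* Poly K)) hv <;>
    rw [Ideal.span_singleton_le_iff_mem] <;> simp

lemma form_mod_y01 :
    NonZeroDivisorMod (Ideal.span {y K 0} ⊔ Ideal.span {y K 1}) (form K 0) := by
  refine NonZeroDivisorMod.of_retraction (kill_sub_mem K {0, 1} (mem_span_y01 K))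
    (fun v => kill_eq_zero_of_mem K) ?_
  refine ne_zero_of_point K ![![0, 0, 0, 1], 0] ![0, 0, 0, 1] ?_
  simp [form]

lemma form_mod_y01_form : NonZeroDivisorMod
    (Ideal.span {y K 0} ⊔ Ideal.span {y K 1} ⊔ Ideal.span {form K 0}) (form K 1) := by
  have h : (kill K {0, 1} : Poly K →+* Poly K) (form K 0) =
      x K 0 2 * y K 2 + x K 0 3 * y K 3 := by simp [form]
  refine NonZeroDivisorMod.of_retraction_of_prime (kill_sub_mem K {0, 1} (mem_span_y01 K))
    (fun v => kill_eq_zero_of_mem K) (h ▸ prime_kill_kill_form K) ?_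
  rw [h]
  refine not_dvd_of_point K ![0, ![0, 0, 0, 1]] ![0, 0, 0, 1] ?_ ?_ <;> simp [form]

lemma form_mod_y0_form : NonZeroDivisorMod
    (Ideal.span {y K 0} ⊔ Ideal.span {form K 0}) (form K 1) := by
  have h : (kill K {0} : Poly K →+* Poly K) (form K 0) =
      x K 0 1 * y K 1 + (x K 0 2 * y K 2 + x K 0 3 * y K 3) := by simp [form]; ring
  refine NonZeroDivisorMod.of_retraction_of_prime (kill_sub_mem K {0} ?_)
    (fun v hv => map_eq_zero_of_mem_span _ ?_ hv) (h ▸ prime_kill_form K) ?_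
  · simp
  · simp
  · rw [h]
    refine not_dvd_of_point K ![0, ![0, 0, 0, 1]] ![0, 0, 0, 1] ?_ ?_ <;> simp [form]

/-- The sequence `y 0`, `y 1`, `form 0`, `form 1` is regular by the retraction lemmas; two swaps
move `y 1` behind both forms. -/
lemma y1_mod_ideal₀ : NonZeroDivisorMod (ideal₀ K) (y K 1) := by
  have h1 : NonZeroDivisorMod (Ideal.span {y K 0} ⊔ Ideal.span {form K 0}) (y K 1) :=
    (nonZeroDivisorMod_span_y K _ (by simpa using y_ne_zero K 1)).swap (form_mod_y01 K)
  refine h1.swap ?_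
  rw [sup_right_comm]
  exact form_mod_y01_form K

lemma y0_mod_ideal : NonZeroDivisorMod (ideal K) (y K 0) := by
  have h0 : NonZeroDivisorMod (⊥ : Ideal (Poly K)) (y K 0) := fun v hv => by
    simpa [y_ne_zero] using hv
  have h1 : NonZeroDivisorMod (⊥ ⊔ Ideal.span {form K 0}) (y K 0) := by
    refine h0.swap ?_
    rw [bot_sup_eq]
    refine nonZeroDivisorMod_span_y K _ ?_
    refine ne_zero_of_point K ![![0, 0, 0, 1], 0] ![0, 0, 0, 1] ?_
    simp [form]
  rw [bot_sup_eq] at h1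
  refine h1.swap ?_
  rw [sup_comm]
  exact form_mod_y0_form K

end ColumnAlgebra
-- Generic solutions of `Xy = 0` and the regular sequence of two minors.
namespace ColumnAlgebra

open MvPolynomial

variable (K : Type*) [Field K]

lemma eq_of_mem_supported {σ B : Type*} [CommRing B] [Algebra K B] {S : Set σ}
    {E E' : MvPolynomial σ K →ₐ[K] B} (h : ∀ s ∈ S, E (X s) = E' (X s)) {w : MvPolynomial σ K}
    (hw : w ∈ supported K S) : E w = E' w := by
  have : supported K S ≤ AlgHom.equalizer E E' := by
    rw [supported_eq_adjoin_X, Algebra.adjoin_le_iff]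
    rintro _ ⟨s, hs, rfl⟩
    exact h s hs
  exact this hw

/-- The inclusion of the polynomial ring into its field of fractions. -/
abbrev toFrac : Poly K →ₐ[K] FractionRing (Poly K) := IsScalarTower.toAlgHom K _ _

lemma toFrac_injective : Function.Injective (toFrac K) :=
  IsFractionRing.injective (Poly K) (FractionRing (Poly K))

/-- The generic solution of `Xy = 0`, with the first column of `X` eliminated. -/
def solve : Poly K →ₐ[K] FractionRing (Poly K) :=
  aeval (Sum.elim (fun p => if p.2 = 0 then
      -(toFrac K (x K p.1 1 * y K 1 + x K p.1 2 * y K 2 + x K p.1 3 * y K 3)) / toFrac K (y K 0)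
    else toFrac K (x K p.1 p.2)) (fun a => toFrac K (y K a)))

/-- The generic solution of `Xy = 0` with vanishing first coordinate of `y`, with the second column
of `X` eliminated. -/
def solve₀ : Poly K →ₐ[K] FractionRing (Poly K) :=
  aeval (Sum.elim (fun p => if p.2 = 1 then
      -(toFrac K (x K p.1 2 * y K 2 + x K p.1 3 * y K 3)) / toFrac K (y K 1)
    else toFrac K (x K p.1 p.2)) (fun a => if a = 0 then 0 else toFrac K (y K a)))

lemma solve_x (i : Fin 2) {a : Fin 4} (h : a ≠ 0) : solve K (x K i a) = toFrac K (x K i a) := by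
  simp [solve, x, h]

lemma solve_x_zero (i : Fin 2) : solve K (x K i 0) =
    -(toFrac K (x K i 1 * y K 1 + x K i 2 * y K 2 + x K i 3 * y K 3)) / toFrac K (y K 0) := by
  simp [solve, x]

lemma solve_y (a : Fin 4) : solve K (y K a) = toFrac K (y K a) := by
  simp [solve, y]

lemma solve₀_x (i : Fin 2) {a : Fin 4} (h : a ≠ 1) : solve₀ K (x K i a) = toFrac K (x K i a) := by
  simp [solve₀, x, h]

lemma solve₀_x_one (i : Fin 2) : solve₀ K (x K i 1) =
    -(toFrac K (x K i 2 * y K 2 + x K i 3 * y K 3)) / toFrac K (y K 1) := by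
  simp [solve₀, x]

lemma solve₀_y {a : Fin 4} (h : a ≠ 0) : solve₀ K (y K a) = toFrac K (y K a) := by
  simp [solve₀, y, h]

lemma solve₀_y_zero : solve₀ K (y K 0) = 0 := by
  simp [solve₀, y]

lemma toFrac_y_ne_zero (a : Fin 4) : toFrac K (y K a) ≠ 0 :=
  (map_ne_zero_iff _ (toFrac_injective K)).2 (y_ne_zero K a)

lemma solve_form (i : Fin 2) : solve K (form K i) = 0 := by
  have h0 := toFrac_y_ne_zero K 0
  simp only [form, map_add, map_mul, solve_x_zero, solve_y, solve_x K i (show (1 : Fin 4) ≠ 0 by decide),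
    solve_x K i (show (2 : Fin 4) ≠ 0 by decide), solve_x K i (show (3 : Fin 4) ≠ 0 by decide)]
  rw [div_mul_cancel₀ _ h0]
  ring

lemma solve₀_form (i : Fin 2) : solve₀ K (form K i) = 0 := by
  have h0 := toFrac_y_ne_zero K 1
  simp only [form, map_add, map_mul, solve₀_x_one, solve₀_y_zero,
    solve₀_y K (show (1 : Fin 4) ≠ 0 by decide), solve₀_y K (show (2 : Fin 4) ≠ 0 by decide),
    solve₀_y K (show (3 : Fin 4) ≠ 0 by decide), solve₀_x K i (show (0 : Fin 4) ≠ 1 by decide),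
    solve₀_x K i (show (2 : Fin 4) ≠ 1 by decide), solve₀_x K i (show (3 : Fin 4) ≠ 1 by decide)]
  rw [div_mul_cancel₀ _ h0]
  ring

lemma form_mem_ideal (i : Fin 2) : form K i ∈ ideal K := by
  fin_cases i
  · exact Ideal.mem_sup_left (Ideal.mem_span_singleton_self _)
  · exact Ideal.mem_sup_right (Ideal.mem_span_singleton_self _)

lemma form_mem_ideal₀ (i : Fin 2) : form K i ∈ ideal₀ K := by
  fin_cases i
  · exact Ideal.mem_sup_left (Ideal.mem_sup_right (Ideal.mem_span_singleton_self _))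
  · exact Ideal.mem_sup_right (Ideal.mem_span_singleton_self _)

lemma y_zero_mem_ideal₀ : y K 0 ∈ ideal₀ K :=
  Ideal.mem_sup_left (Ideal.mem_sup_left (Ideal.mem_span_singleton_self _))

/-- The variables other than the entries of the first column of the matrix. -/
def freeVars : Set ((Fin 2 × Fin 4) ⊕ Fin 4) := {s | ∀ i, s ≠ Sum.inl (i, 0)}

/-- The variables other than the entries of the second column of the matrix and the first entry of
the column. -/
def freeVars₀ : Set ((Fin 2 × Fin 4) ⊕ Fin 4) := {s | (∀ i, s ≠ Sum.inl (i, 1)) ∧ s ≠ Sum.inr 0}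

lemma x_mem_supported {S : Set ((Fin 2 × Fin 4) ⊕ Fin 4)} {i : Fin 2} {a : Fin 4}
    (h : Sum.inl (i, a) ∈ S) : x K i a ∈ supported K S := X_mem_supported.2 h

lemma y_mem_supported {S : Set ((Fin 2 × Fin 4) ⊕ Fin 4)} {a : Fin 4}
    (h : Sum.inr a ∈ S) : y K a ∈ supported K S := X_mem_supported.2 h

/-- Modulo the forms, `y 0 * x i 0` is a polynomial in the free variables, so powers of `y 0`
eliminate the first column. -/
lemma exists_pow_y_zero_mul_sub_mem (v : Poly K) :
    ∃ N : ℕ, ∃ w ∈ supported K freeVars, y K 0 ^ N * v - w ∈ ideal K := by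
  refine exists_pow_mul_sub_mem (y_mem_supported K (by simp [freeVars])) ?_ v
  intro s
  by_cases hs : s ∈ freeVars
  · exact Or.inl (X_mem_supported.2 hs)
  · right
    obtain ⟨i, rfl⟩ : ∃ i, s = Sum.inl (i, 0) := by
      simpa only [freeVars, Set.mem_ofPred_eq, not_forall, not_not] using hs
    refine ⟨-(x K i 1 * y K 1 + x K i 2 * y K 2 + x K i 3 * y K 3),
      neg_mem (add_mem (add_mem ?_ ?_) ?_), ?_⟩
    · exact mul_mem (x_mem_supported K (by simp [freeVars])) (y_mem_supported K (by simp [freeVars]))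
    · exact mul_mem (x_mem_supported K (by simp [freeVars])) (y_mem_supported K (by simp [freeVars]))
    · exact mul_mem (x_mem_supported K (by simp [freeVars])) (y_mem_supported K (by simp [freeVars]))
    · convert form_mem_ideal K i using 1
      simp only [form, x]
      ring

lemma exists_pow_y_one_mul_sub_mem (v : Poly K) :
    ∃ N : ℕ, ∃ w ∈ supported K freeVars₀, y K 1 ^ N * v - w ∈ ideal₀ K := by
  refine exists_pow_mul_sub_mem (y_mem_supported K (by simp [freeVars₀])) ?_ v
  intro s
  by_cases hs : s ∈ freeVars₀
  · exact Or.inl (X_mem_supported.2 hs)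
  · right
    by_cases hs0 : s = Sum.inr 0
    · subst hs0
      exact ⟨0, zero_mem _, by rw [sub_zero]; exact Ideal.mul_mem_left _ _ (y_zero_mem_ideal₀ K)⟩
    obtain ⟨i, rfl⟩ : ∃ i, s = Sum.inl (i, 1) := by
      by_contra! h
      exact hs ⟨h, hs0⟩
    refine ⟨-(x K i 2 * y K 2 + x K i 3 * y K 3), neg_mem (add_mem ?_ ?_), ?_⟩
    · exact mul_mem (x_mem_supported K (by simp [freeVars₀])) (y_mem_supported K (by simp [freeVars₀]))
    · exact mul_mem (x_mem_supported K (by simp [freeVars₀])) (y_mem_supported K (by simp [freeVars₀]))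
    · convert (ideal₀ K).sub_mem (form_mem_ideal₀ K i)
        ((ideal₀ K).mul_mem_left (x K i 0) (y_zero_mem_ideal₀ K)) using 1
      simp only [form, x]
      ring

lemma solve_eq_toFrac {w : Poly K} (hw : w ∈ supported K freeVars) :
    solve K w = toFrac K w := by
  refine eq_of_mem_supported K ?_ hw
  rintro (⟨i, a⟩ | a) h
  · refine solve_x K i ?_
    rintro rfl
    exact h i rfl
  · exact solve_y K a

lemma solve₀_eq_toFrac {w : Poly K} (hw : w ∈ supported K freeVars₀) :
    solve₀ K w = toFrac K w := by
  refine eq_of_mem_supported K ?_ hw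
  rintro (⟨i, a⟩ | a) h
  · refine solve₀_x K i ?_
    rintro rfl
    exact h.1 i rfl
  · refine solve₀_y K ?_
    rintro rfl
    exact h.2 rfl

lemma solve_eq_zero_of_mem {v : Poly K} (hv : v ∈ ideal K) : solve K v = 0 :=
  map_eq_zero_of_mem_ideal K (solve K : Poly K →+* FractionRing (Poly K)) (solve_form K 0) (solve_form K 1) hv

lemma solve₀_eq_zero_of_mem {v : Poly K} (hv : v ∈ ideal₀ K) : solve₀ K v = 0 := by
  refine (sup_le (sup_le ?_ ?_) ?_ : ideal₀ K ≤ RingHom.ker (solve₀ K : Poly K →+* FractionRing (Poly K))) hv <;>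
    rw [Ideal.span_singleton_le_iff_mem]
  exacts [solve₀_y_zero K, solve₀_form K 0, solve₀_form K 1]

/-- Thus the column algebra embeds in a field, and regularity modulo `ideal` becomes nonvanishing of
the image under `solve`. -/
lemma solve_eq_zero_iff {v : Poly K} : solve K v = 0 ↔ v ∈ ideal K := by
  refine ⟨fun h => mem_of_map_eq_zero (y0_mod_ideal K) (solve K : Poly K →+* FractionRing (Poly K))
    (fun v => solve_eq_zero_of_mem K) ?_ (exists_pow_y_zero_mul_sub_mem K v) h,
    solve_eq_zero_of_mem K⟩
  intro w hw h
  rw [RingHom.coe_coe, solve_eq_toFrac K hw] at h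
  exact (map_eq_zero_iff _ (toFrac_injective K)).1 h

lemma solve₀_eq_zero_iff {v : Poly K} : solve₀ K v = 0 ↔ v ∈ ideal₀ K := by
  refine ⟨fun h => mem_of_map_eq_zero (y1_mod_ideal₀ K) (solve₀ K : Poly K →+* FractionRing (Poly K))
    (fun v => solve₀_eq_zero_of_mem K) ?_ (exists_pow_y_one_mul_sub_mem K v) h,
    solve₀_eq_zero_of_mem K⟩
  intro w hw h
  rw [RingHom.coe_coe, solve₀_eq_toFrac K hw] at h
  exact (map_eq_zero_iff _ (toFrac_injective K)).1 h

lemma minor_mem_supported {S : Set ((Fin 2 × Fin 4) ⊕ Fin 4)} {a b : Fin 4}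
    (ha : ∀ i, Sum.inl (i, a) ∈ S) (hb : ∀ i, Sum.inl (i, b) ∈ S) :
    minor K a b ∈ supported K S :=
  sub_mem (mul_mem (x_mem_supported K (ha 0)) (x_mem_supported K (hb 1)))
    (mul_mem (x_mem_supported K (ha 1)) (x_mem_supported K (hb 0)))

lemma minor23_mod_ideal : NonZeroDivisorMod (ideal K) (minor K 2 3) := by
  intro v hv
  rw [← solve_eq_zero_iff, map_mul, solve_eq_toFrac K
    (minor_mem_supported K (by simp [freeVars]) (by simp [freeVars]))] at hv
  exact (solve_eq_zero_iff K).1 ((mul_eq_zero.1 hv).resolve_left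
    ((map_ne_zero_iff _ (toFrac_injective K)).2 (prime_minor K).ne_zero))

lemma minor23_mod_ideal₀ : NonZeroDivisorMod (ideal₀ K) (minor K 2 3) := by
  intro v hv
  rw [← solve₀_eq_zero_iff, map_mul, solve₀_eq_toFrac K
    (minor_mem_supported K (by simp [freeVars₀]) (by simp [freeVars₀]))] at hv
  exact (solve₀_eq_zero_iff K).1 ((mul_eq_zero.1 hv).resolve_left
    ((map_ne_zero_iff _ (toFrac_injective K)).2 (prime_minor K).ne_zero))

/-- By swapping, this amounts to regularity of the minor modulo `ideal + (y 0) = ideal₀`, which is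
again the kernel of a map to a field. -/
lemma y0_mod_ideal_minor : NonZeroDivisorMod (ideal K ⊔ Ideal.span {minor K 2 3}) (y K 0) := by
  refine (y0_mod_ideal K).swap ?_
  have h : ideal K ⊔ Ideal.span {y K 0} = ideal₀ K := by
    rw [ideal, ideal₀, sup_comm, sup_assoc]
  rw [h]
  exact minor23_mod_ideal₀ K

/-- Powers of `y 0` turn the congruence into an equation between polynomials in the free variables.
There `minor 2 3` is prime and does not divide `minor 1 3 * y 0 ^ M`, so it divides `V`; finally `y
0` is cancelled by `y0_mod_ideal_minor`. -/
lemma minor13_mod_ideal_minor :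
    NonZeroDivisorMod (ideal K ⊔ Ideal.span {minor K 2 3}) (minor K 1 3) := by
  intro v hv
  obtain ⟨r, hr⟩ := NonZeroDivisorMod.mem_sup_span_singleton.1 hv
  obtain ⟨N, V, hV, hNV⟩ := exists_pow_y_zero_mul_sub_mem K v
  obtain ⟨M, R, hR, hMR⟩ := exists_pow_y_zero_mul_sub_mem K r
  have e1 := solve_eq_zero_of_mem K hr
  have e2 := solve_eq_zero_of_mem K hNV
  have e3 := solve_eq_zero_of_mem K hMR
  simp only [map_sub, map_mul, map_pow, solve_y, solve_eq_toFrac K hV, solve_eq_toFrac K hR,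
    solve_eq_toFrac K (minor_mem_supported K (S := freeVars) (a := 2) (b := 3)
      (by simp [freeVars]) (by simp [freeVars])),
    solve_eq_toFrac K (minor_mem_supported K (S := freeVars) (a := 1) (b := 3)
      (by simp [freeVars]) (by simp [freeVars]))] at e1 e2 e3
  have e : minor K 1 3 * y K 0 ^ M * V = minor K 2 3 * (y K 0 ^ N * R) := by
    apply toFrac_injective K
    simp only [map_mul, map_pow]
    rw [sub_eq_zero] at e1 e2 e3
    rw [← e2, ← e3]
    linear_combination (toFrac K (y K 0)) ^ M * (toFrac K (y K 0)) ^ N * e1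
  have hdvd : minor K 2 3 ∣ V := by
    refine ((prime_minor K).dvd_or_dvd ⟨_, e⟩).resolve_left ?_
    refine not_dvd_of_point K ![![0, 1, 0, 0], ![0, 0, 0, 1]] ![1, 0, 0, 0] ?_ ?_ <;> simp [minor]
  obtain ⟨V', rfl⟩ := hdvd
  exact (y0_mod_ideal_minor K).pow N _
    (NonZeroDivisorMod.mem_sup_span_singleton.2 ⟨V', hNV⟩)

/-- An element of an extension which becomes an element of the column algebra after multiplication
by powers of two suitable minors of the matrix is an element of the column algebra. -/
lemma exists_map_eq {B : Type*} [CommRing B] [IsDomain B] (E : Poly K →+* B)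
    (hE : ∀ v, E v = 0 ↔ v ∈ ideal K) {h : B} {m k : ℕ} {a b : Poly K}
    (ha : E (minor K 2 3) ^ m * h = E a) (hb : E (minor K 1 3) ^ k * h = E b) :
    ∃ c, E c = h := by
  have h1 : minor K 1 3 ^ k * a - minor K 2 3 ^ m * b ∈ ideal K := by
    rw [← hE, map_sub, map_mul, map_mul, map_pow, map_pow, ← ha, ← hb]
    ring
  -- Powers of the two minors still form a regular sequence, so the relation `h1` makes `a`
  -- divisible by `minor 2 3 ^ m` modulo the forms; the quotient represents `h`.
  obtain ⟨c, hc⟩ := NonZeroDivisorMod.mem_sup_span_singleton.1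
    ((((minor23_mod_ideal K).sup_span_pow (minor13_mod_ideal_minor K) m).pow k) a
      (NonZeroDivisorMod.mem_sup_span_singleton.2 ⟨b, h1⟩))
  have h2 := (hE _).2 hc
  rw [map_sub, map_mul, map_pow, sub_eq_zero, ← ha] at h2
  have h0 : E (minor K 2 3) ≠ 0 := by
    intro h
    have h1 := (minor23_mod_ideal K) 1 (by rw [mul_one]; exact (hE _).1 h)
    have h3 := solve_eq_zero_of_mem K h1
    simp at h3
  exact ⟨c, (mul_left_cancel₀ (pow_ne_zero m h0) h2).symm⟩

end ColumnAlgebra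

/-! ### Weighted homogeneous polynomials -/

namespace MvPolynomial

lemma IsWeightedHomogeneous.aeval {σ τ R M N : Type*} [CommRing R] [AddCommMonoid M]
    [AddCommMonoid N] {w : σ → M} {w' : τ → N} (φ : M →+ N) {g : σ → MvPolynomial τ R}
    (hg : ∀ s, IsWeightedHomogeneous w' (g s) (φ (w s))) {m : M} {p : MvPolynomial σ R}
    (hp : IsWeightedHomogeneous w p m) : IsWeightedHomogeneous w' (aeval g p) (φ m) := by
  induction hp using IsWeightedHomogeneous.induction_on with
  | zero => simpa using isWeightedHomogeneous_zero _ _ _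
  | add p q _ _ hp hq => simpa using hp.add hq
  | monomial d r hr =>
    rw [aeval_monomial, algebraMap_eq]
    refine IsWeightedHomogeneous.C_mul ?_ r
    rw [← hr, Finsupp.weight_apply, map_finsuppSum]
    refine IsWeightedHomogeneous.prod _ _ _ fun s _ => ?_
    beta_reduce
    rw [map_nsmul]
    exact (hg s).pow _

/-- Substituting variables scaled by powers of a parameter. -/
lemma IsWeightedHomogeneous.aeval_C_mul_pow {σ τ R : Type*} [CommRing R] {w : σ → ℕ}
    {g : σ → MvPolynomial τ R} {m : ℕ} {p : MvPolynomial σ R} (hp : IsWeightedHomogeneous w p m) :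
    MvPolynomial.aeval (fun s => Polynomial.C (g s) * Polynomial.X ^ w s) p =
      Polynomial.C (MvPolynomial.aeval g p) * Polynomial.X ^ m := by
  induction hp using IsWeightedHomogeneous.induction_on with
  | zero => simp
  | add p q _ _ hp hq => simp [hp, hq, add_mul]
  | monomial d r hr =>
    rw [aeval_monomial, aeval_monomial, Polynomial.C_mul, mul_assoc, Finsupp.prod, Finsupp.prod,
      map_prod, ← hr, Finsupp.weight_apply, Finsupp.sum, ← Finset.prod_pow_eq_pow_sum,
      ← Finset.prod_mul_distrib]
    congr 1
    refine Finset.prod_congr rfl fun s _ => ?_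
    rw [mul_pow, ← pow_mul, smul_eq_mul, mul_comm (w s), Polynomial.C_pow]

/-- If a homogeneous polynomial of degree `m` is divisible by a homogeneous polynomial of degree
`e`, then the quotient may be chosen homogeneous of degree `m - e`. -/
lemma IsWeightedHomogeneous.eq_mul_component {σ R M : Type*} [CommRing R] [AddCommMonoid M]
    [IsLeftCancelAdd M] {w : σ → M} {e k : M} {p q r : MvPolynomial σ R}
    (hp : IsWeightedHomogeneous w p e) (hr : IsWeightedHomogeneous w r (e + k)) (h : r = p * q) :
    r = p * weightedHomogeneousComponent w k q := by
  classical
  let := weightedGradedAlgebra R w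
  let : AddLeftCancelMonoid M := { (inferInstance : AddCommMonoid M) with
    add_left_cancel := fun a b c h => add_left_cancel h }
  have h1 := _root_.DirectSum.coe_decompose_mul_add_of_left_mem (j := k) (b := q)
    (weightedHomogeneousSubmodule R w) ((mem_weightedHomogeneousSubmodule R w e p).2 hp)
  have h2 (x : MvPolynomial σ R) (l : M) :
      ((_root_.DirectSum.decompose (weightedHomogeneousSubmodule R w) x l : _) : MvPolynomial σ R) =
        weightedHomogeneousComponent w l x := weightedDecomposition.decompose'_apply R w x l
  rw [h2, h2, ← h, hr.weightedHomogeneousComponent_same] at h1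
  exact h1

/-- All components of a multiple of `p` have degree at least `e`. This stops the induction on the
bidegree when one of the two degrees is zero. -/
lemma IsWeightedHomogeneous.eq_zero_of_not_le {σ R M : Type*} [CommRing R] [AddCommMonoid M]
    [PartialOrder M] [CanonicallyOrderedAdd M] {w : σ → M} {e m : M}
    {p q r : MvPolynomial σ R} (hp : IsWeightedHomogeneous w p e)
    (hr : IsWeightedHomogeneous w r m) (h : r = p * q) (hem : ¬ e ≤ m) : r = 0 := by
  classical
  let := weightedGradedAlgebra R w
  have h1 := _root_.DirectSum.coe_decompose_mul_of_left_mem_of_not_le (b := q)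
    (weightedHomogeneousSubmodule R w) ((mem_weightedHomogeneousSubmodule R w e p).2 hp) hem
  have h2 (x : MvPolynomial σ R) (l : M) :
      ((_root_.DirectSum.decompose (weightedHomogeneousSubmodule R w) x l : _) : MvPolynomial σ R) =
        weightedHomogeneousComponent w l x := weightedDecomposition.decompose'_apply R w x l
  rw [h2, ← h, hr.weightedHomogeneousComponent_same] at h1
  exact h1

/-! ### Merging two columns of a generic matrix with two rows -/

/-- The `2 × 2` minors of a generic matrix with two rows, columns indexed by `ℕ`. -/
def colMinor (R : Type*) [CommRing R] (j k : ℕ) : MvPolynomial (ℕ × Fin 2) R :=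
  X (j, 0) * X (k, 1) - X (k, 0) * X (j, 1)

/-- Replaces column `n + 1` by column `n`. -/
def mergeIdx (n j : ℕ) : ℕ := if j = n + 1 then n else j

def merge (R : Type*) [CommRing R] (n : ℕ) :
    MvPolynomial (ℕ × Fin 2) R →ₐ[R] MvPolynomial (ℕ × Fin 2) R :=
  MvPolynomial.aeval fun s => X (mergeIdx n s.1, s.2)

/-- The degree in column `j`. -/
def colWeight (j : ℕ) (s : ℕ × Fin 2) : ℕ := if s.1 = j then 1 else 0

/-- Replaces column `n + 1` by `T` times column `n`. -/
def mergeT (R : Type*) [CommRing R] (n : ℕ) :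
    MvPolynomial (ℕ × Fin 2) R →ₐ[R] Polynomial (MvPolynomial (ℕ × Fin 2) R) :=
  MvPolynomial.aeval fun s =>
    Polynomial.C (X (mergeIdx n s.1, s.2)) * Polynomial.X ^ colWeight (n + 1) s

lemma prime_colMinor (R : Type*) [CommRing R] [IsDomain R] [UniqueFactorizationMonoid R] (n : ℕ) :
    Prime (colMinor R n (n + 1)) := by
  have h : colMinor R n (n + 1) = X (n, 0) * X (n + 1, 1) + (-1) * (X (n + 1, 0) * X (n, 1)) := by
    rw [colMinor]; ring
  rw [h]
  refine ColumnAlgebra.prime_of_linear (by simp) _ (ColumnAlgebra.not_mem_vars_mul ?_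
    (ColumnAlgebra.not_mem_vars_mul ?_ ?_)) ?_
  · rw [← C_1, ← C_neg, vars_C]; simp
  · simp [vars_X]
  · simp [vars_X]
  · rintro ⟨r, hr⟩
    have := congrArg (aeval (R := R) fun s : ℕ × Fin 2 => if s = (n, 0) then (0 : R) else 1) hr
    simp at this

/-- Modulo the prime minor, column `n + 1` is a multiple of column `n` over the fraction field of
the quotient. The quotient map therefore factors through `mergeT`, by sending the parameter to the
factor of proportionality. -/
lemma colMinor_dvd_of_mergeT_eq_zero (R : Type*) [CommRing R] [IsDomain R]
    [UniqueFactorizationMonoid R] (n : ℕ) {p : MvPolynomial (ℕ × Fin 2) R}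
    (hp : mergeT R n p = 0) : colMinor R n (n + 1) ∣ p := by
  let I : Ideal (MvPolynomial (ℕ × Fin 2) R) := Ideal.span {colMinor R n (n + 1)}
  have hI : I.IsPrime :=
    (Ideal.span_singleton_prime (prime_colMinor R n).ne_zero).2 (prime_colMinor R n)
  let L := FractionRing (MvPolynomial (ℕ × Fin 2) R ⧸ I)
  let q : MvPolynomial (ℕ × Fin 2) R →ₐ[R] L :=
    (IsScalarTower.toAlgHom R (MvPolynomial (ℕ × Fin 2) R ⧸ I) L).comp (Ideal.Quotient.mkₐ R I)
  have hq (v) : q v = 0 ↔ colMinor R n (n + 1) ∣ v := by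
    change algebraMap (MvPolynomial (ℕ × Fin 2) R ⧸ I) L (Ideal.Quotient.mk I v) = 0 ↔ _
    rw [map_eq_zero_iff _ (IsFractionRing.injective (MvPolynomial (ℕ × Fin 2) R ⧸ I) L),
      Ideal.Quotient.eq_zero_iff_mem, Ideal.mem_span_singleton]
  have hz : q (X (n, 0)) ≠ 0 := by
    rw [Ne, hq]
    rintro ⟨r, hr⟩
    have := congrArg (MvPolynomial.aeval (R := R) fun s : ℕ × Fin 2 => if s.1 = n + 1 then (0 : R) else 1) hr
    simp [colMinor] at this
  let c : L := q (X (n + 1, 0)) / q (X (n, 0))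
  have hc0 : q (X (n, 0)) * c = q (X (n + 1, 0)) := mul_div_cancel₀ _ hz
  have hc1 : q (X (n, 1)) * c = q (X (n + 1, 1)) := by
    have h0 : q (colMinor R n (n + 1)) = 0 := (hq _).2 dvd_rfl
    rw [colMinor, map_sub, map_mul, map_mul] at h0
    rw [← mul_div_assoc, div_eq_iff hz]
    linear_combination -h0
  let ψ : Polynomial (MvPolynomial (ℕ × Fin 2) R) →+* L := Polynomial.eval₂RingHom q.toRingHom c
  have hψ : ψ.comp (mergeT R n : MvPolynomial (ℕ × Fin 2) R →+* _) = q.toRingHom := by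
    refine MvPolynomial.ringHom_ext (fun r => ?_) ?_
    · simp only [RingHom.comp_apply, RingHom.coe_coe, mergeT, aeval_C]
      simp only [ψ, Polynomial.algebraMap_apply, algebraMap_eq, Polynomial.coe_eval₂RingHom,
        Polynomial.eval₂_C]
    · rintro ⟨j, i⟩
      simp only [RingHom.comp_apply, RingHom.coe_coe, mergeT, aeval_X, ψ, map_mul, map_pow,
        Polynomial.coe_eval₂RingHom, Polynomial.eval₂_C, Polynomial.eval₂_X, colWeight, mergeIdx]
      by_cases hj : j = n + 1
      · subst hj
        fin_cases i
        · simpa using hc0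
        · simpa using hc1
      · simp [hj]
  have h1 : q p = 0 := by
    have := DFunLike.congr_fun hψ p
    rw [RingHom.comp_apply, RingHom.coe_coe, hp, map_zero] at this
    exact this.symm
  exact (hq p).1 h1

/-- For elements homogeneous in column `n + 1` the parameter carries no information, so those killed
by `merge` are already killed by `mergeT`. -/
lemma mergeT_eq (R : Type*) [CommRing R] (n : ℕ) {d : ℕ} {p : MvPolynomial (ℕ × Fin 2) R}
    (hp : IsWeightedHomogeneous (colWeight (n + 1)) p d) :
    mergeT R n p = Polynomial.C (merge R n p) * Polynomial.X ^ d :=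
  hp.aeval_C_mul_pow

lemma mem_supported_of_mul_mem {σ R : Type*} [CommRing R] [IsDomain R] {S : Set σ}
    {p q : MvPolynomial σ R} (hp : p ≠ 0) (h : p * q ∈ supported R S) : q ∈ supported R S := by
  by_cases hq : q = 0
  · rw [hq]; exact zero_mem _
  rw [mem_supported] at h ⊢
  intro s hs
  refine h ?_
  rw [Finset.mem_coe, mem_vars_iff_degreeOf_ne_zero] at hs ⊢
  rw [degreeOf_mul_eq hp hq]
  omega

end MvPolynomial

/-! ### The generic ring for an arbitrary number of columns -/

namespace GenericRing

open MvPolynomial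

variable (K : Type*) [Field K]

/-- The coordinate ring of `2 × 4` matrices. -/
abbrev XPoly : Type _ := MvPolynomial (Fin 2 × Fin 4) K

abbrev XFrac : Type _ := FractionRing (XPoly K)

/-- The polynomial ring in the first two rows of `Y`, over the field of rational functions of the
entries of `X`. -/
abbrev Amb : Type _ := MvPolynomial (ℕ × Fin 2) (XFrac K)

def xv (i : Fin 2) (a : Fin 4) : XPoly K := X (i, a)

/-- The `2 × 2` minors of `X`. -/
def del (a b : Fin 4) : XPoly K := xv K 0 a * xv K 1 b - xv K 1 a * xv K 0 b

/-- Embedding of the coordinate ring of `2 × 4` matrices into its field of fractions. -/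
abbrev fr : XPoly K →+* XFrac K := algebraMap _ _

lemma fr_injective : Function.Injective (fr K) := IsFractionRing.injective (XPoly K) (XFrac K)

/-- Expresses the rows of `Y` by the first two rows. -/
def coef : Fin 4 → Fin 2 → XFrac K :=
  ![![1, 0], ![0, 1], ![-(fr K (del K 0 3) / fr K (del K 2 3)), -(fr K (del K 1 3) / fr K (del K 2 3))],
    ![fr K (del K 0 2) / fr K (del K 2 3), fr K (del K 1 2) / fr K (del K 2 3)]]

/-- The entries of the generic matrix `Y` with `XY = 0`. -/
def yEnt (i : Fin 4) (j : ℕ) : Amb K := C (coef K i 0) * X (j, 0) + C (coef K i 1) * X (j, 1)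

/-- The quotient of a minor of `Y` by the complementary minor of `X`. -/
def uEnt (j k : ℕ) : Amb K := C (fr K (del K 2 3))⁻¹ * colMinor (XFrac K) j k

/-- The generators over the coordinate ring of `2 × 4` matrices, for `n` columns. -/
def gens (n : ℕ) : Set (Amb K) :=
  {p | ∃ i, ∃ j < n, p = yEnt K i j} ∪ {p | ∃ j < n, ∃ k < n, p = uEnt K j k}

/-- The generic ring with `n` columns. -/
def ring (n : ℕ) : Subalgebra (XPoly K) (Amb K) := Algebra.adjoin (XPoly K) (gens K n)

lemma algebraMap_eq_C (p : XPoly K) : algebraMap (XPoly K) (Amb K) p = C (fr K p) := by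
  rw [IsScalarTower.algebraMap_apply (XPoly K) (XFrac K) (Amb K)]; rfl

lemma algebraMap_injective : Function.Injective (algebraMap (XPoly K) (Amb K)) := by
  intro a b h
  rw [algebraMap_eq_C, algebraMap_eq_C] at h
  exact fr_injective K (C_injective _ _ h)

lemma yEnt_mem (n : ℕ) (i : Fin 4) {j : ℕ} (h : j < n) : yEnt K i j ∈ ring K n :=
  Algebra.subset_adjoin (Or.inl ⟨i, j, h, rfl⟩)

lemma uEnt_mem (n : ℕ) {j k : ℕ} (h : j < n) (h' : k < n) : uEnt K j k ∈ ring K n :=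
  Algebra.subset_adjoin (Or.inr ⟨j, h, k, h', rfl⟩)

lemma del_ne_zero {a b : Fin 4} (hab : a ≠ b) : del K a b ≠ 0 := by
  intro h
  have := congrArg (MvPolynomial.aeval (R := K) fun s : Fin 2 × Fin 4 =>
    if s = (0, a) ∨ s = (1, b) then (1 : K) else 0) h
  simp [del, xv, hab] at this

lemma fr_del_ne_zero {a b : Fin 4} (hab : a ≠ b) : fr K (del K a b) ≠ 0 :=
  (map_ne_zero_iff _ (fr_injective K)).2 (del_ne_zero K hab)

lemma fr23 : fr K (del K 2 3) ≠ 0 := fr_del_ne_zero K (by decide)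

lemma fr13 : fr K (del K 1 3) ≠ 0 := fr_del_ne_zero K (by decide)

@[simp] lemma yEnt_zero (j : ℕ) : yEnt K 0 j = X (j, 0) := by simp [yEnt, coef]

@[simp] lemma yEnt_one (j : ℕ) : yEnt K 1 j = X (j, 1) := by simp [yEnt, coef]

lemma mul_yEnt_two (j : ℕ) : C (fr K (del K 2 3)) * yEnt K 2 j =
    -(C (fr K (del K 0 3)) * X (j, 0) + C (fr K (del K 1 3)) * X (j, 1)) := by
  simp only [yEnt, coef, mul_add, ← mul_assoc, ← C_mul]
  simp [mul_neg, mul_div_cancel₀ _ (fr23 K)]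
  ring

lemma mul_yEnt_three (j : ℕ) : C (fr K (del K 2 3)) * yEnt K 3 j =
    C (fr K (del K 0 2)) * X (j, 0) + C (fr K (del K 1 2)) * X (j, 1) := by
  simp only [yEnt, coef, mul_add, ← mul_assoc, ← C_mul]
  simp [mul_div_cancel₀ _ (fr23 K)]

lemma C_fr23_ne_zero : (C (fr K (del K 2 3)) : Amb K) ≠ 0 := by
  rw [Ne, C_eq_zero]; exact fr23 K

/-- The relation `XY = 0`. -/
lemma sum_mul_yEnt (i : Fin 2) (j : ℕ) :
    ∑ a, algebraMap (XPoly K) (Amb K) (xv K i a) * yEnt K a j = 0 := by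
  apply mul_left_cancel₀ (C_fr23_ne_zero K)
  rw [Fin.sum_univ_four, mul_zero]
  simp only [algebraMap_eq_C, yEnt_zero, yEnt_one]
  have h2 := mul_yEnt_two K j
  have h3 := mul_yEnt_three K j
  have e (p q : XPoly K) : (C (fr K (p * q)) : Amb K) = C (fr K p) * C (fr K q) := by simp
  have e' (p q : XPoly K) : (C (fr K (p - q)) : Amb K) = C (fr K p) - C (fr K q) := by simp
  simp only [del, e, e'] at h2 h3 ⊢
  fin_cases i
  · simp only [Fin.zero_eta, Fin.isValue]
    linear_combination C (fr K (xv K 0 2)) * h2 + C (fr K (xv K 0 3)) * h3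
  · simp only [Fin.mk_one, Fin.isValue]
    linear_combination C (fr K (xv K 1 2)) * h2 + C (fr K (xv K 1 3)) * h3

lemma mul_uEnt (j k : ℕ) : C (fr K (del K 2 3)) * uEnt K j k = colMinor (XFrac K) j k := by
  rw [uEnt, ← mul_assoc, ← C_mul, mul_inv_cancel₀ (fr23 K), C_1, one_mul]

/-- A coordinate system in which a minor `δ` of `X` is inverted. -/
structure IsChart (δ : XPoly K) (e : MvPolynomial (ℕ × Fin 2) (XPoly K) →ₐ[XPoly K] Amb K) :
    Prop where
  injective : Function.Injective e
  minor : ∃ ε : XPoly K, ε * ε = 1 ∧ ∀ j k, e (colMinor (XPoly K) j k) =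
    algebraMap (XPoly K) (Amb K) (ε * δ) * uEnt K j k
  row : ∃ r : Fin 2 → Fin 4, ∀ s : ℕ × Fin 2, e (X s) = yEnt K (r s.2) s.1
  solve : ∀ i, ∃ c₀ c₁ : XPoly K, ∀ j, algebraMap (XPoly K) (Amb K) δ * yEnt K i j =
    e (C c₀ * X (j, 0) + C c₁ * X (j, 1))

/-- Rows 0 and 1 of `Y` serve as coordinates here, and rows 0 and 2 in `chart₂`. The minor of `X` to
be inverted is the one on the complementary columns, `del K 2 3` and `del K 1 3` respectively. -/
def chart₁ : MvPolynomial (ℕ × Fin 2) (XPoly K) →ₐ[XPoly K] Amb K :=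
  aeval fun s => yEnt K (![0, 1] s.2) s.1

def chart₂ : MvPolynomial (ℕ × Fin 2) (XPoly K) →ₐ[XPoly K] Amb K :=
  aeval fun s => yEnt K (![0, 2] s.2) s.1

@[simp] lemma chart₁_X (j : ℕ) (i : Fin 2) : chart₁ K (X (j, i)) = X (j, i) := by
  fin_cases i <;> simp [chart₁]

@[simp] lemma chart₂_X_zero (j : ℕ) : chart₂ K (X (j, 0)) = X (j, 0) := by
  simp [chart₂]

@[simp] lemma chart₂_X_one (j : ℕ) : chart₂ K (X (j, 1)) = yEnt K 2 j := by
  simp [chart₂]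

lemma chart_C (e : MvPolynomial (ℕ × Fin 2) (XPoly K) →ₐ[XPoly K] Amb K) (c : XPoly K) :
    e (C c) = C (fr K c) := by
  rw [← algebraMap_eq, AlgHom.commutes, algebraMap_eq_C]

lemma chart₁_eq_map : (chart₁ K : _ →+* Amb K) = MvPolynomial.map (fr K) := by
  refine MvPolynomial.ringHom_ext (fun r => ?_) ?_
  · rw [RingHom.coe_coe, chart_C, map_C]
  · rintro ⟨j, i⟩
    simp

lemma chart₁_injective : Function.Injective (chart₁ K) := by
  have := MvPolynomial.map_injective (σ := ℕ × Fin 2) _ (fr_injective K)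
  rw [← chart₁_eq_map] at this
  exact this

lemma isChart₁ : IsChart K (del K 2 3) (chart₁ K) where
  injective := chart₁_injective K
  minor := ⟨1, one_mul _, fun j k => by
    rw [one_mul, algebraMap_eq_C, mul_uEnt]
    simp [colMinor]⟩
  row := ⟨![0, 1], fun s => by simp [chart₁]⟩
  solve i := by
    fin_cases i
    · exact ⟨del K 2 3, 0, fun j => by simp⟩
    · exact ⟨0, del K 2 3, fun j => by simp⟩
    · refine ⟨-del K 0 3, -del K 1 3, fun j => ?_⟩
      have := mul_yEnt_two K j
      simp only [algebraMap_eq_C, map_add, map_mul, chart_C, chart₁_X, map_neg] at this ⊢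
      exact this.trans (by ring)
    · refine ⟨del K 0 2, del K 1 2, fun j => ?_⟩
      have := mul_yEnt_three K j
      simp only [algebraMap_eq_C, map_add, map_mul, chart_C, chart₁_X] at this ⊢
      exact this

/-- Recovers the first two rows of `Y` from the first and the third. -/
def unchart₂ : Amb K →ₐ[XFrac K] Amb K :=
  aeval fun s => if s.2 = 0 then X (s.1, 0) else
    -(C (fr K (del K 2 3) / fr K (del K 1 3)) * X (s.1, 1) +
      C (fr K (del K 0 3) / fr K (del K 1 3)) * X (s.1, 0))

lemma unchart₂_chart₂ (p : MvPolynomial (ℕ × Fin 2) (XPoly K)) :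
    unchart₂ K (chart₂ K p) = chart₁ K p := by
  have h : ((unchart₂ K).restrictScalars (XPoly K)).comp (chart₂ K) = chart₁ K := by
    refine MvPolynomial.algHom_ext ?_
    rintro ⟨j, i⟩
    fin_cases i
    · simp [unchart₂]
    · have h23 := fr23 K
      have h13 := fr13 K
      simp only [Fin.mk_one, Fin.isValue, AlgHom.coe_comp, AlgHom.coe_restrictScalars',
        Function.comp_apply, chart₂_X_one, yEnt, coef, unchart₂, map_add, map_mul, algHom_C,
        aeval_X, chart₁_X, Matrix.cons_val, algebraMap_eq]
      have e1 : (C (-(fr K (del K 1 3) / fr K (del K 2 3))) : Amb K) *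
          C (fr K (del K 2 3) / fr K (del K 1 3)) = -1 := by
        rw [← C_mul, ← C_1, ← C_neg]
        congr 1
        field_simp
      have e2 : (C (-(fr K (del K 1 3) / fr K (del K 2 3))) : Amb K) *
          C (fr K (del K 0 3) / fr K (del K 1 3)) = C (-(fr K (del K 0 3) / fr K (del K 2 3))) := by
        rw [← C_mul]
        congr 1
        field_simp
      simp only [if_true, one_ne_zero, if_false]
      linear_combination (-X (j, 1)) * e1 - X (j, 0) * e2
  exact DFunLike.congr_fun h p

lemma isChart₂ : IsChart K (del K 1 3) (chart₂ K) where
  injective p q h := chart₁_injective K (by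
    rw [← unchart₂_chart₂, ← unchart₂_chart₂, h])
  minor := by
    -- Row 2 of `Y` contains row 1 with coefficient `-(del K 1 3 / del K 2 3)`, whence the sign.
    refine ⟨-1, by ring, fun j k => ?_⟩
    apply mul_left_cancel₀ (C_fr23_ne_zero K)
    have h1 := mul_uEnt K j k
    have hj := mul_yEnt_two K j
    have hk := mul_yEnt_two K k
    simp only [colMinor] at h1
    simp only [colMinor, map_sub, map_mul, chart₂_X_zero, chart₂_X_one, algebraMap_eq_C, map_neg,
      map_one]
    linear_combination X (j, 0) * hk - X (k, 0) * hj + C (fr K (del K 1 3)) * h1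
  row := ⟨![0, 2], fun s => by simp [chart₂]⟩
  solve i := by
    fin_cases i
    · exact ⟨del K 1 3, 0, fun j => by simp⟩
    · refine ⟨-del K 0 3, -del K 2 3, fun j => ?_⟩
      have := mul_yEnt_two K j
      simp only [algebraMap_eq_C, map_add, map_mul, chart_C, chart₂_X_zero, chart₂_X_one, map_neg,
        Fin.mk_one, Fin.isValue, yEnt_one] at this ⊢
      linear_combination this
    · exact ⟨0, del K 1 3, fun j => by simp⟩
    · refine ⟨del K 0 1, -del K 1 2, fun j => ?_⟩
      apply mul_left_cancel₀ (C_fr23_ne_zero K)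
      have h2 := mul_yEnt_two K j
      have h3 := mul_yEnt_three K j
      simp only [algebraMap_eq_C, map_add, map_mul, chart_C, chart₂_X_zero, chart₂_X_one, map_neg,
        Fin.reduceFinMk, Fin.isValue] at h2 h3 ⊢
      have e (p q : XPoly K) : (C (fr K (p * q)) : Amb K) = C (fr K p) * C (fr K q) := by simp
      have e' (p q : XPoly K) : (C (fr K (p - q)) : Amb K) = C (fr K p) - C (fr K q) := by simp
      simp only [del, e, e'] at h2 h3 ⊢
      linear_combination (C (fr K (xv K 0 1)) * C (fr K (xv K 1 3)) -
        C (fr K (xv K 1 1)) * C (fr K (xv K 0 3))) * h3 + (C (fr K (xv K 0 1)) * C (fr K (xv K 1 2)) -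
        C (fr K (xv K 1 1)) * C (fr K (xv K 0 2))) * h2

end GenericRing

/-! ### The generic ring in charts, divisibility by `u`-elements, and homogeneity. -/

namespace GenericRing

open MvPolynomial

variable {K : Type*} [Field K]

/-- The polynomial ring in the first `n` columns. -/
abbrev colSupp (R : Type*) [CommRing R] (n : ℕ) : Subalgebra R (MvPolynomial (ℕ × Fin 2) R) :=
  supported R {s | s.1 < n}

namespace IsChart

variable {δ : XPoly K} {e : MvPolynomial (ℕ × Fin 2) (XPoly K) →ₐ[XPoly K] Amb K}

lemma exists_minor_eq (h : IsChart K δ e) : ∃ ε : XPoly K, ε * ε = 1 ∧ ∀ j k,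
    algebraMap (XPoly K) (Amb K) δ * uEnt K j k = e (C ε * colMinor (XPoly K) j k) := by
  obtain ⟨ε, hε, h⟩ := h.minor
  refine ⟨ε, hε, fun j k => ?_⟩
  rw [map_mul, h, ← algebraMap_eq, AlgHom.commutes, ← mul_assoc, ← map_mul, ← mul_assoc, hε,
    one_mul]

/-- After inverting `δ` the generic ring is a polynomial ring over `K[X]`: this lemma gives one
inclusion, and `map_mem_ring` the other. -/
lemma exists_pow_mul_eq (h : IsChart K δ e) {n : ℕ} {r : Amb K} (hr : r ∈ ring K n) :
    ∃ N : ℕ, ∃ p ∈ colSupp (XPoly K) n, algebraMap (XPoly K) (Amb K) δ ^ N * r = e p := by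
  have hX (j : ℕ) (i : Fin 2) (hj : j < n) : X (j, i) ∈ colSupp (XPoly K) n :=
    X_mem_supported.2 hj
  have hC (c : XPoly K) : C c ∈ colSupp (XPoly K) n := Subalgebra.algebraMap_mem _ c
  let W := (colSupp (XPoly K) n).map e
  have hd : algebraMap (XPoly K) (Amb K) δ ∈ W := W.algebraMap_mem δ
  suffices hs : ring K n ≤ powMulMemSubalgebra W ⊥ _ hd by
    obtain ⟨N, _, ⟨p, hp, rfl⟩, h⟩ := hs hr
    exact ⟨N, p, hp, sub_eq_zero.1 (by simpa using h)⟩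
  rw [ring, Algebra.adjoin_le_iff]
  rintro _ (⟨i, j, hj, rfl⟩ | ⟨j, hj, k, hk, rfl⟩)
  · obtain ⟨c₀, c₁, hc⟩ := h.solve i
    refine ⟨1, _, ⟨C c₀ * X (j, 0) + C c₁ * X (j, 1), ?_, rfl⟩, ?_⟩
    · exact add_mem (mul_mem (hC _) (hX _ _ hj)) (mul_mem (hC _) (hX _ _ hj))
    · simpa [sub_eq_zero] using hc j
  · obtain ⟨ε, -, hε⟩ := h.exists_minor_eq
    refine ⟨1, _, ⟨C ε * colMinor _ j k, ?_, rfl⟩, ?_⟩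
    · exact mul_mem (hC _) (Subalgebra.sub_mem _ (mul_mem (hX _ _ hj) (hX _ _ hk))
        (mul_mem (hX _ _ hk) (hX _ _ hj)))
    · simpa [sub_eq_zero] using hε j k

lemma map_mem_ring (h : IsChart K δ e) {n : ℕ} {p : MvPolynomial (ℕ × Fin 2) (XPoly K)}
    (hp : p ∈ colSupp (XPoly K) n) : e p ∈ ring K n := by
  obtain ⟨r, hr⟩ := h.row
  have : colSupp (XPoly K) n ≤ (ring K n).comap e := by
    rw [colSupp, supported_eq_adjoin_X, Algebra.adjoin_le_iff]
    rintro _ ⟨s, hs, rfl⟩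
    change e (X s) ∈ ring K n
    rw [hr]
    exact yEnt_mem K n _ hs
  exact this hp

end IsChart

@[simp] lemma merge_yEnt (n : ℕ) (i : Fin 4) (j : ℕ) :
    merge (XFrac K) n (yEnt K i j) = yEnt K i (mergeIdx n j) := by
  simp [yEnt, merge]

@[simp] lemma merge_uEnt (n : ℕ) (j k : ℕ) :
    merge (XFrac K) n (uEnt K j k) = uEnt K (mergeIdx n j) (mergeIdx n k) := by
  simp [uEnt, merge, colMinor]

lemma mergeT_yEnt (n : ℕ) (i : Fin 4) (j : ℕ) : mergeT (XFrac K) n (yEnt K i j) =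
    Polynomial.C (yEnt K i (mergeIdx n j)) * Polynomial.X ^ (if j = n + 1 then 1 else 0) := by
  simp only [yEnt, mergeT, map_add, map_mul, aeval_X, colWeight, algHom_C,
    Polynomial.algebraMap_apply, algebraMap_eq]
  ring

lemma mergeIdx_lt {n j : ℕ} (h : j < n + 2) : mergeIdx n j < n + 1 := by
  unfold mergeIdx; split_ifs <;> omega

lemma merge_mem_ring {n : ℕ} {r : Amb K} (hr : r ∈ ring K (n + 2)) :
    merge (XFrac K) n r ∈ ring K (n + 1) := by
  have : ring K (n + 2) ≤ (ring K (n + 1)).comap ((merge (XFrac K) n).restrictScalars (XPoly K)) := by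
    rw [ring, Algebra.adjoin_le_iff]
    rintro _ (⟨i, j, hj, rfl⟩ | ⟨j, hj, k, hk, rfl⟩)
    · change merge (XFrac K) n (yEnt K i j) ∈ ring K (n + 1)
      rw [merge_yEnt]
      exact yEnt_mem K _ _ (mergeIdx_lt hj)
    · change merge (XFrac K) n (uEnt K j k) ∈ ring K (n + 1)
      rw [merge_uEnt]
      exact uEnt_mem K _ (mergeIdx_lt hj) (mergeIdx_lt hk)
  exact this hr

lemma merge_algebraMap_mul (n : ℕ) (c : XPoly K) (r : Amb K) :
    merge (XFrac K) n (algebraMap (XPoly K) (Amb K) c * r) =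
      algebraMap (XPoly K) (Amb K) c * merge (XFrac K) n r := by
  rw [map_mul, algebraMap_eq_C]
  congr 1
  simp [merge]

lemma colMinor_ne_zero (R : Type*) [CommRing R] [Nontrivial R] {j k : ℕ} (h : j ≠ k) :
    colMinor R j k ≠ 0 := by
  intro h0
  have := congrArg (aeval (R := R) fun s : ℕ × Fin 2 =>
    if s = (j, 0) ∨ s = (k, 1) then (1 : R) else 0) h0
  simp [colMinor, h, h.symm] at this

lemma uEnt_ne_zero {j k : ℕ} (h : j ≠ k) : uEnt K j k ≠ 0 := by
  rw [uEnt]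
  exact mul_ne_zero (by simpa using fr23 K) (colMinor_ne_zero (XFrac K) h)

lemma exists_eq_uEnt_mul (n : ℕ) {h : Amb K} (h0 : mergeT (XFrac K) n h = 0) :
    ∃ q, h = uEnt K n (n + 1) * q := by
  obtain ⟨q, hq⟩ := colMinor_dvd_of_mergeT_eq_zero (XFrac K) n h0
  refine ⟨C (fr K (del K 2 3)) * q, ?_⟩
  rw [← mul_assoc, mul_comm (uEnt K _ _), mul_uEnt, hq]

/-- Division by the `u`-element of the last two columns preserves regularity in a chart. -/
lemma IsChart.exists_pow_mul_mem {δ : XPoly K}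
    {e : MvPolynomial (ℕ × Fin 2) (XPoly K) →ₐ[XPoly K] Amb K} (hc : IsChart K δ e)
    {n N : ℕ} {h q : Amb K} (hq : h = uEnt K n (n + 1) * q)
    (hN : algebraMap (XPoly K) (Amb K) δ ^ N * h ∈ ring K (n + 2))
    (h0 : mergeT (XFrac K) n h = 0) :
    ∃ M, algebraMap (XPoly K) (Amb K) δ ^ M * q ∈ ring K (n + 2) := by
  obtain ⟨M, p, hp, hMp⟩ := hc.exists_pow_mul_eq hN
  obtain ⟨r, hr⟩ := hc.row
  have hcomp (v) : mergeT (XFrac K) n (e v) =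
      Polynomial.map (e : _ →+* Amb K) (mergeT (XPoly K) n v) := by
    have : (mergeT (XFrac K) n : _ →+* Polynomial (Amb K)).comp (e : _ →+* Amb K) =
        (Polynomial.mapRingHom (e : _ →+* Amb K)).comp (mergeT (XPoly K) n : MvPolynomial (ℕ × Fin 2) (XPoly K) →+* Polynomial (MvPolynomial (ℕ × Fin 2) (XPoly K))) := by
      refine MvPolynomial.ringHom_ext (fun c => ?_) (fun s => ?_)
      · simp only [RingHom.comp_apply, RingHom.coe_coe, mergeT, algHom_C,
          Polynomial.algebraMap_apply, algebraMap_eq, Polynomial.coe_mapRingHom,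
          Polynomial.map_C, algebraMap_eq_C]
      · simp only [RingHom.comp_apply, RingHom.coe_coe, hr, mergeT_yEnt]
        simp only [mergeT, aeval_X, Polynomial.coe_mapRingHom, Polynomial.map_mul,
          Polynomial.map_C, Polynomial.map_pow, Polynomial.map_X, RingHom.coe_coe, hr, colWeight]
    exact DFunLike.congr_fun this v
  have hp0 : mergeT (XPoly K) n p = 0 := by
    refine Polynomial.map_injective (e : _ →+* Amb K) hc.injective ?_
    rw [← hcomp, ← hMp, map_mul, map_mul, h0, mul_zero, mul_zero, Polynomial.map_zero]
  -- Divisibility is now obtained over `XPoly K` and no longer over its fraction field, so the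
  -- quotient has no denominators in the entries of `X`.
  obtain ⟨p', rfl⟩ := colMinor_dvd_of_mergeT_eq_zero (XPoly K) n hp0
  have hp' : p' ∈ colSupp (XPoly K) (n + 2) :=
    mem_supported_of_mul_mem (colMinor_ne_zero _ (by omega)) hp
  obtain ⟨ε, -, hε⟩ := hc.minor
  rw [map_mul, hε, hq] at hMp
  -- In the chart the minor is `ε * δ` times the `u`-element; cancelling the latter leaves
  -- coefficients in `XPoly K`.
  have key : algebraMap (XPoly K) (Amb K) δ ^ (M + N) * q =
      algebraMap (XPoly K) (Amb K) (ε * δ) * e p' := by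
    apply mul_left_cancel₀ (uEnt_ne_zero (K := K) (show n ≠ n + 1 by omega))
    rw [pow_add]
    linear_combination hMp
  exact ⟨M + N, key ▸ mul_mem (Subalgebra.algebraMap_mem _ _) (hc.map_mem_ring hp')⟩

/-! ### Homogeneity -/

section Homogeneous

variable {M : Type*} [AddCommMonoid M] (ω : ℕ → M)

lemma isWeightedHomogeneous_yEnt (i : Fin 4) (j : ℕ) :
    IsWeightedHomogeneous (fun s : ℕ × Fin 2 => ω s.1) (yEnt K i j) (ω j) :=
  ((isWeightedHomogeneous_X _ _ (j, (0 : Fin 2))).C_mul _).add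
    ((isWeightedHomogeneous_X _ _ (j, (1 : Fin 2))).C_mul _)

lemma isWeightedHomogeneous_uEnt (j k : ℕ) :
    IsWeightedHomogeneous (fun s : ℕ × Fin 2 => ω s.1) (uEnt K j k) (ω j + ω k) := by
  refine IsWeightedHomogeneous.C_mul ?_ _
  rw [colMinor, sub_eq_add_neg]
  refine IsWeightedHomogeneous.add ?_ (IsWeightedHomogeneous.neg ?_)
  · exact (isWeightedHomogeneous_X _ _ (j, (0 : Fin 2))).mul
      (isWeightedHomogeneous_X _ _ (k, (1 : Fin 2)))
  · rw [add_comm]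
    exact (isWeightedHomogeneous_X _ _ (k, (0 : Fin 2))).mul
      (isWeightedHomogeneous_X _ _ (j, (1 : Fin 2)))

lemma exists_isWeightedHomogeneous {n : ℕ} {m : Amb K}
    (hm : m ∈ Submonoid.closure (gens K n)) :
    ∃ d, IsWeightedHomogeneous (fun s : ℕ × Fin 2 => ω s.1) m d := by
  induction hm using Submonoid.closure_induction with
  | mem x h =>
    rcases h with ⟨i, j, -, rfl⟩ | ⟨j, -, k, -, rfl⟩
    · exact ⟨_, isWeightedHomogeneous_yEnt ω i j⟩
    · exact ⟨_, isWeightedHomogeneous_uEnt ω j k⟩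
  | one => exact ⟨0, isWeightedHomogeneous_one _ _⟩
  | mul x y _ _ hx hy =>
    obtain ⟨d, hx⟩ := hx
    obtain ⟨e, hy⟩ := hy
    exact ⟨d + e, hx.mul hy⟩

lemma mem_ring_iff {n : ℕ} {r : Amb K} :
    r ∈ ring K n ↔ r ∈ Submodule.span (XPoly K) (Submonoid.closure (gens K n) : Set (Amb K)) := by
  rw [← Algebra.adjoin_eq_span]; rfl

lemma component_smul (w : ℕ × Fin 2 → M) (m : M) (c : XPoly K) (r : Amb K) :
    weightedHomogeneousComponent w m (c • r) = c • weightedHomogeneousComponent w m r :=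
  LinearMap.map_smul_of_tower _ c r

lemma component_algebraMap_mul (w : ℕ × Fin 2 → M) (m : M) (c : XPoly K) (r : Amb K) :
    weightedHomogeneousComponent w m (algebraMap (XPoly K) (Amb K) c * r) =
      algebraMap (XPoly K) (Amb K) c * weightedHomogeneousComponent w m r := by
  rw [← Algebra.smul_def, component_smul, Algebra.smul_def]

/-- Over `XPoly K` the generic ring is spanned by products of generators, and these are homogeneous
for every weighting of the columns. -/
lemma component_mem_ring {n : ℕ} (m : M) {r : Amb K} (hr : r ∈ ring K n) :
    weightedHomogeneousComponent (fun s : ℕ × Fin 2 => ω s.1) m r ∈ ring K n := by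
  classical
  rw [mem_ring_iff] at hr
  induction hr using Submodule.span_induction with
  | mem x h =>
    obtain ⟨d, hd⟩ := exists_isWeightedHomogeneous ω h
    rw [weightedHomogeneousComponent_of_mem ((mem_weightedHomogeneousSubmodule _ _ _ _).2 hd)]
    split_ifs
    · exact mem_ring_iff.2 (Submodule.subset_span h)
    · exact zero_mem _
  | zero => rw [map_zero]; exact zero_mem _
  | add x y _ _ hx hy => rw [map_add]; exact add_mem hx hy
  | smul c x _ hx => rw [component_smul]; exact Subalgebra.smul_mem _ hx c

end Homogeneous

end GenericRing

/-! ### Lifting elements from merged columns with prescribed bidegree. -/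

namespace GenericRing

open MvPolynomial

variable {K : Type*} [Field K]

/-- The degree in column `n`. -/
def weight₁ (n j : ℕ) : ℕ := if j = n then 1 else 0

/-- The degrees in the columns `n` and `n + 1`. -/
def weight₂ (n j : ℕ) : ℕ × ℕ := if j = n then (1, 0) else if j = n + 1 then (0, 1) else 0

lemma weight₂_self (n : ℕ) : weight₂ n n = (1, 0) := by simp [weight₂]

lemma weight₂_succ (n : ℕ) : weight₂ n (n + 1) = (0, 1) := by simp [weight₂]

lemma weight₂_of_lt {n j : ℕ} (h : j < n) : weight₂ n j = 0 := by
  unfold weight₂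
  rw [if_neg (by omega), if_neg (by omega)]

lemma weight₁_self (n : ℕ) : weight₁ n n = 1 := by simp [weight₁]

lemma weight₁_of_lt {n j : ℕ} (h : j < n) : weight₁ n j = 0 := by
  unfold weight₁
  rw [if_neg (by omega)]

lemma mergeIdx_of_lt {n j : ℕ} (h : j < n) : mergeIdx n j = j := by
  unfold mergeIdx
  rw [if_neg (by omega)]

@[simp] lemma mergeIdx_self (n : ℕ) : mergeIdx n n = n := by
  unfold mergeIdx
  rw [if_neg (by omega)]

@[simp] lemma mergeIdx_succ (n : ℕ) : mergeIdx n (n + 1) = n := by simp [mergeIdx]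

abbrev byCol {M : Type*} (ω : ℕ → M) (s : ℕ × Fin 2) : M := ω s.1

/-- `m` is homogeneous in column `n`, and every distribution of its degree over the columns
`n` and `n + 1` is realized by an element of the generic ring that becomes `m` when these columns
are merged. -/
def Polarizable (n : ℕ) (m : Amb K) : Prop :=
  ∃ d, IsWeightedHomogeneous (byCol (weight₁ n)) m d ∧ ∀ a b, a + b = d →
    ∃ G ∈ ring K (n + 2), merge (XFrac K) n G = m ∧
      IsWeightedHomogeneous (byCol (weight₂ n)) G (a, b)

lemma Polarizable.mul {n : ℕ} {m m' : Amb K} (h : Polarizable n m) (h' : Polarizable n m') :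
    Polarizable n (m * m') := by
  obtain ⟨d, hd, h⟩ := h
  obtain ⟨d', hd', h'⟩ := h'
  refine ⟨d + d', hd.mul hd', fun a b hab => ?_⟩
  -- The first factor takes as much of the degree `a` as it can hold, and the second takes what
  -- remains.
  obtain ⟨G, hG, rfl, hw⟩ := h (min a d) (d - min a d) (by omega)
  obtain ⟨G', hG', rfl, hw'⟩ := h' (a - min a d) (b - (d - min a d)) (by omega)
  refine ⟨G * G', mul_mem hG hG', map_mul _ _ _, ?_⟩
  convert hw.mul hw' using 1
  ext
  · simp
  · simp; omega

lemma polarizable_one (n : ℕ) : Polarizable n (1 : Amb K) := by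
  refine ⟨0, isWeightedHomogeneous_one _ _, fun a b hab => ⟨1, one_mem _, map_one _, ?_⟩⟩
  obtain ⟨rfl, rfl⟩ : a = 0 ∧ b = 0 := by omega
  exact isWeightedHomogeneous_one _ _

lemma polarizable_yEnt {n j : ℕ} (i : Fin 4) (hj : j < n + 1) : Polarizable n (yEnt K i j) := by
  refine ⟨weight₁ n j, isWeightedHomogeneous_yEnt _ i j, fun a b hab => ?_⟩
  rcases Nat.lt_succ_iff_lt_or_eq.1 hj with h | rfl
  · rw [weight₁_of_lt h] at hab
    obtain ⟨rfl, rfl⟩ : a = 0 ∧ b = 0 := by omega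
    refine ⟨yEnt K i j, yEnt_mem K _ _ (by omega), by rw [merge_yEnt, mergeIdx_of_lt h], ?_⟩
    have := isWeightedHomogeneous_yEnt (K := K) (weight₂ n) i j
    rwa [weight₂_of_lt h] at this
  · rw [weight₁_self] at hab
    obtain ⟨rfl, rfl⟩ | ⟨rfl, rfl⟩ : (a = 1 ∧ b = 0) ∨ (a = 0 ∧ b = 1) := by omega
    · refine ⟨yEnt K i j, yEnt_mem K _ _ (by omega), by simp, ?_⟩
      have := isWeightedHomogeneous_yEnt (K := K) (weight₂ j) i j
      rwa [weight₂_self] at this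
    · refine ⟨yEnt K i (j + 1), yEnt_mem K _ _ (by omega), by simp, ?_⟩
      have := isWeightedHomogeneous_yEnt (K := K) (weight₂ j) i (j + 1)
      rwa [weight₂_succ] at this

lemma uEnt_swap (j k : ℕ) : uEnt K k j = -uEnt K j k := by
  simp only [uEnt, colMinor]; ring

lemma uEnt_self (j : ℕ) : uEnt K j j = 0 := by
  simp only [uEnt, colMinor]; ring

lemma Polarizable.neg {n : ℕ} {m : Amb K} (h : Polarizable n m) : Polarizable n (-m) := by
  obtain ⟨d, hd, h⟩ := h
  refine ⟨d, hd.neg, fun a b hab => ?_⟩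
  obtain ⟨G, hG, rfl, hw⟩ := h a b hab
  exact ⟨-G, Subalgebra.neg_mem _ hG, map_neg _ _, hw.neg⟩

lemma polarizable_uEnt_of_lt {n j k : ℕ} (hj : j < n) (hk : k < n + 1) :
    Polarizable n (uEnt K j k) := by
  refine ⟨weight₁ n j + weight₁ n k, isWeightedHomogeneous_uEnt _ j k, fun a b hab => ?_⟩
  rw [weight₁_of_lt hj, zero_add] at hab
  rcases Nat.lt_succ_iff_lt_or_eq.1 hk with h | rfl
  · rw [weight₁_of_lt h] at hab
    obtain ⟨rfl, rfl⟩ : a = 0 ∧ b = 0 := by omega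
    refine ⟨uEnt K j k, uEnt_mem K _ (by omega) (by omega),
      by rw [merge_uEnt, mergeIdx_of_lt h, mergeIdx_of_lt hj], ?_⟩
    have := isWeightedHomogeneous_uEnt (K := K) (weight₂ n) j k
    rwa [weight₂_of_lt h, weight₂_of_lt hj] at this
  · rw [weight₁_self] at hab
    obtain ⟨rfl, rfl⟩ | ⟨rfl, rfl⟩ : (a = 1 ∧ b = 0) ∨ (a = 0 ∧ b = 1) := by omega
    · refine ⟨uEnt K j k, uEnt_mem K _ (by omega) (by omega), by simp [mergeIdx_of_lt hj], ?_⟩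
      have := isWeightedHomogeneous_uEnt (K := K) (weight₂ k) j k
      rwa [weight₂_self, weight₂_of_lt hj] at this
    · refine ⟨uEnt K j (k + 1), uEnt_mem K _ (by omega) (by omega),
        by simp [mergeIdx_of_lt hj], ?_⟩
      have := isWeightedHomogeneous_uEnt (K := K) (weight₂ k) j (k + 1)
      rwa [weight₂_succ, weight₂_of_lt hj] at this

lemma polarizable_uEnt {n j k : ℕ} (hj : j < n + 1) (hk : k < n + 1) :
    Polarizable n (uEnt K j k) := by
  rcases Nat.lt_succ_iff_lt_or_eq.1 hj with h | rfl
  · exact polarizable_uEnt_of_lt h hk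
  rcases Nat.lt_succ_iff_lt_or_eq.1 hk with h | rfl
  · rw [uEnt_swap]
    exact (polarizable_uEnt_of_lt h hj).neg
  -- Only the case `j = k = n` is left; this `u`-element vanishes and is lifted by zero.
  · rw [uEnt_self]
    exact ⟨0, isWeightedHomogeneous_zero _ _ _, fun a b _ =>
      ⟨0, zero_mem _, map_zero _, isWeightedHomogeneous_zero _ _ _⟩⟩

lemma polarizable_of_mem_closure {n : ℕ} {m : Amb K}
    (hm : m ∈ Submonoid.closure (gens K (n + 1))) : Polarizable n m := by
  induction hm using Submonoid.closure_induction with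
  | mem x h =>
    rcases h with ⟨i, j, hj, rfl⟩ | ⟨j, hj, k, hk, rfl⟩
    · exact polarizable_yEnt i hj
    · exact polarizable_uEnt hj hk
  | one => exact polarizable_one n
  | mul x y _ _ hx hy => exact hx.mul hy

/-- By linearity it is enough to treat products of generators. A lift is obtained by distributing
the occurrences of column `n` over the columns `n` and `n + 1`. -/
lemma exists_polarization {n : ℕ} {c : Amb K} (hc : c ∈ ring K (n + 1)) (a b : ℕ) :
    ∃ G ∈ ring K (n + 2),
      merge (XFrac K) n G = weightedHomogeneousComponent (byCol (weight₁ n)) (a + b) c ∧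
      IsWeightedHomogeneous (byCol (weight₂ n)) G (a, b) := by
  rw [mem_ring_iff] at hc
  induction hc using Submodule.span_induction with
  | mem x h =>
    obtain ⟨d, hd, h⟩ := polarizable_of_mem_closure h
    rw [weightedHomogeneousComponent_of_mem ((mem_weightedHomogeneousSubmodule _ _ _ _).2 hd)]
    split_ifs with hab
    · exact h a b hab
    · exact ⟨0, zero_mem _, map_zero _, isWeightedHomogeneous_zero _ _ _⟩
  | zero => exact ⟨0, zero_mem _, by simp, isWeightedHomogeneous_zero _ _ _⟩
  | add x y _ _ hx hy =>
    obtain ⟨G, hG, hm, hw⟩ := hx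
    obtain ⟨G', hG', hm', hw'⟩ := hy
    exact ⟨G + G', add_mem hG hG', by rw [map_add, map_add, hm, hm'], hw.add hw'⟩
  | smul r x _ hx =>
    obtain ⟨G, hG, hm, hw⟩ := hx
    refine ⟨r • G, Subalgebra.smul_mem _ hG r, ?_, ?_⟩
    · rw [component_smul, ← hm]
      exact map_smul ((merge (XFrac K) n).restrictScalars (XPoly K)) r G
    · rw [Algebra.smul_def, algebraMap_eq_C]
      exact hw.C_mul _

lemma isWeightedHomogeneous_map {σ R M N : Type*} [CommRing R] [AddCommMonoid M] [AddCommMonoid N]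
    {w : σ → M} (φ : M →+ N) {m : M} {p : MvPolynomial σ R} (hp : IsWeightedHomogeneous w p m) :
    IsWeightedHomogeneous (φ ∘ w) p (φ m) := by
  have := hp.aeval φ (w' := φ ∘ w) (fun s => isWeightedHomogeneous_X R (φ ∘ w) s)
  rwa [aeval_X_left_apply] at this

lemma isWeightedHomogeneous_merge {n a b : ℕ} {h : Amb K}
    (hw : IsWeightedHomogeneous (byCol (weight₂ n)) h (a, b)) :
    IsWeightedHomogeneous (byCol (weight₁ n)) (merge (XFrac K) n h) (a + b) := by
  refine IsWeightedHomogeneous.aeval (AddMonoidHom.coprod (AddMonoidHom.id ℕ) (AddMonoidHom.id ℕ))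
    (fun s => ?_) hw
  have e : (AddMonoidHom.coprod (AddMonoidHom.id ℕ) (AddMonoidHom.id ℕ)) (byCol (weight₂ n) s) =
      byCol (weight₁ n) (mergeIdx n s.1, s.2) := by
    simp only [byCol, weight₁, weight₂, mergeIdx]
    split_ifs <;> first | omega | simp
  rw [e]
  exact isWeightedHomogeneous_X (XFrac K) (byCol (weight₁ n)) (mergeIdx n s.1, s.2)

lemma mergeT_eq_zero {n a b : ℕ} {h : Amb K}
    (hw : IsWeightedHomogeneous (byCol (weight₂ n)) h (a, b)) (h0 : merge (XFrac K) n h = 0) :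
    mergeT (XFrac K) n h = 0 := by
  have h1 : IsWeightedHomogeneous (colWeight (n + 1)) h b := by
    have e : (AddMonoidHom.snd ℕ ℕ) ∘ byCol (weight₂ n) = colWeight (n + 1) := by
      funext s
      simp only [colWeight, Function.comp_apply, byCol, weight₂]
      split_ifs <;> first | omega | simp
    rw [← e]
    exact isWeightedHomogeneous_map (AddMonoidHom.snd ℕ ℕ) hw
  rw [mergeT_eq _ _ h1, h0, map_zero, zero_mul]

end GenericRing

namespace GenericRing

open MvPolynomial

variable (K : Type*) [Field K]

/-! ### The case of one column -/

/-- The parametrization of the generic ring with one column. -/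
def oneCol : ColumnAlgebra.Poly K →ₐ[K] Amb K :=
  aeval (Sum.elim (fun p => algebraMap (XPoly K) (Amb K) (xv K p.1 p.2)) (fun a => yEnt K a 0))

@[simp] lemma oneCol_x (i : Fin 2) (a : Fin 4) :
    oneCol K (ColumnAlgebra.x K i a) = algebraMap (XPoly K) (Amb K) (xv K i a) := by
  simp [oneCol, ColumnAlgebra.x]

@[simp] lemma oneCol_y (a : Fin 4) : oneCol K (ColumnAlgebra.y K a) = yEnt K a 0 := by
  simp [oneCol, ColumnAlgebra.y]

lemma oneCol_minor (a b : Fin 4) :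
    oneCol K (ColumnAlgebra.minor K a b) = algebraMap (XPoly K) (Amb K) (del K a b) := by
  simp only [ColumnAlgebra.minor, del, map_sub, map_mul, oneCol_x]

lemma oneCol_form (i : Fin 2) : oneCol K (ColumnAlgebra.form K i) = 0 := by
  rw [← sum_mul_yEnt K i 0, Fin.sum_univ_four, ColumnAlgebra.form]
  simp

lemma oneCol_eq_zero_of_mem {v : ColumnAlgebra.Poly K} (hv : v ∈ ColumnAlgebra.ideal K) :
    oneCol K v = 0 :=
  ColumnAlgebra.map_eq_zero_of_mem_ideal K (oneCol K : ColumnAlgebra.Poly K →+* Amb K)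
    (oneCol_form K 0) (oneCol_form K 1) hv

/-- The variables other than the last two entries of the column. -/
def topVars : Set ((Fin 2 × Fin 4) ⊕ Fin 4) := {s | s ≠ Sum.inr 2 ∧ s ≠ Sum.inr 3}

/-- Cramer's rule: eliminating one unknown from the two forms expresses `minor 2 3` times `y 2` or
`y 3` by `y 0` and `y 1`. -/
lemma exists_pow_minor_mul_sub_mem (v : ColumnAlgebra.Poly K) :
    ∃ N : ℕ, ∃ w ∈ supported K topVars,
      ColumnAlgebra.minor K 2 3 ^ N * v - w ∈ ColumnAlgebra.ideal K := by
  have hm (a b : Fin 4) : ColumnAlgebra.minor K a b ∈ supported K topVars :=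
    ColumnAlgebra.minor_mem_supported K (by simp [topVars]) (by simp [topVars])
  have hy0 : ColumnAlgebra.y K 0 ∈ supported K topVars :=
    ColumnAlgebra.y_mem_supported K (by simp [topVars])
  have hy1 : ColumnAlgebra.y K 1 ∈ supported K topVars :=
    ColumnAlgebra.y_mem_supported K (by simp [topVars])
  have hf := ColumnAlgebra.form_mem_ideal K
  refine exists_pow_mul_sub_mem (hm 2 3) ?_ v
  intro s
  by_cases hs : s ∈ topVars
  · exact Or.inl (X_mem_supported.2 hs)
  right
  obtain rfl | rfl : s = Sum.inr 2 ∨ s = Sum.inr 3 := by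
    by_contra! h
    exact hs h
  · refine ⟨-(ColumnAlgebra.minor K 0 3 * ColumnAlgebra.y K 0 +
      ColumnAlgebra.minor K 1 3 * ColumnAlgebra.y K 1),
      neg_mem (add_mem (mul_mem (hm _ _) hy0) (mul_mem (hm _ _) hy1)), ?_⟩
    convert sub_mem (Ideal.mul_mem_left _ (ColumnAlgebra.x K 1 3) (hf 0))
      (Ideal.mul_mem_left _ (ColumnAlgebra.x K 0 3) (hf 1)) using 1
    simp only [ColumnAlgebra.minor, ColumnAlgebra.form, ColumnAlgebra.y]
    ring
  · refine ⟨ColumnAlgebra.minor K 0 2 * ColumnAlgebra.y K 0 +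
      ColumnAlgebra.minor K 1 2 * ColumnAlgebra.y K 1,
      add_mem (mul_mem (hm _ _) hy0) (mul_mem (hm _ _) hy1), ?_⟩
    convert sub_mem (Ideal.mul_mem_left _ (ColumnAlgebra.x K 0 2) (hf 1))
      (Ideal.mul_mem_left _ (ColumnAlgebra.x K 1 2) (hf 0)) using 1
    simp only [ColumnAlgebra.minor, ColumnAlgebra.form, ColumnAlgebra.y]
    ring

/-- The coordinate ring of `2 × 4` matrices as a subring of the polynomial ring with an additional
column. -/
def xIncl : XPoly K →ₐ[K] ColumnAlgebra.Poly K := rename Sum.inl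

lemma toFrac_comp_xIncl_injective :
    Function.Injective ((ColumnAlgebra.toFrac K).comp (xIncl K)) :=
  (ColumnAlgebra.toFrac_injective K).comp (rename_injective _ Sum.inl_injective)

/-- Evaluation of the columns at a generic column. -/
def evalCol : Amb K →+* FractionRing (ColumnAlgebra.Poly K) :=
  eval₂Hom ((IsFractionRing.liftAlgHom (toFrac_comp_xIncl_injective K) :
      XFrac K →ₐ[K] FractionRing (ColumnAlgebra.Poly K)) : XFrac K →+* _)
    (fun s => ColumnAlgebra.toFrac K (ColumnAlgebra.y K (![0, 1] s.2)))

lemma evalCol_algebraMap (p : XPoly K) : evalCol K (algebraMap (XPoly K) (Amb K) p) =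
    ColumnAlgebra.toFrac K (xIncl K p) := by
  rw [algebraMap_eq_C, evalCol, coe_eval₂Hom, eval₂_C, RingHom.coe_coe]
  exact IsFractionRing.lift_algebraMap (toFrac_comp_xIncl_injective K) p

lemma evalCol_oneCol {w : ColumnAlgebra.Poly K} (hw : w ∈ supported K topVars) :
    evalCol K (oneCol K w) = ColumnAlgebra.toFrac K w := by
  rw [supported_eq_adjoin_X] at hw
  induction hw using Algebra.adjoin_induction with
  | mem v hv =>
    obtain ⟨(⟨i, a⟩ | a), hs, rfl⟩ := hv
    · change evalCol K (oneCol K (ColumnAlgebra.x K i a)) = _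
      rw [oneCol_x, evalCol_algebraMap, xv, xIncl, rename_X]
    · change evalCol K (oneCol K (ColumnAlgebra.y K a)) = ColumnAlgebra.toFrac K (ColumnAlgebra.y K a)
      rw [oneCol_y]
      fin_cases a
      · simp [evalCol]
      · simp [evalCol]
      · exact absurd rfl hs.1
      · exact absurd rfl hs.2
  | algebraMap r =>
    rw [AlgHom.commutes, AlgHom.commutes, IsScalarTower.algebraMap_apply K (XPoly K) (Amb K),
      evalCol_algebraMap, AlgHom.commutes, AlgHom.commutes]
  | add a b _ _ ha hb => simp only [map_add, ha, hb]
  | mul a b _ _ ha hb => simp only [map_mul, ha, hb]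

/-- On the variables other than `y 2` and `y 3` the map `oneCol` is injective, as `evalCol` undoes
it, and powers of `minor 2 3` reduce everything to these variables. -/
lemma oneCol_eq_zero_iff (v : ColumnAlgebra.Poly K) :
    oneCol K v = 0 ↔ v ∈ ColumnAlgebra.ideal K := by
  refine ⟨fun h => mem_of_map_eq_zero (ColumnAlgebra.minor23_mod_ideal K)
    (oneCol K : ColumnAlgebra.Poly K →+* Amb K)
    (fun v => oneCol_eq_zero_of_mem K) ?_ (exists_pow_minor_mul_sub_mem K v) h,
    oneCol_eq_zero_of_mem K⟩
  intro w hw h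
  have h1 := evalCol_oneCol K hw
  rw [RingHom.coe_coe] at h
  rw [h, map_zero] at h1
  exact (map_eq_zero_iff _ (ColumnAlgebra.toFrac_injective K)).1 h1.symm

lemma algebraMap_mem_range_oneCol (p : XPoly K) :
    algebraMap (XPoly K) (Amb K) p ∈ (oneCol K).range := by
  refine ⟨xIncl K p, ?_⟩
  have : (oneCol K).comp (xIncl K) = IsScalarTower.toAlgHom K (XPoly K) (Amb K) := by
    refine MvPolynomial.algHom_ext ?_
    rintro ⟨i, a⟩
    simp [oneCol, xIncl, xv]
  exact DFunLike.congr_fun this p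

/-- With a single column the only `u`-element is `uEnt 0 0 = 0`, so the generic ring is the column
algebra. -/
lemma mem_ring_one_iff {r : Amb K} : r ∈ ring K 1 ↔ r ∈ (oneCol K).range := by
  constructor
  · intro hr
    induction hr using Algebra.adjoin_induction with
    | mem x h =>
      rcases h with ⟨i, j, hj, rfl⟩ | ⟨j, hj, k, hk, rfl⟩
      · obtain rfl : j = 0 := by omega
        exact ⟨ColumnAlgebra.y K i, oneCol_y K i⟩
      · obtain rfl : j = 0 := by omega
        obtain rfl : k = 0 := by omega
        rw [uEnt_self]
        exact zero_mem _
    | algebraMap p => exact algebraMap_mem_range_oneCol K p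
    | add a b _ _ ha hb => exact add_mem ha hb
    | mul a b _ _ ha hb => exact mul_mem ha hb
  · rintro ⟨v, rfl⟩
    change oneCol K v ∈ _
    induction v using MvPolynomial.induction_on with
    | C c =>
      rw [← algebraMap_eq, AlgHom.commutes, IsScalarTower.algebraMap_apply K (XPoly K) (Amb K)]
      exact Subalgebra.algebraMap_mem _ _
    | add p q hp hq => rw [map_add]; exact add_mem hp hq
    | mul_X p s hp =>
      rw [map_mul]
      refine mul_mem hp ?_
      rcases s with ⟨i, a⟩ | a
      · change oneCol K (ColumnAlgebra.x K i a) ∈ _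
        rw [oneCol_x]
        exact Subalgebra.algebraMap_mem _ _
      · change oneCol K (ColumnAlgebra.y K a) ∈ _
        rw [oneCol_y]
        exact yEnt_mem K _ _ one_pos

variable {K}

/-- Membership in the generic ring after inverting either of two minors of `X`. -/
def LocallyMem (n : ℕ) (h : Amb K) : Prop :=
  (∃ N, algebraMap (XPoly K) (Amb K) (del K 2 3) ^ N * h ∈ ring K n) ∧
    ∃ N, algebraMap (XPoly K) (Amb K) (del K 1 3) ^ N * h ∈ ring K n

lemma mem_ring_one_of_locallyMem {h : Amb K} (hl : LocallyMem 1 h) : h ∈ ring K 1 := by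
  obtain ⟨⟨m, hm⟩, k, hk⟩ := hl
  rw [mem_ring_one_iff] at hm hk ⊢
  obtain ⟨a, ha⟩ := hm
  obtain ⟨b, hb⟩ := hk
  change oneCol K a = _ at ha
  change oneCol K b = _ at hb
  rw [← oneCol_minor] at ha hb
  exact ColumnAlgebra.exists_map_eq K (oneCol K : ColumnAlgebra.Poly K →+* Amb K)
    (oneCol_eq_zero_iff K) ha.symm hb.symm

/-! ### The induction on the number of columns -/

lemma LocallyMem.merge {n : ℕ} {h : Amb K} (hl : LocallyMem (n + 2) h) :
    LocallyMem (n + 1) (merge (XFrac K) n h) := by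
  obtain ⟨⟨m, hm⟩, k, hk⟩ := hl
  refine ⟨⟨m, ?_⟩, k, ?_⟩
  · rw [← map_pow, ← merge_algebraMap_mul, map_pow]
    exact merge_mem_ring hm
  · rw [← map_pow, ← merge_algebraMap_mul, map_pow]
    exact merge_mem_ring hk

lemma LocallyMem.sub {n : ℕ} {h g : Amb K} (hl : LocallyMem n h) (hg : g ∈ ring K n) :
    LocallyMem n (h - g) := by
  obtain ⟨⟨m, hm⟩, k, hk⟩ := hl
  refine ⟨⟨m, ?_⟩, k, ?_⟩
  · rw [mul_sub]
    exact Subalgebra.sub_mem _ hm (mul_mem (pow_mem (Subalgebra.algebraMap_mem _ _) _) hg)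
  · rw [mul_sub]
    exact Subalgebra.sub_mem _ hk (mul_mem (pow_mem (Subalgebra.algebraMap_mem _ _) _) hg)

lemma LocallyMem.component {M : Type*} [AddCommMonoid M] (ω : ℕ → M) (d : M) {n : ℕ} {h : Amb K}
    (hl : LocallyMem n h) : LocallyMem n (weightedHomogeneousComponent (byCol ω) d h) := by
  obtain ⟨⟨m, hm⟩, k, hk⟩ := hl
  refine ⟨⟨m, ?_⟩, k, ?_⟩
  · rw [← map_pow, ← component_algebraMap_mul, map_pow]
    exact component_mem_ring ω d hm
  · rw [← map_pow, ← component_algebraMap_mul, map_pow]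
    exact component_mem_ring ω d hk

/-- By `ih` the merged element lies in the smaller ring, and it lifts to some `G` of the same
bidegree as `h`. Then `h - G` is killed by merging, so it equals `uEnt n (n + 1) * q`. Both charts
show that `q` is locally in the ring, and its relevant component has both degrees lowered by one. -/
lemma mem_ring_of_isWeightedHomogeneous {n : ℕ}
    (ih : ∀ h : Amb K, LocallyMem (n + 1) h → h ∈ ring K (n + 1)) (b : ℕ) :
    ∀ (a : ℕ) (h : Amb K), IsWeightedHomogeneous (byCol (weight₂ n)) h (a, b) →
      LocallyMem (n + 2) h → h ∈ ring K (n + 2) := by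
  induction b with
  | zero =>
    intro a h hw hl
    obtain ⟨G, hG, hm, hGw⟩ := exists_polarization (ih _ hl.merge) a 0
    rw [(isWeightedHomogeneous_merge hw).weightedHomogeneousComponent_same] at hm
    have hw' := hw.sub hGw
    obtain ⟨q, hq⟩ := exists_eq_uEnt_mul n (mergeT_eq_zero hw' (by rw [map_sub, hm, sub_self]))
    have hu := isWeightedHomogeneous_uEnt (K := K) (weight₂ n) n (n + 1)
    -- The `u`-element has bidegree `(1, 1)`, which does not fit into `(a, 0)`; so `h = G`.
    have := hu.eq_zero_of_not_le hw' hq (by simp [weight₂_self, weight₂_succ])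
    rw [sub_eq_zero.1 this]
    exact hG
  | succ b ihb =>
    intro a h hw hl
    obtain ⟨G, hG, hm, hGw⟩ := exists_polarization (ih _ hl.merge) a (b + 1)
    rw [(isWeightedHomogeneous_merge hw).weightedHomogeneousComponent_same] at hm
    have hw' := hw.sub hGw
    have h0 := mergeT_eq_zero hw' (by rw [map_sub, hm, sub_self])
    obtain ⟨q, hq⟩ := exists_eq_uEnt_mul n h0
    have hu := isWeightedHomogeneous_uEnt (K := K) (weight₂ n) n (n + 1)
    rw [weight₂_self, weight₂_succ] at hu
    cases a with
    | zero =>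
      have := hu.eq_zero_of_not_le hw' hq (by simp)
      rw [sub_eq_zero.1 this]
      exact hG
    | succ a =>
      have hl' := hl.sub hG
      have hlq : LocallyMem (n + 2) q :=
        ⟨(isChart₁ K).exists_pow_mul_mem hq hl'.1.choose_spec h0,
          (isChart₂ K).exists_pow_mul_mem hq hl'.2.choose_spec h0⟩
      have e : ((1, 0) + (0, 1) + (a, b) : ℕ × ℕ) = (a + 1, b + 1) := by
        ext
        · simp; omega
        · simp; omega
      -- The quotient `q` may be replaced by its component of bidegree `(a, b)`, which is still
      -- locally in the ring.
      have hq' := hu.eq_mul_component (k := (a, b)) (e ▸ hw') hq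
      have := ihb a _ (weightedHomogeneousComponent_isWeightedHomogeneous _ _)
        (hlq.component (weight₂ n) (a, b))
      rw [sub_eq_iff_eq_add.1 hq']
      exact add_mem (mul_mem (uEnt_mem K _ (by omega) (by omega)) this) hG

/-- An element that belongs to the generic ring after inverting either of two suitable minors of
`X` belongs to the generic ring. -/
theorem mem_ring_of_locallyMem (n : ℕ) : ∀ h : Amb K, LocallyMem (n + 1) h → h ∈ ring K (n + 1) := by
  induction n with
  | zero => exact fun h => mem_ring_one_of_locallyMem
  | succ n ih =>
    intro h hl
    -- Local membership passes to bihomogeneous components, so `h` may be treated one component at a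
    -- time.
    rw [← sum_weightedHomogeneousComponent (byCol (weight₂ n)) h,
      finsum_eq_sum _ (weightedHomogeneousComponent_finsupp h)]
    exact sum_mem fun d _ => mem_ring_of_isWeightedHomogeneous ih d.2 d.1 _
      (weightedHomogeneousComponent_isWeightedHomogeneous _ _) (hl.component (weight₂ n) d)

end GenericRing

/-! ### Exactness of the generic complex. -/

namespace GenericRing

open MvPolynomial

variable {K : Type*} [Field K]

/-- Exactness of the generic complex in the middle. -/
theorem exists_eq_sum_mul {n : ℕ} {v : Fin 4 → Amb K} (hv : ∀ a, v a ∈ ring K (n + 1))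
    (h0 : ∑ a, v a * yEnt K a 0 = 0) (h1 : ∑ a, v a * yEnt K a 1 = 0) :
    ∃ w : Fin 2 → Amb K, (∀ i, w i ∈ ring K (n + 1)) ∧
      ∀ a, v a = ∑ i, w i * algebraMap (XPoly K) (Amb K) (xv K i a) := by
  let c (i : Fin 2) (a : Fin 4) : Amb K := algebraMap (XPoly K) (Amb K) (xv K i a)
  let g : Amb K := C (fr K (del K 2 3))⁻¹
  have hg : g * (c 0 2 * c 1 3 - c 1 2 * c 0 3) = 1 := by
    simp only [c, ← map_mul, ← map_sub]
    change g * algebraMap (XPoly K) (Amb K) (del K 2 3) = 1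
    rw [algebraMap_eq_C, ← C_mul, inv_mul_cancel₀ (fr23 K), C_1]
  -- Cramer's rule for `wX = v` on the columns 2 and 3 of `X`, whose minor is invertible in `Amb K`.
  let w : Fin 2 → Amb K :=
    ![g * (v 2 * c 1 3 - v 3 * c 1 2), g * (v 3 * c 0 2 - v 2 * c 0 3)]
  have w0 : w 0 = g * (v 2 * c 1 3 - v 3 * c 1 2) := rfl
  have w1 : w 1 = g * (v 3 * c 0 2 - v 2 * c 0 3) := rfl
  have r (i : Fin 2) (j : ℕ) := sum_mul_yEnt K i j
  simp only [Fin.sum_univ_four] at r h0 h1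
  let v' (a : Fin 4) : Amb K := v a - (w 0 * c 0 a + w 1 * c 1 a)
  have e2 : v' 2 = 0 := by
    simp only [v', w0, w1]
    linear_combination -(v 2) * hg
  have e3 : v' 3 = 0 := by
    simp only [v', w0, w1]
    linear_combination -(v 3) * hg
  -- The difference `v - wX` is still annihilated by `Y` and has only its first two entries left.
  -- Two columns of `Y` suffice to kill these, since their minor on the first two rows is nonzero.
  have k0 : v' 0 * X (0, 0) + v' 1 * X (0, 1) = 0 := by
    have h : v' 0 * yEnt K 0 0 + v' 1 * yEnt K 1 0 + v' 2 * yEnt K 2 0 + v' 3 * yEnt K 3 0 = 0 := by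
      simp only [v']
      linear_combination h0 - w 0 * r 0 0 - w 1 * r 1 0
    simpa [e2, e3] using h
  have k1 : v' 0 * X (1, 0) + v' 1 * X (1, 1) = 0 := by
    have h : v' 0 * yEnt K 0 1 + v' 1 * yEnt K 1 1 + v' 2 * yEnt K 2 1 + v' 3 * yEnt K 3 1 = 0 := by
      simp only [v']
      linear_combination h1 - w 0 * r 0 1 - w 1 * r 1 1
    simpa [e2, e3] using h
  have hm : colMinor (XFrac K) 0 1 ≠ 0 := colMinor_ne_zero _ zero_ne_one
  have e0 : v' 0 = 0 := by
    refine (mul_eq_zero.1 (?_ : colMinor (XFrac K) 0 1 * v' 0 = 0)).resolve_left hm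
    rw [colMinor]
    linear_combination X (1, 1) * k0 - X (0, 1) * k1
  have e1 : v' 1 = 0 := by
    refine (mul_eq_zero.1 (?_ : colMinor (XFrac K) 0 1 * v' 1 = 0)).resolve_left hm
    rw [colMinor]
    linear_combination X (0, 0) * k1 - X (1, 0) * k0
  have hw (a : Fin 4) : v a = w 0 * c 0 a + w 1 * c 1 a := by
    refine sub_eq_zero.1 (?_ : v' a = 0)
    fin_cases a
    exacts [e0, e1, e2, e3]
  have hc (i : Fin 2) (a : Fin 4) : c i a ∈ ring K (n + 1) := Subalgebra.algebraMap_mem _ _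
  have hd (a b : Fin 4) : algebraMap (XPoly K) (Amb K) (del K a b) =
      c 0 a * c 1 b - c 1 a * c 0 b := by simp [del, c]
  -- Given `v = wX`, Cramer's rule on the columns `a` and `b` writes `del a b * w i` as a
  -- combination of `v a` and `v b` with coefficients entries of `X`.
  have hloc (i : Fin 2) (a b : Fin 4) :
      algebraMap (XPoly K) (Amb K) (del K a b) ^ 1 * w i ∈ ring K (n + 1) := by
    rw [pow_one, hd]
    fin_cases i
    · convert Subalgebra.sub_mem _ (mul_mem (hv a) (hc 1 b)) (mul_mem (hv b) (hc 1 a)) using 1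
      rw [hw a, hw b]
      simp only [Fin.zero_eta, Fin.isValue]
      ring
    · convert Subalgebra.sub_mem _ (mul_mem (hv b) (hc 0 a)) (mul_mem (hv a) (hc 0 b)) using 1
      rw [hw a, hw b]
      simp only [Fin.mk_one, Fin.isValue]
      ring
  refine ⟨w, fun i => mem_ring_of_locallyMem n _ ⟨⟨1, hloc i 2 3⟩, 1, hloc i 1 3⟩, fun a => ?_⟩
  rw [Fin.sum_univ_two]
  exact hw a

/-- Exactness of the generic complex on the left. -/
theorem eq_zero_of_sum_mul_eq_zero {w : Fin 2 → Amb K}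
    (hw : ∀ a, ∑ i, w i * algebraMap (XPoly K) (Amb K) (xv K i a) = 0) : w = 0 := by
  simp only [Fin.sum_univ_two] at hw
  have hd : algebraMap (XPoly K) (Amb K) (del K 2 3) ≠ 0 :=
    (map_ne_zero_iff _ (algebraMap_injective K)).2 (del_ne_zero K (by decide))
  have hd' : algebraMap (XPoly K) (Amb K) (del K 2 3) = _ := map_sub _ _ _
  rw [map_mul, map_mul] at hd'
  funext i
  refine (mul_eq_zero.1 (?_ : algebraMap (XPoly K) (Amb K) (del K 2 3) * w i = 0)).resolve_left hd
  rw [hd']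
  fin_cases i
  · simp only [Fin.zero_eta, Fin.isValue]
    linear_combination algebraMap (XPoly K) (Amb K) (xv K 1 3) * hw 2 -
      algebraMap (XPoly K) (Amb K) (xv K 1 2) * hw 3
  · simp only [Fin.mk_one, Fin.isValue]
    linear_combination algebraMap (XPoly K) (Amb K) (xv K 0 2) * hw 3 -
      algebraMap (XPoly K) (Amb K) (xv K 0 3) * hw 2

end GenericRing

namespace RigidityCounterexample

open MvPolynomial GenericRing

variable (K : Type u) [Field K]

/-! ### The ring `R` as a generic ring with eight columns -/

/-- The parametrization of `XY = 0`. -/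
def polyEval : PolyRing K →ₐ[K] Amb K :=
  aeval (Sum.elim (fun p => algebraMap (XPoly K) (Amb K) (xv K p.1 p.2))
    (fun p => yEnt K p.1 (p.2 : ℕ)))

@[simp] lemma polyEval_polyX (i : Fin 2) (a : Fin 4) :
    polyEval K (polyX K i a) = algebraMap (XPoly K) (Amb K) (xv K i a) := by
  simp [polyEval, polyX]

@[simp] lemma polyEval_polyY (a : Fin 4) (j : Fin 8) :
    polyEval K (polyY K a j) = yEnt K a j := by
  simp [polyEval, polyY]

/-- A ring homomorphism vanishes on the ideal defining Bruns's ring if it carries the generic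
matrices to matrices `X` and `Y` with `XY = 0` such that `Y` has rank at most 2. -/
lemma map_eq_zero_of_mem_brunsIdeal {B : Type*} [CommRing B] (E : PolyRing K →+* B)
    (hXY : ∀ i j, ∑ a, E (polyX K i a) * E (polyY K a j) = 0)
    (H : Fin 4 → Fin 2 → B) (Z : Fin 2 → Fin 8 → B)
    (hY : ∀ a j, E (polyY K a j) = H a 0 * Z 0 j + H a 1 * Z 1 j)
    {v : PolyRing K} (hv : v ∈ brunsIdeal K) : E v = 0 := by
  refine ColumnAlgebra.map_eq_zero_of_mem_span E ?_ hv
  rintro _ (⟨i, j, rfl⟩ | ⟨a, b, rfl⟩)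
  · rw [Matrix.mul_apply, map_sum]
    simpa only [map_mul] using hXY i j
  · rw [Matrix.det_fin_three]
    simp only [Matrix.submatrix_apply, map_add, map_sub, map_mul, hY]
    ring

lemma polyEval_eq_zero_of_mem {v : PolyRing K} (hv : v ∈ brunsIdeal K) : polyEval K v = 0 := by
  refine map_eq_zero_of_mem_brunsIdeal K (polyEval K : PolyRing K →+* Amb K) (fun i j => ?_)
    (fun a i => C (coef K a i)) (fun i j => X ((j : ℕ), i)) (fun a j => ?_) hv
  · simpa using sum_mul_yEnt K i j
  · simp [yEnt]

/-- The variables of the first matrix and of the first two rows of the second one. -/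
def topIdx : Set EntryIndex := {s | ∀ j, s ≠ Sum.inr (2, j) ∧ s ≠ Sum.inr (3, j)}

def polyMinor (a b : Fin 4) : PolyRing K := polyX K 0 a * polyX K 1 b - polyX K 1 a * polyX K 0 b

lemma polyX_mem (i : Fin 2) (a : Fin 4) : polyX K i a ∈ supported K topIdx :=
  X_mem_supported.2 (by simp [topIdx])

lemma polyMinor_mem (a b : Fin 4) : polyMinor K a b ∈ supported K topIdx :=
  sub_mem (mul_mem (polyX_mem K _ _) (polyX_mem K _ _))
    (mul_mem (polyX_mem K _ _) (polyX_mem K _ _))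

/-- Cramer's rule in each column of `XY = 0` eliminates the last two rows of `Y`. -/
lemma exists_pow_polyMinor_mul_sub_mem (v : PolyRing K) :
    ∃ N : ℕ, ∃ w ∈ supported K topIdx, polyMinor K 2 3 ^ N * v - w ∈ brunsIdeal K := by
  have hy0 (j) : polyY K 0 j ∈ supported K topIdx := X_mem_supported.2 (by simp [topIdx])
  have hy1 (j) : polyY K 1 j ∈ supported K topIdx := X_mem_supported.2 (by simp [topIdx])
  have hf (i j) : polyX K i 0 * polyY K 0 j + polyX K i 1 * polyY K 1 j + polyX K i 2 * polyY K 2 j +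
      polyX K i 3 * polyY K 3 j ∈ brunsIdeal K := by
    rw [← Fin.sum_univ_four (fun a => polyX K i a * polyY K a j), ← Matrix.mul_apply]
    exact Ideal.subset_span (Or.inl ⟨i, j, rfl⟩)
  refine exists_pow_mul_sub_mem (polyMinor_mem K 2 3) ?_ v
  intro s
  by_cases hs : s ∈ topIdx
  · exact Or.inl (X_mem_supported.2 hs)
  right
  obtain ⟨j, rfl | rfl⟩ : ∃ j, s = Sum.inr (2, j) ∨ s = Sum.inr (3, j) := by
    by_contra! h
    exact hs h
  · refine ⟨-(polyMinor K 0 3 * polyY K 0 j + polyMinor K 1 3 * polyY K 1 j),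
      neg_mem (add_mem (mul_mem (polyMinor_mem K _ _) (hy0 j))
        (mul_mem (polyMinor_mem K _ _) (hy1 j))), ?_⟩
    have e : (X (Sum.inr (2, j)) : PolyRing K) = polyY K 2 j := rfl
    rw [e]
    convert sub_mem (Ideal.mul_mem_left _ (polyX K 1 3) (hf 0 j))
      (Ideal.mul_mem_left _ (polyX K 0 3) (hf 1 j)) using 1
    simp only [polyMinor]
    ring
  · refine ⟨polyMinor K 0 2 * polyY K 0 j + polyMinor K 1 2 * polyY K 1 j,
      add_mem (mul_mem (polyMinor_mem K _ _) (hy0 j))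
        (mul_mem (polyMinor_mem K _ _) (hy1 j)), ?_⟩
    have e : (X (Sum.inr (3, j)) : PolyRing K) = polyY K 3 j := rfl
    rw [e]
    convert sub_mem (Ideal.mul_mem_left _ (polyX K 0 2) (hf 1 j))
      (Ideal.mul_mem_left _ (polyX K 1 2) (hf 0 j)) using 1
    simp only [polyMinor]
    ring

abbrev polyToFrac : PolyRing K →ₐ[K] FractionRing (PolyRing K) := IsScalarTower.toAlgHom K _ _

lemma polyToFrac_injective : Function.Injective (polyToFrac K) :=
  IsFractionRing.injective (PolyRing K) (FractionRing (PolyRing K))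

def xIncl : XPoly K →ₐ[K] PolyRing K := rename Sum.inl

lemma polyToFrac_comp_xIncl_injective :
    Function.Injective ((polyToFrac K).comp (xIncl K)) :=
  (polyToFrac_injective K).comp (rename_injective _ Sum.inl_injective)

/-- Evaluation of the columns at the columns of the generic matrix. -/
def evalCols : Amb K →+* FractionRing (PolyRing K) :=
  eval₂Hom ((IsFractionRing.liftAlgHom (polyToFrac_comp_xIncl_injective K) :
      XFrac K →ₐ[K] FractionRing (PolyRing K)) : XFrac K →+* _)
    (fun s => if h : s.1 < 8 then polyToFrac K (polyY K (![0, 1] s.2) ⟨s.1, h⟩) else 0)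

lemma evalCols_algebraMap (p : XPoly K) : evalCols K (algebraMap (XPoly K) (Amb K) p) =
    polyToFrac K (xIncl K p) := by
  rw [algebraMap_eq_C, evalCols, coe_eval₂Hom, eval₂_C, RingHom.coe_coe]
  exact IsFractionRing.lift_algebraMap (polyToFrac_comp_xIncl_injective K) p

lemma evalCols_polyEval {w : PolyRing K} (hw : w ∈ supported K topIdx) :
    evalCols K (polyEval K w) = polyToFrac K w := by
  rw [supported_eq_adjoin_X] at hw
  induction hw using Algebra.adjoin_induction with
  | mem v hv =>
    obtain ⟨(⟨i, a⟩ | ⟨a, j⟩), hs, rfl⟩ := hv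
    · change evalCols K (polyEval K (polyX K i a)) = _
      rw [polyEval_polyX, evalCols_algebraMap, xv, xIncl, rename_X]
    · change evalCols K (polyEval K (polyY K a j)) = polyToFrac K (polyY K a j)
      rw [polyEval_polyY]
      fin_cases a
      · simp [evalCols]
      · simp [evalCols]
      · exact absurd rfl (hs j).1
      · exact absurd rfl (hs j).2
  | algebraMap r =>
    rw [AlgHom.commutes, AlgHom.commutes, IsScalarTower.algebraMap_apply K (XPoly K) (Amb K),
      evalCols_algebraMap, AlgHom.commutes, AlgHom.commutes]
  | add a b _ _ ha hb => simp only [map_add, ha, hb]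
  | mul a b _ _ ha hb => simp only [map_mul, ha, hb]

/-- The kernel of the parametrization is the ideal of Bruns's ring, up to powers of a minor. -/
lemma exists_pow_mul_mem_of_polyEval_eq_zero {v : PolyRing K} (hv : polyEval K v = 0) :
    ∃ N : ℕ, polyMinor K 2 3 ^ N * v ∈ brunsIdeal K := by
  obtain ⟨N, w, hw, h⟩ := exists_pow_polyMinor_mul_sub_mem K v
  have h0 := polyEval_eq_zero_of_mem K h
  rw [map_sub, map_mul, hv, mul_zero, zero_sub, neg_eq_zero] at h0
  have h1 := evalCols_polyEval K hw
  rw [h0, map_zero] at h1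
  have : w = 0 := (map_eq_zero_iff _ (polyToFrac_injective K)).1 h1.symm
  exact ⟨N, by simpa [this] using h⟩

def brunsEval : BrunsRing K →+* Amb K :=
  Ideal.Quotient.lift (brunsIdeal K) (polyEval K : PolyRing K →+* Amb K)
    (fun _ => polyEval_eq_zero_of_mem K)

@[simp] lemma brunsEval_mk (p : PolyRing K) :
    brunsEval K (Ideal.Quotient.mk (brunsIdeal K) p) = polyEval K p := rfl

lemma minorF_eq : minorF K = Ideal.Quotient.mk (brunsIdeal K) (polyMinor K 2 3) := by
  rw [minorF, Matrix.det_fin_two]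
  simp [brunsX, polyMinor, mul_comm]

lemma minorG_eq (σ : Fin 8 × Fin 8) : minorG K σ = Ideal.Quotient.mk (brunsIdeal K)
    (polyY K 0 σ.1 * polyY K 1 σ.2 - polyY K 0 σ.2 * polyY K 1 σ.1) := by
  rw [minorG, Matrix.det_fin_two]
  simp [brunsY]

lemma brunsEval_minorF : brunsEval K (minorF K) = C (fr K (del K 2 3)) := by
  rw [minorF_eq, brunsEval_mk, ← algebraMap_eq_C]
  simp [polyMinor, del]

lemma brunsEval_minorG (σ : Fin 8 × Fin 8) :
    brunsEval K (minorG K σ) = C (fr K (del K 2 3)) * uEnt K σ.1 σ.2 := by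
  rw [minorG_eq, brunsEval_mk, mul_uEnt]
  simp [colMinor]

lemma isUnit_brunsEval_minorF : IsUnit (brunsEval K (minorF K)) := by
  rw [brunsEval_minorF]
  exact (isUnit_iff_ne_zero.2 (fr23 K)).map C

def locEval : Localization.Away (minorF K) →+* Amb K :=
  IsLocalization.Away.lift (minorF K) (isUnit_brunsEval_minorF K)

@[simp] lemma locEval_algebraMap (r : BrunsRing K) :
    locEval K (algebraMap _ _ r) = brunsEval K r :=
  IsLocalization.Away.lift_eq _ _ _

/-- Whatever the parametrization kills in Bruns's ring is annihilated by a power of `f`, hence is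
zero in the localization. It is not necessary to know that Bruns's ring is a domain. -/
lemma locEval_injective : Function.Injective (locEval K) := by
  rw [injective_iff_map_eq_zero]
  intro z hz
  obtain ⟨r, s, rfl⟩ := IsLocalization.exists_mk'_eq (Submonoid.powers (minorF K)) z
  have h1 : locEval K (algebraMap _ _ r) = 0 := by
    rw [← IsLocalization.mk'_spec' (Localization.Away (minorF K)) r s, map_mul, hz, mul_zero]
  rw [locEval_algebraMap] at h1
  obtain ⟨p, rfl⟩ := Ideal.Quotient.mk_surjective r
  obtain ⟨N, hN⟩ := exists_pow_mul_mem_of_polyEval_eq_zero K h1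
  rw [IsLocalization.mk'_eq_zero_iff]
  refine ⟨⟨minorF K ^ N, N, rfl⟩, ?_⟩
  change minorF K ^ N * Ideal.Quotient.mk (brunsIdeal K) p = 0
  rw [minorF_eq, ← map_pow, ← map_mul]
  exact Ideal.Quotient.eq_zero_iff_mem.2 hN

lemma mul_uElement (σ : Fin 8 × Fin 8) :
    algebraMap (BrunsRing K) (Localization.Away (minorF K)) (minorF K) * uElement K σ =
      algebraMap (BrunsRing K) (Localization.Away (minorF K)) (minorG K σ) := by
  rw [uElement, Localization.mk_eq_mk', IsLocalization.mk'_spec'_mk]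

@[simp] lemma locEval_uElement (σ : Fin 8 × Fin 8) :
    locEval K (uElement K σ) = uEnt K σ.1 σ.2 := by
  have h := congrArg (locEval K) (mul_uElement K σ)
  rw [map_mul, locEval_algebraMap, locEval_algebraMap, brunsEval_minorF, brunsEval_minorG] at h
  exact mul_left_cancel₀ (C_fr23_ne_zero K) h

/-- The inclusion of `R` into the localization of Bruns's ring. -/
def hIncl : HRing K →ₐ[BrunsRing K] Localization.Away (minorF K) :=
  Subalgebra.val (Algebra.adjoin (BrunsRing K) (Set.range (uElement K)))

/-- The embedding of `R` into a polynomial ring. -/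
def hEval : HRing K →+* Amb K := (locEval K).comp (hIncl K : HRing K →+* _)

lemma hEval_injective : Function.Injective (hEval K) :=
  (locEval_injective K).comp Subtype.val_injective

lemma hEval_algebraMap (r : BrunsRing K) :
    hEval K (algebraMap (BrunsRing K) (HRing K) r) = brunsEval K r :=
  locEval_algebraMap K r

@[simp] lemma hEval_matX (i : Fin 2) (a : Fin 4) :
    hEval K (matX K i a) = algebraMap (XPoly K) (Amb K) (xv K i a) := by
  rw [matX, Matrix.map_apply, hEval_algebraMap, brunsX, Matrix.map_apply, brunsEval_mk,
    polyEval_polyX]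

@[simp] lemma hEval_matY (a : Fin 4) (j : Fin 8) : hEval K (matY K a j) = yEnt K a j := by
  rw [matY, Matrix.map_apply, hEval_algebraMap, brunsY, Matrix.map_apply, brunsEval_mk,
    polyEval_polyY]

@[simp] lemma hEval_uGen (σ : Fin 8 × Fin 8) : hEval K (uGen K σ) = uEnt K σ.1 σ.2 :=
  locEval_uElement K σ

/-- Induction over the generators of `R` over `K`. -/
lemma hRing_induction {p : HRing K → Prop} (hC : ∀ c : K, p (algebraMap K (HRing K) c))
    (hX : ∀ i a, p (matX K i a)) (hY : ∀ a j, p (matY K a j)) (hu : ∀ σ, p (uGen K σ))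
    (hadd : ∀ a b, p a → p b → p (a + b)) (hmul : ∀ a b, p a → p b → p (a * b)) (h : HRing K) :
    p h := by
  have hB (r : BrunsRing K) : p (algebraMap (BrunsRing K) (HRing K) r) := by
    obtain ⟨q, rfl⟩ := Ideal.Quotient.mk_surjective r
    induction q using MvPolynomial.induction_on with
    | C c =>
      have := hC c
      rwa [IsScalarTower.algebraMap_apply K (BrunsRing K) (HRing K)] at this
    | add a b ha hb => rw [map_add, map_add]; exact hadd _ _ ha hb
    | mul_X q s hq =>
      rw [map_mul, map_mul]
      refine hmul _ _ hq ?_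
      rcases s with ⟨i, a⟩ | ⟨a, j⟩
      · exact hX i a
      · exact hY a j
  obtain ⟨z, hz⟩ := h
  induction hz using Algebra.adjoin_induction with
  | mem x hx =>
    obtain ⟨σ, rfl⟩ := hx
    exact hu σ
  | algebraMap r => exact hB r
  | add a b ha hb iha ihb => exact hadd ⟨a, ha⟩ ⟨b, hb⟩ iha ihb
  | mul a b ha hb iha ihb => exact hmul ⟨a, ha⟩ ⟨b, hb⟩ iha ihb

lemma hEval_algebraMap_field (c : K) :
    hEval K (algebraMap K (HRing K) c) = algebraMap K (Amb K) c := by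
  rw [IsScalarTower.algebraMap_apply K (BrunsRing K) (HRing K), hEval_algebraMap]
  exact (polyEval K).commutes c

/-- Together with `exists_hEval_eq` and `hEval_injective` this identifies `R` with the generic ring
for eight columns. -/
lemma hEval_mem (h : HRing K) : hEval K h ∈ ring K 8 := by
  induction h using hRing_induction K with
  | hC c =>
    rw [hEval_algebraMap_field, IsScalarTower.algebraMap_apply K (XPoly K) (Amb K)]
    exact Subalgebra.algebraMap_mem _ _
  | hX i a => rw [hEval_matX]; exact Subalgebra.algebraMap_mem _ _
  | hY a j => rw [hEval_matY]; exact yEnt_mem K _ _ j.2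
  | hu σ => rw [hEval_uGen]; exact uEnt_mem K _ σ.1.2 σ.2.2
  | hadd a b ha hb => rw [map_add]; exact add_mem ha hb
  | hmul a b ha hb => rw [map_mul]; exact mul_mem ha hb

lemma exists_hEval_eq {r : Amb K} (hr : r ∈ ring K 8) : ∃ h, hEval K h = r := by
  induction hr using Algebra.adjoin_induction with
  | mem x h =>
    rcases h with ⟨i, j, hj, rfl⟩ | ⟨j, hj, k, hk, rfl⟩
    · exact ⟨matY K i ⟨j, hj⟩, hEval_matY K _ _⟩
    · exact ⟨uGen K (⟨j, hj⟩, ⟨k, hk⟩), hEval_uGen K _⟩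
  | algebraMap p =>
    refine ⟨algebraMap (BrunsRing K) (HRing K) (Ideal.Quotient.mk _ (xIncl K p)), ?_⟩
    rw [hEval_algebraMap, brunsEval_mk]
    have : (polyEval K).comp (xIncl K) = IsScalarTower.toAlgHom K (XPoly K) (Amb K) := by
      refine MvPolynomial.algHom_ext ?_
      rintro ⟨i, a⟩
      simp [polyEval, xIncl, xv]
    exact DFunLike.congr_fun this p
  | add a b _ _ ha hb =>
    obtain ⟨h, rfl⟩ := ha
    obtain ⟨h', rfl⟩ := hb
    exact ⟨h + h', map_add _ _ _⟩
  | mul a b _ _ ha hb =>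
    obtain ⟨h, rfl⟩ := ha
    obtain ⟨h', rfl⟩ := hb
    exact ⟨h * h', map_mul _ _ _⟩

/-! ### Exactness over `R` -/

lemma vecMulLinear_matX_injective : Function.Injective (matX K).vecMulLinear := by
  rw [injective_iff_map_eq_zero]
  intro w hw
  have h0 : (fun i => hEval K (w i)) = 0 := by
    refine eq_zero_of_sum_mul_eq_zero fun a => ?_
    have := congrArg (hEval K) (congrFun hw a)
    simpa [Matrix.vecMul, dotProduct] using this
  funext i
  exact hEval_injective K ((congrFun h0 i).trans (map_zero _).symm)

lemma matX_mul_matY : matX K * matY K = 0 := by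
  ext i j
  apply hEval_injective K
  rw [Matrix.mul_apply, map_sum, Matrix.zero_apply, map_zero]
  simpa using sum_mul_yEnt K i j

lemma exact_matX_matY : Function.Exact (matX K).vecMulLinear (matY K).vecMulLinear := by
  intro v
  constructor
  · intro hv
    have hv' (j : Fin 8) : ∑ a, hEval K (v a) * yEnt K a (j : ℕ) = 0 := by
      have := congrArg (hEval K) (congrFun hv j)
      simpa [Matrix.vecMul, dotProduct] using this
    obtain ⟨w, hw, h⟩ := exists_eq_sum_mul (fun a => hEval_mem K (v a)) (hv' 0) (hv' 1)
    choose w' hw' using fun i => exists_hEval_eq K (hw i)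
    refine ⟨w', ?_⟩
    funext a
    apply hEval_injective K
    rw [h a]
    simp [Matrix.vecMul, dotProduct, hw']
  · rintro ⟨w, rfl⟩
    rw [Matrix.vecMulLinear_apply, Matrix.vecMulLinear_apply, Matrix.vecMul_vecMul,
      matX_mul_matY, Matrix.vecMul_zero]

end RigidityCounterexample

namespace RigidityCounterexample

open MvPolynomial GenericRing
open scoped LaurentPolynomial

variable (K : Type u) [Field K]

/-! ### The degree filtration of `R` -/

/-- The parametrization of `XY = 0`, recording the degree in an additional variable; the entries
of `X` have degree 2 and those of `Y` have degree 3. -/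
def polyGrade : PolyRing K →ₐ[K] (Amb K)[T;T⁻¹] :=
  aeval (Sum.elim
    (fun p => LaurentPolynomial.C (algebraMap (XPoly K) (Amb K) (xv K p.1 p.2)) *
      LaurentPolynomial.T 2)
    (fun p => LaurentPolynomial.C (yEnt K p.1 (p.2 : ℕ)) * LaurentPolynomial.T 3))

@[simp] lemma polyGrade_polyX (i : Fin 2) (a : Fin 4) : polyGrade K (polyX K i a) =
    LaurentPolynomial.C (algebraMap (XPoly K) (Amb K) (xv K i a)) * LaurentPolynomial.T 2 := by
  simp [polyGrade, polyX]

@[simp] lemma polyGrade_polyY (a : Fin 4) (j : Fin 8) : polyGrade K (polyY K a j) =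
    LaurentPolynomial.C (yEnt K a j) * LaurentPolynomial.T 3 := by
  simp [polyGrade, polyY]

lemma polyGrade_eq_zero_of_mem {v : PolyRing K} (hv : v ∈ brunsIdeal K) : polyGrade K v = 0 := by
  refine map_eq_zero_of_mem_brunsIdeal K (polyGrade K : PolyRing K →+* (Amb K)[T;T⁻¹])
    (fun i j => ?_) (fun a i => LaurentPolynomial.C (C (coef K a i)))
    (fun i j => LaurentPolynomial.C (X ((j : ℕ), i)) * LaurentPolynomial.T 3) (fun a j => ?_) hv
  · have h := congrArg (fun z => LaurentPolynomial.C z * LaurentPolynomial.T 5)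
      (sum_mul_yEnt K i j)
    simp only [map_sum, map_zero, zero_mul, Finset.sum_mul, map_mul] at h
    rw [← h]
    refine Finset.sum_congr rfl fun a _ => ?_
    rw [RingHom.coe_coe, polyGrade_polyX, polyGrade_polyY,
      show (5 : ℤ) = 2 + 3 by norm_num, LaurentPolynomial.T_add]
    ring
  · rw [RingHom.coe_coe, polyGrade_polyY, yEnt, map_add, map_mul, map_mul]
    ring

def brunsGrade : BrunsRing K →+* (Amb K)[T;T⁻¹] :=
  Ideal.Quotient.lift (brunsIdeal K) (polyGrade K : PolyRing K →+* (Amb K)[T;T⁻¹])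
    (fun _ => polyGrade_eq_zero_of_mem K)

@[simp] lemma brunsGrade_mk (p : PolyRing K) :
    brunsGrade K (Ideal.Quotient.mk (brunsIdeal K) p) = polyGrade K p := rfl

lemma brunsGrade_minorF : brunsGrade K (minorF K) =
    LaurentPolynomial.C (C (fr K (del K 2 3))) * LaurentPolynomial.T 4 := by
  rw [minorF_eq, brunsGrade_mk, ← algebraMap_eq_C, polyMinor, del]
  simp only [map_sub, map_mul, polyGrade_polyX]
  rw [show (4 : ℤ) = 2 + 2 by norm_num, LaurentPolynomial.T_add]
  ring

lemma brunsGrade_minorG (σ : Fin 8 × Fin 8) : brunsGrade K (minorG K σ) =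
    LaurentPolynomial.C (C (fr K (del K 2 3)) * uEnt K σ.1 σ.2) * LaurentPolynomial.T 6 := by
  rw [minorG_eq, brunsGrade_mk, mul_uEnt, colMinor]
  simp only [map_sub, map_mul, polyGrade_polyY, yEnt_zero, yEnt_one]
  rw [show (6 : ℤ) = 3 + 3 by norm_num, LaurentPolynomial.T_add]
  ring

/-- This is why Laurent polynomials are used: `f` has degree 4 and must become invertible for the
grading to extend to the localization. -/
lemma isUnit_brunsGrade_minorF : IsUnit (brunsGrade K (minorF K)) := by
  rw [brunsGrade_minorF]
  exact (((isUnit_iff_ne_zero.2 (fr23 K)).map C).map LaurentPolynomial.C).mul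
    (LaurentPolynomial.isUnit_T 4)

def locGrade : Localization.Away (minorF K) →+* (Amb K)[T;T⁻¹] :=
  IsLocalization.Away.lift (minorF K) (isUnit_brunsGrade_minorF K)

lemma locGrade_algebraMap (r : BrunsRing K) :
    locGrade K (algebraMap _ _ r) = brunsGrade K r :=
  IsLocalization.Away.lift_eq _ _ _

/-- The ring `R` with the degree recorded in an additional variable. -/
def hGrade : HRing K →+* (Amb K)[T;T⁻¹] := (locGrade K).comp (hIncl K : HRing K →+* _)

lemma hGrade_algebraMap (r : BrunsRing K) :
    hGrade K (algebraMap (BrunsRing K) (HRing K) r) = brunsGrade K r :=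
  locGrade_algebraMap K r

lemma hGrade_algebraMap_field (c : K) : hGrade K (algebraMap K (HRing K) c) =
    LaurentPolynomial.C (algebraMap K (Amb K) c) := by
  rw [IsScalarTower.algebraMap_apply K (BrunsRing K) (HRing K), hGrade_algebraMap]
  exact (polyGrade K).commutes c

@[simp] lemma hGrade_matX (i : Fin 2) (a : Fin 4) : hGrade K (matX K i a) =
    LaurentPolynomial.C (algebraMap (XPoly K) (Amb K) (xv K i a)) * LaurentPolynomial.T 2 := by
  rw [matX, Matrix.map_apply, hGrade_algebraMap, brunsX, Matrix.map_apply, brunsGrade_mk,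
    polyGrade_polyX]

@[simp] lemma hGrade_matY (a : Fin 4) (j : Fin 8) : hGrade K (matY K a j) =
    LaurentPolynomial.C (yEnt K a j) * LaurentPolynomial.T 3 := by
  rw [matY, Matrix.map_apply, hGrade_algebraMap, brunsY, Matrix.map_apply, brunsGrade_mk,
    polyGrade_polyY]

lemma minorF_mul_uGen (σ : Fin 8 × Fin 8) :
    algebraMap (BrunsRing K) (HRing K) (minorF K) * uGen K σ =
      algebraMap (BrunsRing K) (HRing K) (minorG K σ) :=
  Subtype.ext (mul_uElement K σ)

@[simp] lemma hGrade_uGen (σ : Fin 8 × Fin 8) : hGrade K (uGen K σ) =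
    LaurentPolynomial.C (uEnt K σ.1 σ.2) * LaurentPolynomial.T 2 := by
  have h := congrArg (hGrade K) (minorF_mul_uGen K σ)
  rw [map_mul, hGrade_algebraMap, hGrade_algebraMap, brunsGrade_minorG] at h
  refine (isUnit_brunsGrade_minorF K).mul_left_cancel (h.trans ?_)
  rw [brunsGrade_minorF, show (6 : ℤ) = 4 + 2 by norm_num, LaurentPolynomial.T_add, map_mul]
  ring

lemma exists_toLaurent_eq (h : HRing K) : ∃ p, hGrade K h = Polynomial.toLaurent p := by
  induction h using hRing_induction K with
  | hC c => exact ⟨Polynomial.C (algebraMap K (Amb K) c), by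
      rw [hGrade_algebraMap_field, Polynomial.toLaurent_C]⟩
  | hX i a => exact ⟨Polynomial.monomial 2 _, by
      rw [hGrade_matX, ← Polynomial.C_mul_X_pow_eq_monomial, Polynomial.toLaurent_C_mul_X_pow]; rfl⟩
  | hY a j => exact ⟨Polynomial.monomial 3 _, by
      rw [hGrade_matY, ← Polynomial.C_mul_X_pow_eq_monomial, Polynomial.toLaurent_C_mul_X_pow]; rfl⟩
  | hu σ => exact ⟨Polynomial.monomial 2 _, by
      rw [hGrade_uGen, ← Polynomial.C_mul_X_pow_eq_monomial, Polynomial.toLaurent_C_mul_X_pow]; rfl⟩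
  | hadd a b ha hb =>
    obtain ⟨p, hp⟩ := ha
    obtain ⟨q, hq⟩ := hb
    exact ⟨p + q, by rw [map_add, map_add, hp, hq]⟩
  | hmul a b ha hb =>
    obtain ⟨p, hp⟩ := ha
    obtain ⟨q, hq⟩ := hb
    exact ⟨p * q, by rw [map_mul, map_mul, hp, hq]⟩

/-- The ideal of elements of `R` all of whose components have degree at least `k`. -/
def degreeIdeal (k : ℕ) : Ideal (HRing K) where
  carrier := {h | ∃ p, hGrade K h = Polynomial.toLaurent (Polynomial.X ^ k * p)}
  zero_mem' := ⟨0, by simp⟩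
  add_mem' := by
    rintro a b ⟨p, hp⟩ ⟨q, hq⟩
    exact ⟨p + q, by rw [map_add, hp, hq, mul_add, map_add]⟩
  smul_mem' := by
    rintro a b ⟨p, hp⟩
    obtain ⟨q, hq⟩ := exists_toLaurent_eq K a
    exact ⟨q * p, by rw [smul_eq_mul, map_mul, hp, hq, ← map_mul]; congr 1; ring⟩

lemma degreeIdeal_mul_le (k l : ℕ) : degreeIdeal K k * degreeIdeal K l ≤ degreeIdeal K (k + l) := by
  rw [Ideal.mul_le]
  rintro a ⟨p, hp⟩ b ⟨q, hq⟩
  exact ⟨p * q, by rw [map_mul, hp, hq, ← map_mul]; congr 1; ring⟩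

lemma mem_degreeIdeal_two {h : HRing K} {p : Amb K} (k : ℕ)
    (hh : hGrade K h = LaurentPolynomial.C p * LaurentPolynomial.T (k + 2 : ℕ)) :
    h ∈ degreeIdeal K 2 :=
  ⟨Polynomial.C p * Polynomial.X ^ k, by
    rw [hh, ← Polynomial.toLaurent_C_mul_X_pow]; congr 1; ring⟩

/-- With degrees 2 and 3 for the entries, a `u`-element has degree `2·3 - 2·2 = 2`. So all
generators of `P` have degree at least 2, and `P²` lies in degrees at least 4, above the degrees of
all entries. -/
lemma idealP_le_degreeIdeal : idealP K ≤ degreeIdeal K 2 := by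
  refine Ideal.span_le.2 ?_
  rintro _ (⟨⟨i, a⟩ | ⟨a, j⟩, rfl⟩ | ⟨σ, rfl⟩)
  · exact mem_degreeIdeal_two K 0 (hGrade_matX K i a)
  · exact mem_degreeIdeal_two K 1 (hGrade_matY K a j)
  · exact mem_degreeIdeal_two K 0 (hGrade_uGen K σ)

lemma idealP_sq_le_degreeIdeal : idealP K ^ 2 ≤ degreeIdeal K 4 := by
  rw [pow_two]
  exact (Ideal.mul_mono (idealP_le_degreeIdeal K) (idealP_le_degreeIdeal K)).trans
    (degreeIdeal_mul_le K 2 2)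

lemma idealP_ne_top : idealP K ≠ ⊤ := by
  intro h
  obtain ⟨p, hp⟩ := idealP_le_degreeIdeal K (h ▸ Submodule.mem_top : (1 : HRing K) ∈ idealP K)
  rw [map_one, ← map_one Polynomial.toLaurent] at hp
  have := congrArg (Polynomial.coeff · 0) (Polynomial.toLaurent_injective hp)
  simp at this

lemma entry_mem_idealP (e : EntryIndex) : entry K e ∈ idealP K :=
  Ideal.subset_span (Or.inl ⟨e, rfl⟩)

lemma uGen_mem_idealP (σ : Fin 8 × Fin 8) : uGen K σ ∈ idealP K :=
  Ideal.subset_span (Or.inr ⟨σ, rfl⟩)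

lemma exists_sub_algebraMap_mem (h : HRing K) :
    ∃ c : K, h - algebraMap K (HRing K) c ∈ idealP K := by
  induction h using hRing_induction K with
  | hC c => exact ⟨c, by simp⟩
  | hX i a => exact ⟨0, by rw [map_zero, sub_zero]; exact entry_mem_idealP K (Sum.inl (i, a))⟩
  | hY a j => exact ⟨0, by rw [map_zero, sub_zero]; exact entry_mem_idealP K (Sum.inr (a, j))⟩
  | hu σ => exact ⟨0, by simpa using uGen_mem_idealP K σ⟩
  | hadd a b ha hb =>
    obtain ⟨c, hc⟩ := ha
    obtain ⟨d, hd⟩ := hb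
    exact ⟨c + d, by convert add_mem hc hd using 1; rw [map_add]; ring⟩
  | hmul a b ha hb =>
    obtain ⟨c, hc⟩ := ha
    obtain ⟨d, hd⟩ := hb
    refine ⟨c * d, ?_⟩
    convert add_mem (Ideal.mul_mem_left _ b hc)
      (Ideal.mul_mem_left _ (algebraMap K (HRing K) c) hd) using 1
    rw [map_mul]
    ring

lemma algebraMap_quotient_bijective :
    Function.Bijective (algebraMap K (HRing K ⧸ idealP K)) := by
  constructor
  · have := Ideal.Quotient.nontrivial_iff.2 (idealP_ne_top K)
    exact (algebraMap K (HRing K ⧸ idealP K)).injective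
  · intro z
    obtain ⟨h, rfl⟩ := Ideal.Quotient.mk_surjective z
    obtain ⟨c, hc⟩ := exists_sub_algebraMap_mem K h
    exact ⟨c, ((Ideal.Quotient.eq).2 hc).symm⟩

lemma idealP_isMaximal : (idealP K).IsMaximal := by
  refine Ideal.Quotient.maximal_of_isField _ ?_
  exact (RingEquiv.ofBijective _ (algebraMap_quotient_bijective K)).symm.toMulEquiv.isField
    (Field.toIsField K)

lemma finiteType_hRing : Algebra.FiniteType K (HRing K) := by
  refine ⟨Subalgebra.fg_def.2 ⟨Set.range (entry K) ∪ Set.range (uGen K),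
    (Set.finite_range _).union (Set.finite_range _), ?_⟩⟩
  rw [eq_top_iff]
  intro h _
  induction h using hRing_induction K with
  | hC c => exact Subalgebra.algebraMap_mem _ c
  | hX i a => exact Algebra.subset_adjoin (Or.inl ⟨Sum.inl (i, a), rfl⟩)
  | hY a j => exact Algebra.subset_adjoin (Or.inl ⟨Sum.inr (a, j), rfl⟩)
  | hu σ => exact Algebra.subset_adjoin (Or.inr ⟨σ, rfl⟩)
  | hadd a b ha hb => exact add_mem (ha trivial) (hb trivial)
  | hmul a b ha hb => exact mul_mem (ha trivial) (hb trivial)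

lemma isNoetherianRing_hRing : IsNoetherianRing (HRing K) :=
  have := finiteType_hRing K
  Algebra.FiniteType.isNoetherianRing K (HRing K)

/-! ### Linear independence of the entries modulo the square of `P` -/

lemma eq_zero_of_sum_smul_xv {c : Fin 2 → Fin 4 → K}
    (h : ∑ i, ∑ a, c i a • xv K i a = 0) (i : Fin 2) (a : Fin 4) : c i a = 0 := by
  have := congrArg (aeval (R := K) fun s : Fin 2 × Fin 4 => if s = (i, a) then (1 : K) else 0) h
  rw [Finset.sum_comm] at this
  simpa [xv, Prod.ext_iff, ite_and, -Fin.sum_univ_two] using this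

lemma coeff_yEnt (a : Fin 4) (j k : ℕ) (i : Fin 2) :
    coeff (Finsupp.single (k, i) 1) (yEnt K a j) = if j = k then coef K a i else 0 := by
  rw [yEnt, coeff_add, coeff_C_mul, coeff_C_mul, coeff_X, coeff_X]
  simp only [Finsupp.single_left_inj one_ne_zero, Prod.mk.injEq]
  fin_cases i <;> by_cases h : j = k <;> simp [h]

/-- The four rows of `coef` lie in a plane over `XFrac K`, but they are independent over `K`:
clearing the denominator turns a relation into one between distinct minors of `X`. -/
lemma eq_zero_of_sum_mul_coef {d : Fin 4 → K}
    (h : ∀ i, ∑ a, algebraMap K (XFrac K) (d a) * coef K a i = 0) (a : Fin 4) : d a = 0 := by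
  have e (c : K) : algebraMap K (XFrac K) c = fr K (C c) := by
    rw [IsScalarTower.algebraMap_apply K (XPoly K) (XFrac K)]; rfl
  have h23 := fr23 K
  have h0 : C (d 0) * del K 2 3 - C (d 2) * del K 0 3 + C (d 3) * del K 0 2 = 0 := by
    apply fr_injective K
    have := h 0
    rw [Fin.sum_univ_four] at this
    simp only [coef, e] at this
    simp only [Matrix.cons_val] at this
    field_simp at this
    simp only [map_sub, map_add, map_mul, map_zero]
    linear_combination this
  have h1 : C (d 1) * del K 2 3 - C (d 2) * del K 1 3 + C (d 3) * del K 1 2 = 0 := by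
    apply fr_injective K
    have := h 1
    rw [Fin.sum_univ_four] at this
    simp only [coef, e] at this
    simp only [Matrix.cons_val] at this
    field_simp at this
    simp only [map_sub, map_add, map_mul, map_zero]
    linear_combination this
  -- Evaluation at the matrix with ones in positions `(0, p)` and `(1, q)` only; it picks out the
  -- minor on the columns `p` and `q`.
  have ev (p q : Fin 4) := fun {z : XPoly K} (hz : z = 0) => congrArg (aeval (R := K)
    fun s : Fin 2 × Fin 4 => if s = (0, p) ∨ s = (1, q) then (1 : K) else 0) hz
  have e0 := ev 2 3 h0
  have e1 := ev 2 3 h1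
  have e2 := ev 0 3 h0
  have e3 := ev 0 2 h0
  simp [del, xv] at e0 e1 e2 e3
  fin_cases a
  · exact e0
  · exact e1
  · exact e2
  · exact e3

lemma eq_zero_of_sum_smul_yEnt {d : Fin 4 → Fin 8 → K}
    (h : ∑ a, ∑ j, d a j • yEnt K a (j : ℕ) = 0) (a : Fin 4) (j : Fin 8) : d a j = 0 := by
  refine eq_zero_of_sum_mul_coef K (d := fun a => d a j) (fun i => ?_) a
  have := congrArg (coeff (Finsupp.single ((j : ℕ), i) 1)) h
  simpa [coeff_sum, coeff_smul, coeff_yEnt, Fin.val_inj, Algebra.smul_def] using this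

/-- A relation modulo `P²` has no components in degrees 2 and 3. These components are the parts of
the relation in `X` and in `Y`, so each part is a linear relation in `Amb K`. -/
lemma linearIndependent_entry : LinearIndependent K
    (fun e : EntryIndex => Ideal.Quotient.mk (idealP K ^ 2) (entry K e)) := by
  rw [Fintype.linearIndependent_iff]
  intro g hg
  have hmem : ∑ e, g e • entry K e ∈ idealP K ^ 2 := by
    rw [← Ideal.Quotient.eq_zero_iff_mem, map_sum, ← hg]
    rfl
  obtain ⟨p, hp⟩ := idealP_sq_le_degreeIdeal K hmem
  have hs : hGrade K (∑ e, g e • entry K e) = Polynomial.toLaurent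
      (Polynomial.C (∑ i, ∑ a, g (Sum.inl (i, a)) • algebraMap (XPoly K) (Amb K) (xv K i a)) *
          Polynomial.X ^ 2 +
        Polynomial.C (∑ a, ∑ j, g (Sum.inr (a, j)) • yEnt K a ((j : Fin 8) : ℕ)) *
          Polynomial.X ^ 3) := by
    rw [Fintype.sum_sum_type, Fintype.sum_prod_type, Fintype.sum_prod_type, map_add, map_add,
      Polynomial.toLaurent_C_mul_X_pow, Polynomial.toLaurent_C_mul_X_pow]
    simp only [map_sum, Algebra.smul_def, map_mul, hGrade_algebraMap_field, Finset.sum_mul, entry,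
      Sum.elim_inl, Sum.elim_inr, hGrade_matX, hGrade_matY, Nat.cast_ofNat, mul_assoc]
  have hpoly := Polynomial.toLaurent_injective (hs.symm.trans hp)
  have h2 := congrArg (Polynomial.coeff · 2) hpoly
  have h3 := congrArg (Polynomial.coeff · 3) hpoly
  simp only [Polynomial.coeff_add, Polynomial.coeff_C_mul_X_pow, Polynomial.coeff_X_pow_mul'] at h2 h3
  rw [if_pos trivial, if_neg (by decide : ¬ 2 = 3), if_neg (by decide : ¬ 4 ≤ 2), add_zero] at h2
  rw [if_pos trivial, if_neg (by decide : ¬ 3 = 2), if_neg (by decide : ¬ 4 ≤ 3), zero_add] at h3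
  have h2' : algebraMap (XPoly K) (Amb K) (∑ i, ∑ a, g (Sum.inl (i, a)) • xv K i a) = 0 := by
    rw [← h2]
    simp only [map_sum, Algebra.smul_def, map_mul,
      ← IsScalarTower.algebraMap_apply K (XPoly K) (Amb K)]
  rintro (⟨i, a⟩ | ⟨a, j⟩)
  · exact eq_zero_of_sum_smul_xv K (c := fun i a => g (Sum.inl (i, a)))
      (algebraMap_injective K (h2'.trans (map_zero _).symm)) i a
  · exact eq_zero_of_sum_smul_yEnt K (d := fun a j => g (Sum.inr (a, j))) h3 a j

end RigidityCounterexample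

/-! ### Projective resolutions of length two -/

namespace LengthTwoResolution

open ZeroObject

universe v w

variable {C : Type w} [Category.{v} C] [Abelian C] {P₀ P₁ P₂ M : C}

/-- The objects of a complex of length two. -/
def obj (P₀ P₁ P₂ : C) : ℕ → C
  | 0 => P₀
  | 1 => P₁
  | 2 => P₂
  | _ + 3 => 0

def diff (d₂ : P₂ ⟶ P₁) (d₁ : P₁ ⟶ P₀) : ∀ n, obj P₀ P₁ P₂ (n + 1) ⟶ obj P₀ P₁ P₂ n
  | 0 => d₁
  | 1 => d₂
  | _ + 2 => 0

lemma diff_comp {d₂ : P₂ ⟶ P₁} {d₁ : P₁ ⟶ P₀} (h : d₂ ≫ d₁ = 0) :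
    ∀ n, diff d₂ d₁ (n + 1) ≫ diff d₂ d₁ n = 0
  | 0 => h
  | _ + 1 => zero_comp

/-- The complex `0 ⟶ P₂ ⟶ P₁ ⟶ P₀`. -/
def complex {d₂ : P₂ ⟶ P₁} {d₁ : P₁ ⟶ P₀} (h : d₂ ≫ d₁ = 0) : ChainComplex C ℕ :=
  ChainComplex.of (obj P₀ P₁ P₂) (diff d₂ d₁) (diff_comp h)

variable {d₂ : P₂ ⟶ P₁} {d₁ : P₁ ⟶ P₀} (h : d₂ ≫ d₁ = 0)

lemma complex_d (n : ℕ) : (complex h).d (n + 1) n = diff d₂ d₁ n := ChainComplex.of_d _ _ _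

lemma exactAt_succ [Mono d₂] (hex : (ShortComplex.mk d₂ d₁ h).Exact) (n : ℕ) :
    (complex h).ExactAt (n + 1) := by
  rw [HomologicalComplex.exactAt_iff' _ (n + 1 + 1) (n + 1) n (by simp) (by simp)]
  have e : (complex h).sc' (n + 1 + 1) (n + 1) n =
      ShortComplex.mk (diff d₂ d₁ (n + 1)) (diff d₂ d₁ n) (diff_comp h n) := by
    simp only [HomologicalComplex.sc', HomologicalComplex.shortComplexFunctor', complex_d]
    rfl
  rw [e]
  match n with
  | 0 => exact hex
  | 1 =>
    rw [ShortComplex.exact_iff_mono _ rfl]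
    exact (inferInstance : Mono d₂)
  | n + 2 => exact ShortComplex.exact_of_isZero_X₂ _ (isZero_zero C)

/-- A projective resolution of length two. -/
def resolution [Projective P₀] [Projective P₁] [Projective P₂] [Mono d₂]
    (hex : (ShortComplex.mk d₂ d₁ h).Exact) (π : P₀ ⟶ M) (hπ : d₁ ≫ π = 0) [Epi π]
    (hex' : (ShortComplex.mk d₁ π hπ).Exact) : ProjectiveResolution M where
  complex := complex h
  projective
    | 0 => (inferInstance : Projective P₀)
    | 1 => (inferInstance : Projective P₁)
    | 2 => (inferInstance : Projective P₂)
    | _ + 3 => (isZero_zero C).projective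
  π := (ChainComplex.toSingle₀Equiv (complex h) M).symm ⟨π, by
    rw [complex_d h 0]
    exact hπ⟩
  quasiIso := ⟨fun n => by
    cases n with
    | zero =>
      rw [ChainComplex.quasiIsoAt₀_iff, ShortComplex.quasiIso_iff_of_zeros' _ rfl rfl rfl]
      have e : (complex h).d 1 0 = d₁ := complex_d h 0
      have key : ∀ (f : P₁ ⟶ P₀) (g : P₀ ⟶ M) (w : f ≫ g = 0), f = d₁ → g = π →
          (ShortComplex.mk f g w).Exact ∧ Epi g := by
        rintro _ _ _ rfl rfl
        exact ⟨hex', inferInstance⟩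
      exact key _ _ _ e (ChainComplex.toSingle₀Equiv_symm_apply_f_zero _ _)
    | succ n =>
      rw [quasiIsoAt_iff_exactAt' (hL := ChainComplex.exactAt_succ_single_obj ..)]
      exact exactAt_succ h hex n⟩

end LengthTwoResolution

/-! ### Tor of the cokernel of a matrix -/

namespace RowCokernel

variable {A : Type u} [CommRing A] {a b c : ℕ}

/-- The action of a matrix from the right on rows with entries in a module. -/
def rowAction (X : Matrix (Fin a) (Fin b) A) (N : Type*) [AddCommGroup N] [Module A N] :
    (Fin a → N) →ₗ[A] (Fin b → N) :=
  LinearMap.pi fun j => ∑ i, X i j • LinearMap.proj i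

lemma rowAction_apply (X : Matrix (Fin a) (Fin b) A) {N : Type*} [AddCommGroup N] [Module A N]
    (n : Fin a → N) (j : Fin b) : rowAction X N n j = ∑ i, X i j • n i := by
  simp [rowAction]

/-- Rows with entries in a module as a tensor product. -/
def tensorEquiv (k : ℕ) (N : Type*) [AddCommGroup N] [Module A N] :
    TensorProduct A (Fin k → A) N ≃ₗ[A] (Fin k → N) :=
  TensorProduct.comm A (Fin k → A) N ≪≫ₗ TensorProduct.piScalarRight A A N (Fin k)

lemma tensorEquiv_tmul {k : ℕ} {N : Type*} [AddCommGroup N] [Module A N] (v : Fin k → A) (n : N) :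
    tensorEquiv k N (v ⊗ₜ n) = fun i => v i • n := by
  simp [tensorEquiv]

lemma tensorEquiv_comp_rTensor (X : Matrix (Fin a) (Fin b) A) (N : Type*) [AddCommGroup N]
    [Module A N] : (rowAction X N) ∘ₗ (tensorEquiv (A := A) a N).toLinearMap =
      (tensorEquiv (A := A) b N).toLinearMap ∘ₗ (X.vecMulLinear.rTensor N) := by
  refine TensorProduct.ext' fun v n => ?_
  funext j
  simp [tensorEquiv_tmul, rowAction_apply, Matrix.vecMul, dotProduct, Finset.sum_smul, smul_smul,
    mul_comm]

variable (X : Matrix (Fin a) (Fin b) A) (Y : Matrix (Fin b) (Fin c) A)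

/-- A free resolution of the cokernel of `Y`. -/
def resolution (hX : Function.Injective X.vecMulLinear)
    (hXY : Function.Exact X.vecMulLinear Y.vecMulLinear) :
    ProjectiveResolution (rowCokernel Y) :=
  haveI : Mono (ModuleCat.ofHom X.vecMulLinear) := (ModuleCat.mono_iff_injective _).2 hX
  haveI : Epi (ModuleCat.ofHom (LinearMap.range Y.vecMulLinear).mkQ) :=
    (ModuleCat.epi_iff_surjective _).2 (Submodule.mkQ_surjective _)
  LengthTwoResolution.resolution (d₂ := ModuleCat.ofHom X.vecMulLinear)
    (d₁ := ModuleCat.ofHom Y.vecMulLinear) (M := rowCokernel Y)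
    (by ext1; exact hXY.linearMap_comp_eq_zero)
    ((ShortComplex.ShortExact.moduleCat_exact_iff_function_exact _).2 hXY)
    (ModuleCat.ofHom (LinearMap.range Y.vecMulLinear).mkQ)
    (by ext1; exact LinearMap.range_mkQ_comp _)
    ((ShortComplex.ShortExact.moduleCat_exact_iff_function_exact _).2
      (LinearMap.exact_map_mkQ_range _))

variable {X Y}

/-- Tor is the homology of the tensored resolution, so it vanishes exactly when that complex is
exact at the given spot. -/
lemma isZero_torModule_succ_iff (hX : Function.Injective X.vecMulLinear)
    (hXY : Function.Exact X.vecMulLinear Y.vecMulLinear) (N : ModuleCat.{u} A) (n : ℕ) :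
    IsZero (torModule (n + 1) (rowCokernel Y) N) ↔
      Function.Exact
        ((LengthTwoResolution.diff (ModuleCat.ofHom X.vecMulLinear)
          (ModuleCat.ofHom Y.vecMulLinear) (n + 1)).hom.rTensor N)
        ((LengthTwoResolution.diff (ModuleCat.ofHom X.vecMulLinear)
          (ModuleCat.ofHom Y.vecMulLinear) n).hom.rTensor N) := by
  have i := (resolution X Y hX hXY).isoLeftDerivedObj
    ((MonoidalCategory.tensoringRight (ModuleCat.{u} A)).obj N) (n + 1)
  refine (i.isZero_iff).trans ?_
  refine (HomologicalComplex.exactAt_iff_isZero_homology _ _).symm.trans ?_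
  rw [HomologicalComplex.exactAt_iff' _ (n + 1 + 1) (n + 1) n (by simp) (by simp),
    ShortComplex.ShortExact.moduleCat_exact_iff_function_exact]
  have key : ∀ (f : LengthTwoResolution.obj (ModuleCat.of A (Fin c → A)) (ModuleCat.of A (Fin b → A))
      (ModuleCat.of A (Fin a → A)) (n + 1 + 1) ⟶ LengthTwoResolution.obj _ _ _ (n + 1))
      (g : LengthTwoResolution.obj (ModuleCat.of A (Fin c → A)) (ModuleCat.of A (Fin b → A))
      (ModuleCat.of A (Fin a → A)) (n + 1) ⟶ LengthTwoResolution.obj _ _ _ n)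
      (_ : f = LengthTwoResolution.diff (ModuleCat.ofHom X.vecMulLinear)
          (ModuleCat.ofHom Y.vecMulLinear) (n + 1))
      (_ : g = LengthTwoResolution.diff (ModuleCat.ofHom X.vecMulLinear)
          (ModuleCat.ofHom Y.vecMulLinear) n),
      Function.Exact (f.hom.rTensor N) (g.hom.rTensor N) ↔ Function.Exact
        ((LengthTwoResolution.diff (ModuleCat.ofHom X.vecMulLinear)
          (ModuleCat.ofHom Y.vecMulLinear) (n + 1)).hom.rTensor N)
        ((LengthTwoResolution.diff (ModuleCat.ofHom X.vecMulLinear)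
          (ModuleCat.ofHom Y.vecMulLinear) n).hom.rTensor N) := by
    rintro _ _ rfl rfl
    rfl
  have h : ModuleCat.ofHom X.vecMulLinear ≫ ModuleCat.ofHom Y.vecMulLinear = 0 := by
    ext1
    exact hXY.linearMap_comp_eq_zero
  exact key _ _ (LengthTwoResolution.complex_d h _) (LengthTwoResolution.complex_d h _)

lemma isZero_torModule_one_iff (hX : Function.Injective X.vecMulLinear)
    (hXY : Function.Exact X.vecMulLinear Y.vecMulLinear) (N : ModuleCat.{u} A) :
    IsZero (torModule 1 (rowCokernel Y) N) ↔
      Function.Exact (rowAction X N) (rowAction Y N) := by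
  refine (isZero_torModule_succ_iff hX hXY N 0).trans ?_
  exact (Function.Exact.iff_of_ladder_linearEquiv (tensorEquiv_comp_rTensor X N)
    (tensorEquiv_comp_rTensor Y N)).symm

lemma isZero_torModule_two_iff (hX : Function.Injective X.vecMulLinear)
    (hXY : Function.Exact X.vecMulLinear Y.vecMulLinear) (N : ModuleCat.{u} A) :
    IsZero (torModule 2 (rowCokernel Y) N) ↔ Function.Injective (rowAction X N) := by
  refine (isZero_torModule_succ_iff hX hXY N 1).trans ?_
  -- The resolution is zero in degree 3, so exactness in degree 2 means injectivity of the next map.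
  have e : Function.Exact
        (((0 : LengthTwoResolution.obj (ModuleCat.of A (Fin c → A)) (ModuleCat.of A (Fin b → A))
      (ModuleCat.of A (Fin a → A)) 3 ⟶ ModuleCat.of A (Fin a → A)).hom).rTensor N)
        (X.vecMulLinear.rTensor N) ↔ Function.Injective (X.vecMulLinear.rTensor N) := by
    rw [ModuleCat.hom_zero, LinearMap.rTensor_zero]
    rw [LinearMap.exact_iff, LinearMap.range_zero, LinearMap.ker_eq_bot]
  refine e.trans ?_
  have h := congrArg DFunLike.coe (tensorEquiv_comp_rTensor X N)
  rw [LinearMap.coe_comp, LinearMap.coe_comp] at h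
  rw [← (tensorEquiv (A := A) b N).injective.of_comp_iff, ← Function.Injective.of_comp_iff'
    (rowAction X N) (tensorEquiv (A := A) a N).bijective]
  exact iff_of_eq (congrArg _ h.symm)

end RowCokernel

/-! ### Projective dimension of the cokernel. -/

namespace RowCokernel

variable {A : Type u} [CommRing A] {a b c : ℕ}
  {X : Matrix (Fin a) (Fin b) A} {Y : Matrix (Fin b) (Fin c) A}

lemma exists_mul_eq_one_of_comp_vecMulLinear (r : (Fin b → A) →ₗ[A] (Fin a → A))
    (hr : r ∘ₗ X.vecMulLinear = LinearMap.id) : ∃ Z : Matrix (Fin b) (Fin a) A, X * Z = 1 := by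
  refine ⟨Matrix.of fun j => r (Pi.single j 1), ?_⟩
  ext i k
  have h := congrFun (DFunLike.congr_fun hr (Pi.single i 1)) k
  rw [LinearMap.comp_apply, LinearMap.pi_apply_eq_sum_univ r] at h
  rw [Matrix.mul_apply, Matrix.one_apply]
  have e (j : Fin b) : (fun j' => if j = j' then (1 : A) else 0) = Pi.single j 1 := by
    funext j'
    simp [Pi.single_apply, eq_comm]
  simpa [Finset.sum_apply, e, Pi.single_apply, eq_comm] using h

/-- If the dimension were at most 1, the image of `Y` would be projective. The surjection onto it
would then split, and so would the inclusion given by `X`; the matrix of a retraction is a right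
inverse of `X`. -/
lemma projectiveDimension_eq_two (hX : Function.Injective X.vecMulLinear)
    (hXY : Function.Exact X.vecMulLinear Y.vecMulLinear)
    (hZ : ∀ Z : Matrix (Fin b) (Fin a) A, X * Z ≠ 1) :
    projectiveDimension (rowCokernel Y) = 2 := by
  have hex : Function.Exact X.vecMulLinear Y.vecMulLinear.rangeRestrict := by
    intro v
    rw [← hXY v, ← Subtype.coe_inj]
    rfl
  have s₁ : (ShortComplex.mk (ModuleCat.ofHom X.vecMulLinear)
      (ModuleCat.ofHom Y.vecMulLinear.rangeRestrict)
      (by ext1; exact hex.linearMap_comp_eq_zero)).ShortExact :=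
    { exact := (ShortComplex.ShortExact.moduleCat_exact_iff_function_exact _).2 hex
      mono_f := (ModuleCat.mono_iff_injective _).2 hX
      epi_g := (ModuleCat.epi_iff_surjective _).2 (LinearMap.surjective_rangeRestrict _) }
  have s₂ : (ShortComplex.mk (ModuleCat.ofHom (LinearMap.range Y.vecMulLinear).subtype)
      (ModuleCat.ofHom (LinearMap.range Y.vecMulLinear).mkQ : _ ⟶ rowCokernel Y)
      (by ext1; exact (LinearMap.exact_subtype_mkQ _).linearMap_comp_eq_zero)).ShortExact :=
    { exact := (ShortComplex.ShortExact.moduleCat_exact_iff_function_exact _).2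
        (LinearMap.exact_subtype_mkQ _)
      mono_f := (ModuleCat.mono_iff_injective _).2 (Submodule.subtype_injective _)
      epi_g := (ModuleCat.epi_iff_surjective _).2 (Submodule.mkQ_surjective _) }
  have p (k : ℕ) : Projective (ModuleCat.of A (Fin k → A)) := inferInstance
  apply le_antisymm
  · refine (projectiveDimension_le_iff _ 2).2 ?_
    have h₁ := (s₁.hasProjectiveDimensionLT_X₃_iff 0 (p b)).2
      (projective_iff_hasProjectiveDimensionLT_one.1 (p a))
    exact (s₂.hasProjectiveDimensionLT_X₃_iff 1 (p c)).2 h₁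
  · refine (projectiveDimension_ge_iff _ 2).2 fun h => ?_
    have h₁ := (s₂.hasProjectiveDimensionLT_X₃_iff 0 (p c)).1 h
    have h₂ : Projective (ModuleCat.of A (LinearMap.range Y.vecMulLinear)) :=
      projective_iff_hasProjectiveDimensionLT_one.2 h₁
    have h₃ : Module.Projective A (LinearMap.range Y.vecMulLinear) :=
      (IsProjective.iff_projective _).2 h₂
    have h₄ := Module.projective_lifting_property Y.vecMulLinear.rangeRestrict LinearMap.id
      (LinearMap.surjective_rangeRestrict _)
    have h₅ := (hex.split_tfae hX (LinearMap.surjective_rangeRestrict _)).out 0 1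
    obtain ⟨r, hr⟩ := h₅.1 h₄
    obtain ⟨Z, hZ'⟩ := exists_mul_eq_one_of_comp_vecMulLinear r hr
    exact hZ Z hZ'

end RowCokernel

namespace RigidityCounterexample

variable (K : Type u) [Field K]

/-! ### Arithmetic in `S` and `N` -/

lemma sElt_mul_sElt : sElt K * sElt K = 0 := by
  rw [sElt, ← map_mul, ← pow_two, Ideal.Quotient.eq_zero_iff_mem]
  exact Ideal.subset_span (by simp)

lemma sElt_mul_tElt : sElt K * tElt K = 0 := by
  rw [sElt, tElt, ← map_mul, Ideal.Quotient.eq_zero_iff_mem]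
  exact Ideal.subset_span (by simp)

lemma tElt_mul_tElt : tElt K * tElt K = 0 := by
  rw [tElt, ← map_mul, ← pow_two, Ideal.Quotient.eq_zero_iff_mem]
  exact Ideal.subset_span (by simp)

/-- The linear combinations of `s` and `t`. -/
def linComb (c : Fin 2 → K) : SRing K :=
  algebraMap K (SRing K) (c 0) * sElt K + algebraMap K (SRing K) (c 1) * tElt K

lemma linComb_add (c d : Fin 2 → K) : linComb K (c + d) = linComb K c + linComb K d := by
  simp only [linComb, Pi.add_apply, map_add]
  ring

lemma linComb_smul (r : K) (c : Fin 2 → K) :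
    linComb K (r • c) = algebraMap K (SRing K) r * linComb K c := by
  simp only [linComb, Pi.smul_apply, smul_eq_mul, map_mul]
  ring

@[simp] lemma linComb_zero : linComb K 0 = 0 := by simp [linComb]

lemma linComb_mul_linComb (c d : Fin 2 → K) : linComb K c * linComb K d = 0 := by
  have h1 := sElt_mul_sElt K
  have h2 := sElt_mul_tElt K
  have h3 := tElt_mul_tElt K
  simp only [linComb]
  linear_combination algebraMap K (SRing K) (c 0) * algebraMap K (SRing K) (d 0) * h1 +
    (algebraMap K (SRing K) (c 0) * algebraMap K (SRing K) (d 1) +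
      algebraMap K (SRing K) (c 1) * algebraMap K (SRing K) (d 0)) * h2 +
    algebraMap K (SRing K) (c 1) * algebraMap K (SRing K) (d 1) * h3

lemma exists_eq_add_linComb (z : SRing K) :
    ∃ (r : K) (c : Fin 2 → K), z = algebraMap K (SRing K) r + linComb K c := by
  obtain ⟨p, rfl⟩ := Ideal.Quotient.mk_surjective z
  induction p using MvPolynomial.induction_on with
  | C r => exact ⟨r, 0, by rw [linComb_zero, add_zero]; rfl⟩
  | add p q hp hq =>
    obtain ⟨r, c, h⟩ := hp
    obtain ⟨r', c', h'⟩ := hq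
    exact ⟨r + r', c + c', by rw [map_add, h, h', map_add, linComb_add]; ring⟩
  | mul_X p i hp =>
    obtain ⟨r, c, h⟩ := hp
    have hi : Ideal.Quotient.mk _ (MvPolynomial.X i) = linComb K (Pi.single i 1) := by
      fin_cases i
      · simp [linComb, sElt]
      · simp [linComb, tElt]
    refine ⟨0, r • Pi.single i 1, ?_⟩
    rw [map_mul, h, hi, add_mul, linComb_mul_linComb, linComb_smul, map_zero]
    ring

/-- The isomorphism of `S` with the square-zero extension of `K` by `K²`, as a homomorphism. -/
def sEval : SRing K →ₐ[K] TrivSqZeroExt K (K × K) :=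
  Ideal.Quotient.liftₐ _ (MvPolynomial.aeval
      ![TrivSqZeroExt.inr (1, 0), TrivSqZeroExt.inr (0, 1)]) (by
    intro p hp
    induction hp using Submodule.span_induction with
    | mem x hx =>
      rcases hx with rfl | rfl | rfl <;> simp [pow_two]
    | zero => simp
    | add x y _ _ hx hy => rw [map_add, hx, hy, add_zero]
    | smul r x _ hx => rw [smul_eq_mul, map_mul, hx, mul_zero])

@[simp] lemma sEval_sElt : sEval K (sElt K) = TrivSqZeroExt.inr (1, 0) := by
  exact (MvPolynomial.aeval_X _ _).trans rfl

@[simp] lemma sEval_tElt : sEval K (tElt K) = TrivSqZeroExt.inr (0, 1) := by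
  exact (MvPolynomial.aeval_X _ _).trans rfl

lemma isUnit_algebraMap_add_linComb {r : K} (hr : r ≠ 0) (c : Fin 2 → K) :
    IsUnit (algebraMap K (SRing K) r + linComb K c) := by
  refine IsUnit.of_mul_eq_one (algebraMap K (SRing K) r⁻¹ - linComb K ((r⁻¹ * r⁻¹) • c)) ?_
  have h := linComb_mul_linComb K c c
  have hr' : algebraMap K (SRing K) r * algebraMap K (SRing K) r⁻¹ = 1 := by
    rw [← map_mul, mul_inv_cancel₀ hr, map_one]
  rw [linComb_smul, map_mul]
  linear_combination (1 - algebraMap K (SRing K) r⁻¹ * linComb K c) * hr' -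
    algebraMap K (SRing K) r⁻¹ * algebraMap K (SRing K) r⁻¹ * h

/-- The relations defining `N`. -/
abbrev relN : Submodule (SRing K) (Fin 2 → SRing K) :=
  Submodule.span (SRing K) {![tElt K, 0], ![0, sElt K], ![sElt K, tElt K]}

/-- The maximal ideal of `S` has square zero, so over `K` the relations are spanned by `te₁`, `se₂`
and `se₁ + te₂`. The last condition compares the `s`-coefficient of the first entry with the
`t`-coefficient of the second. -/
lemma mem_relN_iff (v : Fin 2 → SRing K) : v ∈ relN K ↔
    (sEval K (v 0)).fst = 0 ∧ (sEval K (v 1)).fst = 0 ∧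
      (sEval K (v 0)).snd.1 = (sEval K (v 1)).snd.2 := by
  constructor
  · intro h
    obtain ⟨a, b, c, rfl⟩ := Submodule.mem_span_triple.1 h
    simp
  · rintro ⟨h0, h1, h2⟩
    obtain ⟨r, c, hc⟩ := exists_eq_add_linComb K (v 0)
    obtain ⟨r', c', hc'⟩ := exists_eq_add_linComb K (v 1)
    rw [hc] at h0 h2
    rw [hc'] at h1 h2
    simp [linComb, AlgHom.commutes, TrivSqZeroExt.algebraMap_eq_inl] at h0 h1 h2
    subst h0 h1
    refine Submodule.mem_span_triple.2 ⟨algebraMap _ _ (c 1), algebraMap _ _ (c' 0),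
      algebraMap _ _ (c 0), ?_⟩
    funext i
    fin_cases i
    · simp [hc, linComb, add_comm, -algebraMap_smul, smul_eq_mul]
    · simp [hc', linComb, h2, -algebraMap_smul, smul_eq_mul]

/-- The class of a row in `N`. -/
def mkN : (Fin 2 → SRing K) →ₗ[SRing K] moduleN K := (relN K).mkQ

lemma mkN_surjective : Function.Surjective (mkN K) := Submodule.mkQ_surjective _

lemma mkN_eq_zero_iff (v : Fin 2 → SRing K) : mkN K v = 0 ↔
    (sEval K (v 0)).fst = 0 ∧ (sEval K (v 1)).fst = 0 ∧
      (sEval K (v 0)).snd.1 = (sEval K (v 1)).snd.2 :=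
  (Submodule.Quotient.mk_eq_zero _).trans (mem_relN_iff K v)

lemma mkN_eq_iff (v w : Fin 2 → SRing K) : mkN K v = mkN K w ↔
    (sEval K ((v - w) 0)).fst = 0 ∧ (sEval K ((v - w) 1)).fst = 0 ∧
      (sEval K ((v - w) 0)).snd.1 = (sEval K ((v - w) 1)).snd.2 := by
  rw [← sub_eq_zero, ← map_sub, mkN_eq_zero_iff]

end RigidityCounterexample

/-! ### The complex `N² → N⁴ → N⁸` over `S`. -/

namespace RowCokernel

variable {A : Type u} [CommRing A] {a b c : ℕ}

lemma rowAction_rowAction (X : Matrix (Fin a) (Fin b) A) (Y : Matrix (Fin b) (Fin c) A)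
    {N : Type*} [AddCommGroup N] [Module A N] (n : Fin a → N) :
    rowAction Y N (rowAction X N n) = rowAction (X * Y) N n := by
  funext k
  simp only [rowAction_apply, Matrix.mul_apply, Finset.smul_sum, Finset.sum_smul, smul_smul]
  rw [Finset.sum_comm]
  simp only [mul_comm]

lemma rowAction_zero (N : Type*) [AddCommGroup N] [Module A N] :
    rowAction (0 : Matrix (Fin a) (Fin b) A) N = 0 := by
  ext n j
  simp [rowAction_apply]

lemma rowAction_two_four (s t : A) {N : Type*} [AddCommGroup N] [Module A N] (n : Fin 2 → N) :
    rowAction !![s, 0, t, 0; 0, s, 0, t] N n = ![s • n 0, s • n 1, t • n 0, t • n 1] := by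
  funext j
  rw [rowAction_apply, Fin.sum_univ_two]
  fin_cases j <;> simp

lemma rowAction_four_eight (s t : A) {N : Type*} [AddCommGroup N] [Module A N] (n : Fin 4 → N) :
    rowAction !![s, 0, 0, 0, t, 0, 0, 0; 0, s, 0, 0, 0, t, 0, 0;
      0, 0, s, 0, 0, 0, t, 0; 0, 0, 0, s, 0, 0, 0, t] N n =
        ![s • n 0, s • n 1, s • n 2, s • n 3, t • n 0, t • n 1, t • n 2, t • n 3] := by
  funext j
  rw [rowAction_apply, Fin.sum_univ_four]
  fin_cases j <;> simp

end RowCokernel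

namespace RigidityCounterexample

open RowCokernel

variable (K : Type u) [Field K]

lemma barX_mul_barY : barX K * barY K = 0 := by
  have h1 := sElt_mul_sElt K
  have h2 := sElt_mul_tElt K
  have h3 := tElt_mul_tElt K
  have h4 : tElt K * sElt K = 0 := by rw [mul_comm, h2]
  ext i j
  rw [Matrix.mul_apply, Fin.sum_univ_four]
  fin_cases i <;> fin_cases j <;> simp [barX, barY, h1, h2, h3, h4]

/-- Multiplication by `s` detects the coefficient of `e₁` and multiplication by `t` that of `e₂`;
what both kill is the socle. -/
lemma fst_eq_zero_of_smul_eq_zero {v : Fin 2 → SRing K} (hs : sElt K • mkN K v = 0)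
    (ht : tElt K • mkN K v = 0) : (sEval K (v 0)).fst = 0 ∧ (sEval K (v 1)).fst = 0 := by
  rw [← map_smul, mkN_eq_zero_iff] at hs ht
  simp at hs ht
  exact ⟨hs, ht.symm⟩

/-- The kernel of `barY` consists of rows with entries in the socle. Since `s` and `t` see different
basis vectors of `N`, the values `sn` and `tn` can be prescribed independently in the socle. -/
lemma exact_barX_barY : Function.Exact (rowAction (barX K) (moduleN K))
    (rowAction (barY K) (moduleN K)) := by
  intro n
  constructor
  · intro hn
    choose v hv using fun i => mkN_surjective K (n i)
    rw [barY, rowAction_four_eight] at hn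
    have hf (i : Fin 4) : (sEval K (v i 0)).fst = 0 ∧ (sEval K (v i 1)).fst = 0 := by
      apply fst_eq_zero_of_smul_eq_zero
      · rw [hv]
        have := congrFun hn (![0, 1, 2, 3] i)
        fin_cases i <;> exact this
      · rw [hv]
        have := congrFun hn (![4, 5, 6, 7] i)
        fin_cases i <;> exact this
    -- The coordinate of `n i` in the socle: `n i = d i • se₁`.
    let d (i : Fin 4) : K := (sEval K (v i 0)).snd.1 - (sEval K (v i 1)).snd.2
    have hS (i j : Fin 4) : sElt K • mkN K ![algebraMap K (SRing K) (d i),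
        -algebraMap K (SRing K) (d j)] = n i := by
      rw [← hv, eq_comm, ← map_smul, mkN_eq_iff]
      simp [hf, TrivSqZeroExt.algebraMap_eq_inl, d]
    have hT (i j : Fin 4) : tElt K • mkN K ![algebraMap K (SRing K) (d i),
        -algebraMap K (SRing K) (d j)] = n j := by
      rw [← hv, eq_comm, ← map_smul, mkN_eq_iff]
      simp [hf, TrivSqZeroExt.algebraMap_eq_inl, d]
    -- The minus sign compensates `te₂ = -se₁`. Entries 0 and 2 come from the first coordinate of
    -- the preimage, entries 1 and 3 from the second.
    refine ⟨![mkN K ![algebraMap K (SRing K) (d 0), -algebraMap K (SRing K) (d 2)],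
      mkN K ![algebraMap K (SRing K) (d 1), -algebraMap K (SRing K) (d 3)]], ?_⟩
    rw [barX, rowAction_two_four]
    funext j
    fin_cases j
    · exact hS 0 2
    · exact hS 1 3
    · exact hT 0 2
    · exact hT 1 3
  · rintro ⟨m, rfl⟩
    rw [rowAction_rowAction, barX_mul_barY, rowAction_zero, LinearMap.zero_apply]

/-- The entries of `barX` lie in the maximal ideal, which kills the nonzero socle element `se₁`. -/
lemma not_injective_barX : ¬ Function.Injective (rowAction (barX K) (moduleN K)) := by
  intro h
  have e1 : sElt K • mkN K ![sElt K, 0] = 0 := by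
    rw [← map_smul, mkN_eq_zero_iff]
    simp
  have e2 : tElt K • mkN K ![sElt K, 0] = 0 := by
    rw [← map_smul, mkN_eq_zero_iff]
    simp
  have h0 : rowAction (barX K) (moduleN K) (fun _ => mkN K ![sElt K, 0]) = 0 := by
    rw [barX, rowAction_two_four, e1, e2]
    funext j
    fin_cases j <;> rfl
  have h1 := congrFun (h (h0.trans (map_zero _).symm)) 0
  rw [Pi.zero_apply, mkN_eq_zero_iff] at h1
  simp at h1

/-- The residue map of `S`. -/
def sResidue : SRing K →ₐ[K] K := (TrivSqZeroExt.fstHom K K (K × K)).comp (sEval K)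

lemma sResidue_apply (z : SRing K) : sResidue K z = (sEval K z).fst := rfl

/-- The socle and its quotient give `0 → K → N → K² → 0`. -/
lemma length_moduleN : Module.length (SRing K) (moduleN K) = 3 := by
  let _ : Algebra (SRing K) K := (sResidue K : SRing K →+* K).toAlgebra
  have hsm (z : SRing K) (r : K) : z • r = sResidue K z * r := rfl
  have hsurj : Function.Surjective (algebraMap (SRing K) K) := fun r =>
    ⟨algebraMap K (SRing K) r, (sResidue K).commutes r⟩
  let f : K →ₗ[SRing K] moduleN K :=
    { toFun r := mkN K ![algebraMap K (SRing K) r * sElt K, 0]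
      map_add' r r' := by
        rw [← map_add, mkN_eq_iff]
        simp [TrivSqZeroExt.algebraMap_eq_inl]
      map_smul' z r := by
        rw [RingHom.id_apply, ← map_smul, mkN_eq_iff, hsm, sResidue_apply]
        simp [TrivSqZeroExt.algebraMap_eq_inl] }
  let g₀ : (Fin 2 → SRing K) →ₗ[SRing K] K × K :=
    { toFun v := (sResidue K (v 0), sResidue K (v 1))
      map_add' v w := by simp
      map_smul' z v := by
        ext <;> simp [hsm] }
  let g : moduleN K →ₗ[SRing K] K × K := Submodule.liftQ (relN K) g₀ (by
    intro v hv
    rw [mem_relN_iff] at hv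
    exact Prod.ext hv.1 hv.2.1)
  have hg (v : Fin 2 → SRing K) : g (mkN K v) = (sResidue K (v 0), sResidue K (v 1)) := rfl
  have hf : Function.Injective f := by
    rw [injective_iff_map_eq_zero]
    intro r hr
    change mkN K _ = 0 at hr
    rw [mkN_eq_zero_iff] at hr
    simpa [TrivSqZeroExt.algebraMap_eq_inl] using hr
  have hgs : Function.Surjective g := by
    rintro ⟨r, r'⟩
    refine ⟨mkN K ![algebraMap _ _ r, algebraMap _ _ r'], ?_⟩
    rw [hg]
    simp
  have hex : Function.Exact f g := by
    intro n
    obtain ⟨v, rfl⟩ := mkN_surjective K n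
    constructor
    · intro h
      have h0 : (sEval K (v 0)).fst = 0 := congrArg Prod.fst h
      have h1 : (sEval K (v 1)).fst = 0 := congrArg Prod.snd h
      refine ⟨(sEval K (v 0)).snd.1 - (sEval K (v 1)).snd.2, ?_⟩
      refine (mkN_eq_iff K _ _).2 ?_
      simp [h0, h1, TrivSqZeroExt.algebraMap_eq_inl]
    · rintro ⟨r, hr⟩
      rw [← hr]
      change g (mkN K ![algebraMap K (SRing K) r * sElt K, 0]) = 0
      rw [hg]
      simp [sResidue_apply]
  rw [Module.length_eq_add_of_exact f g hf hgs hex,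
    Module.length_eq_of_surjective (R := K) (M := K) hsurj,
    Module.length_eq_of_surjective (R := K) (M := K × K) hsurj,
    Module.length_of_free_of_finite, Module.length_of_free_of_finite]
  simp
  norm_num

end RigidityCounterexample

lemma length_restrictScalars {A S : Type u} [CommRing A] [CommRing S] (f : A →+* S)
    (hf : Function.Surjective f) (M : ModuleCat.{u} S) :
    Module.length A ((ModuleCat.restrictScalars f).obj M) = Module.length S M := by
  let _ : Algebra A S := f.toAlgebra
  let _ : Module A M := inferInstanceAs (Module A ((ModuleCat.restrictScalars f).obj M))
  have : IsScalarTower A S M := ⟨fun a z n => mul_smul (f a) z n⟩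
  exact Module.length_eq_of_surjective (R := S) (S := A) (M := M) hf

/-! ### From one specialization to all the asserted properties. -/

namespace RigidityCounterexample

open RowCokernel

variable {K : Type u} [Field K] {A : Type u} [CommRing A] [Algebra K A]
  {X : Matrix (Fin 2) (Fin 4) A} {Y : Matrix (Fin 4) (Fin 8) A}

/-- Every entry of `barX` has residue zero, so no product with it can be the identity. -/
lemma barX_mul_ne_one (Z : Matrix (Fin 4) (Fin 2) (SRing K)) : barX K * Z ≠ 1 := by
  intro h
  have := congrArg (sResidue K) (congrFun (congrFun h 0) 0)
  rw [Matrix.mul_apply, Fin.sum_univ_four] at this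
  simp [barX, sResidue_apply] at this

namespace IsSpecialization

variable {φ : A →ₐ[K] SRing K} (h : IsSpecialization X Y φ)

include h

lemma mul_ne_one (Z : Matrix (Fin 4) (Fin 2) A) : X * Z ≠ 1 := by
  intro hZ
  have := congrArg (fun M => M.map φ) hZ
  simp only [Matrix.map_mul, h.1, Matrix.map_one φ (map_zero φ) (map_one φ)] at this
  exact barX_mul_ne_one _ this

lemma surjective : Function.Surjective φ := by
  intro z
  obtain ⟨r, c, rfl⟩ := exists_eq_add_linComb K z
  have hs : φ (X 0 0) = sElt K := congrFun (congrFun h.1 0) 0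
  have ht : φ (X 0 2) = tElt K := congrFun (congrFun h.1 0) 2
  refine ⟨algebraMap K A r + (algebraMap K A (c 0) * X 0 0 + algebraMap K A (c 1) * X 0 2), ?_⟩
  simp only [map_add, map_mul, AlgHom.commutes, hs, ht]
  rfl

lemma length_eq : Module.length A (moduleNVia φ) = 3 :=
  (length_restrictScalars (φ : A →+* SRing K) h.surjective (moduleN K)).trans (length_moduleN K)

lemma finite : Module.Finite A (moduleNVia φ) := by
  have h3 : Module.length A (moduleNVia φ) ≠ ⊤ := by
    rw [h.length_eq]
    decide
  have := (isFiniteLength_iff_isNoetherian_isArtinian.1 (Module.length_ne_top_iff.1 h3)).1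
  infer_instance

lemma rowAction_X : ⇑(rowAction X (moduleNVia φ)) = rowAction (barX K) (moduleN K) := by
  funext n j
  rw [rowAction_apply, ← h.1]
  exact (rowAction_apply (X.map φ) (N := moduleN K) n j).symm

lemma rowAction_Y : ⇑(rowAction Y (moduleNVia φ)) = rowAction (barY K) (moduleN K) := by
  funext n j
  rw [rowAction_apply, ← h.2]
  exact (rowAction_apply (Y.map φ) (N := moduleN K) n j).symm

lemma isZero_torModule_one (hX : Function.Injective X.vecMulLinear)
    (hXY : Function.Exact X.vecMulLinear Y.vecMulLinear) :
    IsZero (torModule 1 (rowCokernel Y) (moduleNVia φ)) := by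
  rw [isZero_torModule_one_iff hX hXY, h.rowAction_X, h.rowAction_Y]
  exact exact_barX_barY K

lemma not_isZero_torModule_two (hX : Function.Injective X.vecMulLinear)
    (hXY : Function.Exact X.vecMulLinear Y.vecMulLinear) :
    ¬ IsZero (torModule 2 (rowCokernel Y) (moduleNVia φ)) := by
  rw [isZero_torModule_two_iff hX hXY, h.rowAction_X]
  exact not_injective_barX K

end IsSpecialization

lemma isCounterexample_of_exists_isSpecialization (hA : IsNoetherianRing A)
    (hX : Function.Injective X.vecMulLinear)
    (hXY : Function.Exact X.vecMulLinear Y.vecMulLinear)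
    (hφ : ∃ φ : A →ₐ[K] SRing K, IsSpecialization X Y φ) : IsCounterexample (K := K) X Y := by
  obtain ⟨φ, h⟩ := hφ
  exact
    { noetherian := hA
      injective := hX
      exact := hXY
      projectiveDimension_eq := projectiveDimension_eq_two hX hXY h.mul_ne_one
      exists_specialization := ⟨φ, h⟩
      tor ψ hψ := ⟨hψ.length_eq, hψ.isZero_torModule_one hX hXY,
        hψ.not_isZero_torModule_two hX hXY⟩
      not_rigid hr := h.not_isZero_torModule_two hX hXY
        (hr _ h.finite 1 (h.isZero_torModule_one hX hXY) 2 one_le_two) }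

lemma IsCounterexample.not_rigidityConjecture (h : IsCounterexample (K := K) X Y) :
    ¬ RigidityConjecture.{u} := by
  intro hc
  have := h.noetherian
  refine h.not_rigid (hc A (rowCokernel Y) inferInstance ?_)
  rw [h.projectiveDimension_eq]
  decide

end RigidityCounterexample

/-! ### The completion of a Noetherian ring is Noetherian -/

namespace AdicCompletion

variable {T B : Type*} [CommRing T] [CommRing B] (J : Ideal T) (I : Ideal B) (a : T →+* B)
  (ha : J.map a = I)

include ha in
lemma pow_le_comap_pow (n : ℕ) : J ^ n ≤ (I ^ n).comap a := by
  rw [← Ideal.map_le_iff_le_comap, Ideal.map_pow, ha]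

/-- The homomorphisms `T̂ → B / I ^ n` induced by a ring homomorphism. -/
def toQuotientPow (n : ℕ) : AdicCompletion J T →+* B ⧸ I ^ n :=
  (Ideal.quotientMap (I ^ n) a (pow_le_comap_pow J I a ha n)).comp
    (evalₐ J n : AdicCompletion J T →+* T ⧸ J ^ n)

lemma factorPow_comp_toQuotientPow {m n : ℕ} (hle : m ≤ n) :
    (Ideal.Quotient.factorPow I hle).comp (toQuotientPow J I a ha n) =
      toQuotientPow J I a ha m := by
  ext x
  obtain ⟨x, rfl⟩ := mk_surjective J T x
  simp only [toQuotientPow, RingHom.comp_apply, RingHom.coe_coe, evalₐ_mk, Ideal.quotientMap_mk]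
  change Ideal.Quotient.mk (I ^ m) _ = _
  rw [Ideal.Quotient.eq, ← map_sub]
  refine pow_le_comap_pow J I a ha m ?_
  have := x.2 hle
  rw [SModEq.sub_mem, smul_eq_mul, Ideal.mul_top] at this
  rw [← Ideal.Quotient.eq, eq_comm, Ideal.Quotient.eq]
  exact this

/-- The homomorphism of completions induced by a ring homomorphism. -/
def completedMap : AdicCompletion J T →+* AdicCompletion I B :=
  liftRingHom I (toQuotientPow J I a ha) (factorPow_comp_toQuotientPow J I a ha)

lemma completedMap_algebraMap (t : T) : completedMap J I a ha (algebraMap T _ t) =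
    algebraMap B (AdicCompletion I B) (a t) := by
  refine ext_evalₐ fun n => ?_
  rw [completedMap, evalₐ_liftRingHom]
  rfl

/-- Modulo the extended ideal the target is `B/I`, onto which `T` already maps; completeness of the
source and separatedness of the target lift this surjectivity. -/
lemma completedMap_surjective (hJ : J.FG) (hs : Function.Surjective a) :
    Function.Surjective (completedMap J I a ha) := by
  have hI : I.FG := ha ▸ hJ.map a
  have h : (J.map (algebraMap T (AdicCompletion J T))).map (completedMap J I a ha) =
      I.map (algebraMap B (AdicCompletion I B)) := by
    have e : (completedMap J I a ha).comp (algebraMap T (AdicCompletion J T)) =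
        (algebraMap B (AdicCompletion I B)).comp a :=
      RingHom.ext (completedMap_algebraMap J I a ha)
    rw [Ideal.map_map, e, ← Ideal.map_map, ha]
  have h1 := isAdicComplete_self J hJ
  have h2 := isAdicComplete_self I hI
  have h3 : IsHausdorff ((J.map (algebraMap T (AdicCompletion J T))).map (completedMap J I a ha))
      (AdicCompletion I B) := by
    rw [h]
    infer_instance
  refine surjective_of_mk_map_comp_surjective (I := J.map (algebraMap T (AdicCompletion J T))) _ ?_
  intro z
  obtain ⟨y, rfl⟩ := Ideal.Quotient.mk_surjective z
  obtain ⟨b, hb⟩ := Ideal.Quotient.mk_surjective (evalOneₐ I y)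
  obtain ⟨t, rfl⟩ := hs b
  refine ⟨algebraMap T _ t, ?_⟩
  rw [RingHom.comp_apply, completedMap_algebraMap, Ideal.Quotient.eq, h, ← ker_evalOneₐ_eq_map I hI,
    RingHom.mem_ker, map_sub, sub_eq_zero]
  exact hb

/-- Sending variables to generators of `I` makes the completion a quotient of the completion of
`B[x]` at its variables, which is a power series ring in finitely many variables. -/
lemma isNoetherianRing [IsNoetherianRing B] : IsNoetherianRing (AdicCompletion I B) := by
  obtain ⟨s, hs⟩ := I.fg_of_isNoetherianRing
  let a : MvPolynomial s B →+* B := (MvPolynomial.aeval fun i : s => (i : B) : _ →ₐ[B] B)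
  have ha : (MvPolynomial.idealOfVars s B).map a = I := by
    rw [MvPolynomial.idealOfVars, Ideal.map_span, ← hs, ← Set.range_comp]
    congr 1
    ext x
    simp [a]
  have hsurj : Function.Surjective a := fun b => ⟨MvPolynomial.C b, by simp [a]⟩
  have h := completedMap_surjective _ I a ha (MvPolynomial.idealOfVars_fg s B) hsurj
  exact isNoetherianRing_of_surjective (MvPowerSeries s B) _
    ((completedMap _ I a ha).comp
      (MvPowerSeries.toAdicCompletionAlgEquiv s B).toRingEquiv.toRingHom)
    (h.comp (MvPowerSeries.toAdicCompletionAlgEquiv s B).surjective)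

end AdicCompletion

/-! ### Flat base change -/

namespace RowCokernel

variable {A B : Type*} [CommRing A] [CommRing B] [Algebra A B] [Module.Flat A B] {a b c : ℕ}
  {X : Matrix (Fin a) (Fin b) A} {Y : Matrix (Fin b) (Fin c) A}

omit [Module.Flat A B] in
lemma coe_vecMulLinear_map (X : Matrix (Fin a) (Fin b) A) :
    ⇑(X.map (algebraMap A B)).vecMulLinear = rowAction X B := by
  funext n j
  simp [rowAction_apply, Matrix.vecMul, dotProduct, Algebra.smul_def, mul_comm]

variable (B)

lemma vecMulLinear_map_injective (hX : Function.Injective X.vecMulLinear) :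
    Function.Injective (X.map (algebraMap A B)).vecMulLinear := by
  rw [coe_vecMulLinear_map]
  have h := congrArg DFunLike.coe (tensorEquiv_comp_rTensor X B)
  rw [LinearMap.coe_comp, LinearMap.coe_comp] at h
  have h' := Module.Flat.rTensor_preserves_injective_linearMap (M := B) _ hX
  rw [← (tensorEquiv (A := A) b B).injective.of_comp_iff] at h'
  exact (Function.Injective.of_comp_iff' _ (tensorEquiv (A := A) a B).bijective).1
    ((congrArg Function.Injective h).mpr h')

lemma vecMulLinear_map_exact (hXY : Function.Exact X.vecMulLinear Y.vecMulLinear) :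
    Function.Exact (X.map (algebraMap A B)).vecMulLinear (Y.map (algebraMap A B)).vecMulLinear := by
  rw [coe_vecMulLinear_map, coe_vecMulLinear_map]
  exact (Function.Exact.iff_of_ladder_linearEquiv (tensorEquiv_comp_rTensor X B)
    (tensorEquiv_comp_rTensor Y B)).2 (Module.Flat.rTensor_exact B hXY)

end RowCokernel

namespace RigidityCounterexample

/-! ### Specializations of augmented algebras -/

section Augmented

variable {K : Type u} [Field K] {A : Type u} [CommRing A] [Algebra K A] {P : Ideal A}

/-- A `K`-algebra with residue field `K` at `P` has homomorphisms to `S` with arbitrary prescribed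
values on elements of `P` that are linearly independent modulo `P ^ 2`. -/
lemma exists_algHom_apply_eq_linComb (hP : Function.Bijective (algebraMap K (A ⧸ P)))
    {ι : Type*} {e : ι → A} (he : ∀ i, e i ∈ P)
    (hli : LinearIndependent K (fun i => Ideal.Quotient.mk (P ^ 2) (e i)))
    (v : ι → Fin 2 → K) :
    ∃ φ : A →ₐ[K] SRing K, (∀ i, φ (e i) = linComb K (v i)) ∧ (∀ a ∉ P, IsUnit (φ a)) ∧
      ∀ a ∈ P ^ 2, φ a = 0 := by
  let E : K ≃ₐ[K] A ⧸ P := AlgEquiv.ofBijective (Algebra.ofId K (A ⧸ P)) hP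
  let ε : A →ₐ[K] K := (E.symm : A ⧸ P →ₐ[K] K).comp (Ideal.Quotient.mkₐ K P)
  have hε {a : A} : ε a = 0 ↔ a ∈ P := by
    change E.symm (Ideal.Quotient.mk P a) = 0 ↔ _
    rw [EmbeddingLike.map_eq_zero_iff, Ideal.Quotient.eq_zero_iff_mem]
  -- By independence the prescribed values define a linear map on the span of the classes in `A/P²`;
  -- it is extended to all of `A/P²`.
  obtain ⟨ℓ, hℓ⟩ := LinearMap.exists_extend ((Module.Basis.span hli).constr K v)
  let m : A →ₗ[K] (Fin 2 → K) := ℓ ∘ₗ (Ideal.Quotient.mkₐ K (P ^ 2)).toLinearMap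
  have hm {a : A} (ha : a ∈ P ^ 2) : m a = 0 := by
    change ℓ (Ideal.Quotient.mk (P ^ 2) a) = 0
    rw [Ideal.Quotient.eq_zero_iff_mem.2 ha, map_zero]
  have hme (i : ι) : m (e i) = v i := by
    have := DFunLike.congr_fun hℓ (Module.Basis.span hli i)
    rw [Module.Basis.constr_basis, LinearMap.comp_apply, Submodule.subtype_apply,
      Module.Basis.span_apply] at this
    exact this
  have hsub (a : A) : a - algebraMap K A (ε a) ∈ P := by
    rw [← hε, map_sub, AlgHom.commutes]
    exact sub_self _
  let d (a : A) : Fin 2 → K := m (a - algebraMap K A (ε a))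
  have dadd (a b : A) : d (a + b) = d a + d b := by
    simp only [d]
    rw [← map_add, map_add ε, map_add (algebraMap K A), add_sub_add_comm]
  -- The map `d` is a derivation along `ε`, because `m` vanishes on products of two elements of `P`.
  -- Linear combinations of `s` and `t` have product zero, so `ε + linComb d` is multiplicative.
  have dmul (a b : A) : d (a * b) = ε a • d b + ε b • d a := by
    have h : m ((a - algebraMap K A (ε a)) * (b - algebraMap K A (ε b))) = 0 := by
      apply hm
      rw [pow_two]
      exact Ideal.mul_mem_mul (hsub a) (hsub b)
    have h2 : a * b - algebraMap K A (ε (a * b)) = ε a • (b - algebraMap K A (ε b)) +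
        ε b • (a - algebraMap K A (ε a)) +
        (a - algebraMap K A (ε a)) * (b - algebraMap K A (ε b)) := by
      rw [Algebra.smul_def, Algebra.smul_def, map_mul, map_mul]
      ring
    simp only [d]
    rw [h2, map_add, map_add, h, add_zero, map_smul, map_smul]
  have dK (r : K) : d (algebraMap K A r) = 0 := by
    simp only [d, AlgHom.commutes]
    exact (congrArg m (sub_self _)).trans (map_zero m)
  let φ : A →ₐ[K] SRing K :=
    { toFun a := algebraMap K (SRing K) (ε a) + linComb K (d a)
      map_one' := by
        have := dK 1
        rw [map_one] at this
        rw [this, linComb_zero, add_zero, map_one, map_one]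
      map_zero' := by
        have := dK 0
        rw [map_zero] at this
        rw [this, linComb_zero, add_zero, map_zero, map_zero]
      map_add' a b := by
        rw [dadd, map_add, map_add, linComb_add]
        ring
      map_mul' a b := by
        rw [dmul, map_mul, map_mul, linComb_add, linComb_smul, linComb_smul]
        linear_combination - linComb_mul_linComb K (d a) (d b)
      commutes' r := by
        rw [dK, linComb_zero, add_zero, AlgHom.commutes]
        rfl }
  have hφP {a : A} (ha : a ∈ P) : φ a = linComb K (m a) := by
    change algebraMap K (SRing K) (ε a) + linComb K (m (a - algebraMap K A (ε a))) = _
    rw [hε.2 ha, map_zero, map_zero, sub_zero, zero_add]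
  refine ⟨φ, fun i => ?_, fun a ha => ?_, fun a ha => ?_⟩
  · rw [hφP (he i), hme]
  · exact isUnit_algebraMap_add_linComb K (mt hε.1 ha) _
  · rw [hφP (Ideal.pow_le_self two_ne_zero ha), hm ha, linComb_zero]

end Augmented

variable (K : Type u) [Field K]

/-- The coordinates of the entries of the matrices over `S`. -/
def barCoord : EntryIndex → Fin 2 → K :=
  Sum.elim (fun p => ![if (p.2 : ℕ) = p.1 then 1 else 0, if (p.2 : ℕ) = p.1 + 2 then 1 else 0])
    (fun p => ![if (p.2 : ℕ) = p.1 then 1 else 0, if (p.2 : ℕ) = p.1 + 4 then 1 else 0])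

lemma linComb_barCoord_inl (i : Fin 2) (a : Fin 4) :
    linComb K (barCoord K (Sum.inl (i, a))) = barX K i a := by
  fin_cases i <;> fin_cases a <;> simp [linComb, barCoord, barX]

lemma linComb_barCoord_inr (a : Fin 4) (j : Fin 8) :
    linComb K (barCoord K (Sum.inr (a, j))) = barY K a j := by
  fin_cases a <;> fin_cases j <;> simp [linComb, barCoord, barY]

/-- The homomorphism from `R` to `S`; it factors through every infinitesimal neighborhood of `P`
of order at least one. -/
lemma exists_isSpecialization_hRing : ∃ φ : HRing K →ₐ[K] SRing K,
    IsSpecialization (matX K) (matY K) φ ∧ (∀ a ∉ idealP K, IsUnit (φ a)) ∧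
      ∀ a ∈ idealP K ^ 2, φ a = 0 := by
  obtain ⟨φ, h1, h2, h3⟩ := exists_algHom_apply_eq_linComb (algebraMap_quotient_bijective K)
    (entry_mem_idealP K) (linearIndependent_entry K) (barCoord K)
  refine ⟨φ, ⟨?_, ?_⟩, h2, h3⟩
  · ext i a
    exact (h1 (Sum.inl (i, a))).trans (linComb_barCoord_inl K i a)
  · ext a j
    exact (h1 (Sum.inr (a, j))).trans (linComb_barCoord_inr K a j)

end RigidityCounterexample

/-! ### Passage to the localization and the completion. -/

namespace RigidityCounterexample

variable {K : Type u} [Field K] {A : Type u} [CommRing A] [Algebra K A]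
  {X : Matrix (Fin 2) (Fin 4) A} {Y : Matrix (Fin 4) (Fin 8) A}

/-- Base change of the data along a flat extension of Noetherian rings. -/
lemma isCounterexample_map {B : Type u} [CommRing B] [Algebra K B] [Algebra A B]
    [IsScalarTower K A B] [Module.Flat A B] (hB : IsNoetherianRing B)
    (hX : Function.Injective X.vecMulLinear)
    (hXY : Function.Exact X.vecMulLinear Y.vecMulLinear) {φ : A →ₐ[K] SRing K}
    (hφ : IsSpecialization X Y φ) (ψ : B →ₐ[K] SRing K)
    (hψ : ∀ a, ψ (algebraMap A B a) = φ a) :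
    IsCounterexample (K := K) (X.map (algebraMap A B)) (Y.map (algebraMap A B)) := by
  refine isCounterexample_of_exists_isSpecialization hB
    (RowCokernel.vecMulLinear_map_injective B hX) (RowCokernel.vecMulLinear_map_exact B hXY)
    ⟨ψ, ?_, ?_⟩
  · rw [← hφ.1]
    ext i j
    exact hψ _
  · rw [← hφ.2]
    ext i j
    exact hψ _

lemma exists_algHom_localization {P : Ideal A} [P.IsPrime] {φ : A →ₐ[K] SRing K}
    (h1 : ∀ a ∉ P, IsUnit (φ a)) (h2 : ∀ a ∈ P ^ 2, φ a = 0) :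
    ∃ ψ : Localization.AtPrime P →ₐ[K] SRing K,
      (∀ a, ψ (algebraMap A (Localization.AtPrime P) a) = φ a) ∧
      ∀ b ∈ IsLocalRing.maximalIdeal (Localization.AtPrime P) ^ 2, ψ b = 0 := by
  let ψ : Localization.AtPrime P →ₐ[K] SRing K :=
    IsLocalization.liftAlgHom (M := P.primeCompl) (f := φ) fun y => h1 y y.2
  have hψ (a : A) : ψ (algebraMap A (Localization.AtPrime P) a) = φ a :=
    IsLocalization.lift_eq _ a
  refine ⟨ψ, hψ, fun b hb => ?_⟩
  rw [← Localization.AtPrime.map_eq_maximalIdeal, ← Ideal.map_pow] at hb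
  have : Ideal.map (algebraMap A (Localization.AtPrime P)) (P ^ 2) ≤ RingHom.ker ψ := by
    rw [Ideal.map_le_iff_le_comap]
    intro a ha
    exact (hψ a).trans (h2 a ha)
  exact this hb

/-- The homomorphism factors through `A/m²`, and the completion maps to this quotient. -/
lemma exists_algHom_completion [IsLocalRing A] {φ : A →ₐ[K] SRing K}
    (h : ∀ a ∈ IsLocalRing.maximalIdeal A ^ 2, φ a = 0) :
    ∃ ψ : LocalCompletion A →ₐ[K] SRing K, ∀ a, ψ (algebraMap A (LocalCompletion A) a) = φ a :=
  ⟨(Ideal.Quotient.liftₐ (IsLocalRing.maximalIdeal A ^ 2) φ h).comp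
    ((AdicCompletion.evalₐ (IsLocalRing.maximalIdeal A) 2).restrictScalars K), fun _ => rfl⟩

end RigidityCounterexample
end

open RigidityCounterexample in
theorem theorem3 (K : Type u) [Field K] :
    Algebra.FiniteType K (HRing K) ∧
    (∃ _ : (idealP K).IsMaximal,
      Function.Bijective (algebraMap K (HRing K ⧸ idealP K)) ∧
      (∀ e : EntryIndex, entry K e ∈ idealP K) ∧
      LinearIndependent K
        (fun e : EntryIndex => Ideal.Quotient.mk (idealP K ^ 2) (entry K e)) ∧
      IsCounterexample (K := K) (matX K) (matY K) ∧
      IsCounterexample (K := K)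
        ((matX K).map (algebraMap (HRing K) (Localization.AtPrime (idealP K))))
        ((matY K).map (algebraMap (HRing K) (Localization.AtPrime (idealP K)))) ∧
      IsLocalRing (LocalCompletion (Localization.AtPrime (idealP K))) ∧
      IsCounterexample (K := K)
        ((matX K).map (fun a => algebraMap (Localization.AtPrime (idealP K))
          (LocalCompletion (Localization.AtPrime (idealP K)))
            (algebraMap (HRing K) (Localization.AtPrime (idealP K)) a)))
        ((matY K).map (fun a => algebraMap (Localization.AtPrime (idealP K))
          (LocalCompletion (Localization.AtPrime (idealP K)))
            (algebraMap (HRing K) (Localization.AtPrime (idealP K)) a)))) ∧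
    ¬ RigidityConjecture.{u} := by
  obtain ⟨φ, hφ, h1, h2⟩ := exists_isSpecialization_hRing K
  have hR := isNoetherianRing_hRing K
  have hX := vecMulLinear_matX_injective K
  have hXY := exact_matX_matY K
  have hc := isCounterexample_of_exists_isSpecialization hR hX hXY ⟨φ, hφ⟩
  have hP := idealP_isMaximal K
  have hL : IsNoetherianRing (Localization.AtPrime (idealP K)) :=
    IsLocalization.isNoetherianRing (idealP K).primeCompl _ hR
  have hF : Module.Flat (HRing K) (Localization.AtPrime (idealP K)) :=
    IsLocalization.flat _ (idealP K).primeCompl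
  obtain ⟨ψ, hψ, h3⟩ := exists_algHom_localization h1 h2
  obtain ⟨χ, hχ⟩ := exists_algHom_completion h3
  have hcL := isCounterexample_map hL hX hXY hφ ψ hψ
  have hψs : IsSpecialization
      ((matX K).map (algebraMap (HRing K) (Localization.AtPrime (idealP K))))
      ((matY K).map (algebraMap (HRing K) (Localization.AtPrime (idealP K)))) ψ := by
    constructor
    · rw [← hφ.1]
      ext i j
      exact hψ _
    · rw [← hφ.2]
      ext i j
      exact hψ _
  have hN : IsNoetherianRing (LocalCompletion (Localization.AtPrime (idealP K))) :=
    AdicCompletion.isNoetherianRing _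
  refine ⟨finiteType_hRing K, ⟨hP, algebraMap_quotient_bijective K, entry_mem_idealP K,
    linearIndependent_entry K, hc, hcL, inferInstance, ?_⟩, hc.not_rigidityConjecture⟩
  -- The completion is flat over the Noetherian ring `R_P`, so exactness is transported a second
  -- time.
  have := isCounterexample_map hN hcL.injective hcL.exact hψs χ hχ
  rwa [Matrix.map_map, Matrix.map_map] at this
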